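/- Let $M$ be an $m$-dimensional smooth Riemannian manifold (Hausdorff, second countable, without boundary), with volume measure $\mathrm{vol}$, Levi-Civita connection $\nabla$, Ricci curvature $\mathrm{Ric}$ and scalar curvature $\mathrm{Sc}$. Let $\Omega\subset M$ be open, and let $f\colon M\to\mathbb R$ be a function that is smooth and has no critical points on $\Omega$. On $\Omega$ set $u=\nabla f/|\nabla f|$. For $x\in\Omega$ let $L_x=f^{-1}(f(x))$, which near $x$ is a smooth hypersurface, and let $\kappa_1(x)\le\dots\le\kappa_{m-1}(x)$ be the principal curvatures of $L_x$ at $x$, that is, the eigenvalues of the shape operator $v\mapsto\nabla_v u$ on $T_xL_x$. Put $$H(x)=\sum_{i}\kappa_i(x),\qquad G(x)=2\sum_{i<j}\kappa_i(x)\,\kappa_j(x),$$ and let $\mathrm{Int}_f(x)$ be the scalar curvature at $x$ of $L_x$ with its induced Riemannian metric. Put $\mathrm{Str}(u)=\mathrm{Sc}-\langle\mathrm{Ric}\,u,u\rangle$. Let $\varphi\colon\Omega\to\mathbb R$ be a smooth function with compact support in $\Omega$. Then all the integrands below are integrable on $\Omega$ with respect to $\mathrm{vol}$, and $$\int_\Omega\varphi\,\langle\mathrm{Ric}\,u,u\rangle\,d\mathrm{vol}=\int_\Omega\bigl[\varphi\,G+H\,\langle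 u,\nabla\varphi\rangle-\langle\nabla\varphi,\nabla_u u\rangle\bigr]\,d\mathrm{vol}$$ and $$\int_\Omega\varphi\,\mathrm{Str}(u)\,d\mathrm{vol}=\int_\Omega\bigl[H\,\langle u,\nabla\varphi\rangle-\langle\nabla\varphi,\nabla_u u\rangle\bigr]\,d\mathrm{vol}+\int_\Omega\varphi\,\mathrm{Int}_f\,d\mathrm{vol}.$$ -/

import Mathlib

open Bundle Manifold MeasureTheory Set Topology
open scoped ContDiff

noncomputable section

namespace RiemannianGeometry

/-- The coordinate space `ℝⁿ`. -/
abbrev Coord (n : ℕ) : Type := EuclideanSpace ℝ (Fin n)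

/-! ### Curvature of a metric tensor given by its matrix in coordinates -/

section Coordinates

variable {n : ℕ}

/-- The partial derivative `∂ᵢ F (y)`. -/
def partialDeriv (i : Fin n) (F : Coord n → ℝ) (y : Coord n) : ℝ :=
  fderiv ℝ F y (EuclideanSpace.single i 1)

/-- The Christoffel symbols
`Γᵏᵢⱼ = ½ ∑ₗ gᵏˡ (∂ᵢ gⱼₗ + ∂ⱼ gᵢₗ - ∂ₗ gᵢⱼ)` of the metric tensor with matrix `g`. -/
def christoffel (g : Coord n → Matrix (Fin n) (Fin n) ℝ) (k i j : Fin n) (y : Coord n) : ℝ :=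
  (1 / 2 : ℝ) * ∑ l, (g y)⁻¹ k l *
    (partialDeriv i (fun z => g z j l) y + partialDeriv j (fun z => g z i l) y
      - partialDeriv l (fun z => g z i j) y)

/-- The components of the Ricci tensor,
`Ricⱼₖ = ∑ᵢ (∂ᵢ Γⁱⱼₖ - ∂ⱼ Γⁱᵢₖ + ∑ₚ (Γⁱᵢₚ Γᵖⱼₖ - Γⁱⱼₚ Γᵖᵢₖ))`
(positive on round spheres of dimension at least two). -/
def ricciCoord (g : Coord n → Matrix (Fin n) (Fin n) ℝ) (j k : Fin n) (y : Coord n) : ℝ :=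
  ∑ i, (partialDeriv i (christoffel g i j k) y - partialDeriv j (christoffel g i i k) y
    + ∑ p, (christoffel g i i p y * christoffel g p j k y
      - christoffel g i j p y * christoffel g p i k y))

/-- The scalar curvature `∑ⱼₖ gʲᵏ Ricⱼₖ`. -/
def scalarCoord (g : Coord n → Matrix (Fin n) (Fin n) ℝ) (y : Coord n) : ℝ :=
  ∑ j, ∑ k, (g y)⁻¹ j k * ricciCoord g j k y

end Coordinates

section Riemannian

variable (m : ℕ) {M : Type*} [TopologicalSpace M] [ChartedSpace (Coord m) M]

instance (x : M) : FiniteDimensional ℝ (TangentSpace (𝓡 m) x) :=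
  inferInstanceAs (FiniteDimensional ℝ (Coord m))

variable [RiemannianBundle (fun x : M => TangentSpace (𝓡 m) x)]

instance (x : M) : CompleteSpace (TangentSpace (𝓡 m) x) :=
  FiniteDimensional.complete ℝ _

/-- The matrix `⟨∂ᵢψ, ∂ⱼψ⟩` of the pullback of the Riemannian metric of `M` along a map `ψ` from
a coordinate space to `M`. For the inverse of a chart this is the metric tensor in the chart; for
a parametrization of a submanifold it is the induced metric (the first fundamental form). -/
def pullbackMetric {n : ℕ} (ψ : Coord n → M) (y : Coord n) : Matrix (Fin n) (Fin n) ℝ :=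
  Matrix.of fun i j =>
    inner ℝ (mfderiv (𝓡 n) (𝓡 m) ψ y
        ((NormedSpace.fromTangentSpace y).symm (EuclideanSpace.single i (1 : ℝ))))
      (mfderiv (𝓡 n) (𝓡 m) ψ y
        ((NormedSpace.fromTangentSpace y).symm (EuclideanSpace.single j (1 : ℝ))))

/-- The matrix of the metric tensor in the preferred chart around `x`. -/
def chartMetric (x : M) : Coord m → Matrix (Fin m) (Fin m) ℝ :=
  pullbackMetric m (chartAt (Coord m) x).symm

/-- The differential at `x` of the preferred chart around `x`; it sends a tangent vector to the
vector of its components. -/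
def chartDiff (x : M) : TangentSpace (𝓡 m) x →L[ℝ] Coord m :=
  mvfderiv (𝓡 m) (chartAt (Coord m) x) x

/-- The Ricci form `Ric(v, w) = ⟨Ric v, w⟩`. -/
def ricci (x : M) (v w : TangentSpace (𝓡 m) x) : ℝ :=
  ∑ j, ∑ k, ricciCoord (chartMetric m x) j k (chartAt (Coord m) x x)
    * chartDiff m x v j * chartDiff m x w k

/-- The scalar curvature `Sc`. -/
def scalarCurvature (x : M) : ℝ :=
  scalarCoord (chartMetric m x) (chartAt (Coord m) x x)

/-- The strange curvature `Str(v) = Sc - ⟨Ric v, v⟩` (of a unit vector `v`). -/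
def strange (x : M) (v : TangentSpace (𝓡 m) x) : ℝ :=
  scalarCurvature m x - ricci m x v v

/-- The components, in the preferred chart around `x`, of a vector field `X`. -/
def fieldInChart (X : ∀ z : M, TangentSpace (𝓡 m) z) (x : M) (y : Coord m) : Coord m :=
  mvfderiv (𝓡 m) (chartAt (Coord m) x) ((chartAt (Coord m) x).symm y)
    (X ((chartAt (Coord m) x).symm y))

/-- The Levi-Civita covariant derivative `v ↦ ∇_v X` at `x`: in the preferred chart around `x`,
`(∇_v X)ᵏ = dXᵏ(v) + ∑ᵢⱼ Γᵏᵢⱼ vⁱ Xʲ`. -/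
def covDeriv (X : ∀ z : M, TangentSpace (𝓡 m) z) (x : M) :
    TangentSpace (𝓡 m) x →L[ℝ] TangentSpace (𝓡 m) x :=
  (chartDiff m x).inverse ∘L
    (fderiv ℝ (fieldInChart m X x) (chartAt (Coord m) x x)
      + Matrix.toEuclideanCLM (n := Fin m) (𝕜 := ℝ) (Matrix.of fun k i =>
          ∑ j, christoffel (chartMetric m x) k i j (chartAt (Coord m) x x)
            * fieldInChart m X x (chartAt (Coord m) x x) j)) ∘L
    chartDiff m x

/-- The Riemannian gradient: `⟨∇f, v⟩ = df(v)`. -/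
def grad (f : M → ℝ) (x : M) : TangentSpace (𝓡 m) x :=
  (InnerProductSpace.toDual ℝ (TangentSpace (𝓡 m) x)).symm (mvfderiv (𝓡 m) f x)

/-- The field `u = ∇f / |∇f|` of unit normals to the level sets of `f`. -/
def unitNormal (f : M → ℝ) (x : M) : TangentSpace (𝓡 m) x :=
  ‖grad m f x‖⁻¹ • grad m f x

/-- The tangent space at `x` of the level set of `f` through the regular point `x`. -/
def levelTangent (f : M → ℝ) (x : M) : Submodule ℝ (TangentSpace (𝓡 m) x) :=
  LinearMap.ker (mvfderiv (𝓡 m) f x).toLinearMap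

/-- The shape operator `v ↦ ∇_v u` of the level set of `f` through `x`, with respect to the unit
normal `u = ∇f / |∇f|`. (The vector `∇_v u` is tangent to the level set because `|u| = 1`, so the
orthogonal projection only adjusts the codomain.) -/
def shapeOperator (f : M → ℝ) (x : M) : levelTangent m f x →ₗ[ℝ] levelTangent m f x :=
  ((levelTangent m f x).orthogonalProjectionOnto ∘L covDeriv m (unitNormal m f) x ∘L
    (levelTangent m f x).subtypeL).toLinearMap

/-- The principal curvatures of the level set of `f` through `x`: the eigenvalues of the (symmetric)
shape operator, counted with multiplicity. -/
def principalCurvatures (f : M → ℝ) (x : M) : Multiset ℝ :=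
  (shapeOperator m f x).charpoly.roots

/-- The mean curvature `H = ∑ᵢ κᵢ` of the level set of `f` through `x`. -/
def meanCurvature (f : M → ℝ) (x : M) : ℝ :=
  (principalCurvatures m f x).sum

/-- The extrinsic term `G = 2 ∑_{i<j} κᵢ κⱼ` in the Gauss formula for the level set of `f`
through `x`. -/
def extrinsicGauss (f : M → ℝ) (x : M) : ℝ :=
  2 * (principalCurvatures m f x).esymm 2

/-- `ψ`, defined on the open neighbourhood `V` of `0` in `ℝⁿ`, is a smooth parametrization, with
`ψ 0 = x`, of a neighbourhood of `x` in the `n`-dimensional submanifold `S` of `M`. -/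
structure IsLocalParametrization {n : ℕ} (S : Set M) (x : M) (V : Set (Coord n))
    (ψ : Coord n → M) : Prop where
  isOpen : IsOpen V
  zero_mem : (0 : Coord n) ∈ V
  map_zero : ψ 0 = x
  contMDiffOn : ContMDiffOn (𝓡 n) (𝓡 m) ∞ ψ V
  injective_mfderiv : ∀ y ∈ V, Function.Injective (mfderiv (𝓡 n) (𝓡 m) ψ y)
  injOn : InjOn ψ V
  mapsTo : MapsTo ψ V S
  image_mem : ψ '' V ∈ 𝓝[S] x

open Classical in
/-- The (intrinsic) scalar curvature at `x` of the `n`-dimensional submanifold `S` of `M` with the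
induced Riemannian metric, computed in a local parametrization around `x`. (It does not depend on
the parametrization; the value is `0` by convention if there is none.) -/
def submanifoldScalarCurvature (n : ℕ) (S : Set M) (x : M) : ℝ :=
  if h : ∃ ψ : Coord n → M, ∃ V : Set (Coord n), IsLocalParametrization m S x V ψ then
    scalarCoord (pullbackMetric m h.choose) 0
  else 0

/-- `Int_f`: the scalar curvature at `x` of the level set `f⁻¹(f(x))` with its induced metric. -/
def levelScalarCurvature (f : M → ℝ) (x : M) : ℝ :=
  submanifoldScalarCurvature m (m - 1) (f ⁻¹' {f x}) x

variable (M) in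
/-- The Riemannian volume: in each chart of the atlas it is `√(det g) dy`. The measures of the
charts, extended by zero, agree on the overlaps, and their supremum glues them. -/
def riemannianVolume [MeasurableSpace M] : Measure M :=
  ⨆ x : M, (((volume : Measure (Coord m)).restrict (chartAt (Coord m) x).target).withDensity
    (fun y => ENNReal.ofReal (Real.sqrt (chartMetric m x y).det))).map (chartAt (Coord m) x).symm

end Riemannian

end RiemannianGeometry

end

/-! Write A = ∇u on Ω. Since |u| = 1, A takes values in u^⊥, the tangent space of the level set, so
the traces of A and A² on the whole tangent space equal those of the shape operator and of its
square. The shape operator is symmetric, hence diagonalizable, and Newton's identity gives H = tr A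
and G = (tr A)² - tr A². Commuting covariant derivatives in ∇(∇_u u) and tracing gives the Bochner
identity (`divergence_bochner`) div(∇_u u - H u) = tr A² + Ric(u,u) - H² = Ric(u,u) - G. After
multiplication by φ, the function φ Ric(u,u) - φ G - H⟨u,∇φ⟩ + ⟨∇φ,∇_u u⟩ is the divergence of the
compactly supported field φ(∇_u u - H u). Its integral vanishes, which is the first formula. The
second follows from it by the traced Gauss equation Int_f = Sc - 2 Ric(u,u) + G, that is, Str(u) =
Int_f + Ric(u,u) - G.

The geometric quantities at a point are defined through the preferred chart of that very point,
while differentiating and integrating need one fixed chart. The calculus is therefore developed on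
open subsets of normed spaces for a metric g with Christoffel form Γ (`IsLeviCivita`), and maps
between such spaces are treated as isometric immersions. The second fundamental form is normal
(`secondFundamental_normal`). This is used twice: for changes of charts it vanishes, so Ricci and ∇
do not depend on the chart (`ricci_eq_ricciForm`, `mvfderiv_covDeriv`), and for parametrizations of
level sets it is the shape operator, so that `gauss_equation` traces to the Gauss formula
(`scalarCoord_pullbackMetric`).

For the integral, the chart measures √det g dy agree on overlaps by the change of variables formula,
so their supremum restricts to each of them (`riemannianVolume_apply`). In a chart, √det g · div X
is the flat divergence of √det g · X, which integrates to zero for compactly supported fields; a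
partition of unity reduces the general φ to this case. -/

noncomputable section

namespace RiemannianGeometry

/-! ### Connections on open subsets of normed spaces -/

section AbstractCalculus

variable {E F G : Type*} [NormedAddCommGroup E] [NormedSpace ℝ E]
  [NormedAddCommGroup F] [NormedSpace ℝ F] [NormedAddCommGroup G] [NormedSpace ℝ G]

/-- The covariant derivative in the direction `v` of the field `X` along the map `ξ`. -/
def covAlong (Γ : E → E →L[ℝ] E →L[ℝ] E) (ξ X : F → E) (v t : F) : E :=
  fderiv ℝ X t v + Γ (ξ t) (fderiv ℝ ξ t v) (X t)

/-- The curvature `R(v, w)z` of the connection with Christoffel form `Γ`. -/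
def curvature (Γ : E → E →L[ℝ] E →L[ℝ] E) (y v w z : E) : E :=
  fderiv ℝ Γ y v w z - fderiv ℝ Γ y w v z + Γ y v (Γ y w z) - Γ y w (Γ y v z)

/-- `Γ` is the Christoffel form of the Levi-Civita connection of the metric `g` on the open
set `U`. -/
structure IsLeviCivita (U : Set E) (g : E → E →L[ℝ] E →L[ℝ] ℝ)
    (Γ : E → E →L[ℝ] E →L[ℝ] E) : Prop where
  isOpen : IsOpen U
  contDiffOn_metric : ContDiffOn ℝ ∞ g U
  contDiffOn_connection : ContDiffOn ℝ ∞ Γ U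
  metric_symm : ∀ y ∈ U, ∀ v w, g y v w = g y w v
  metric_pos : ∀ y ∈ U, ∀ v, v ≠ 0 → 0 < g y v v
  connection_symm : ∀ y ∈ U, ∀ v w, Γ y v w = Γ y w v
  fderiv_metric : ∀ y ∈ U, ∀ v w z, fderiv ℝ g y v w z = g y (Γ y v w) z + g y w (Γ y v z)

theorem hasFDerivAt_comp_fun {B : E → G} {ξ : F → E} {t : F} (hB : DifferentiableAt ℝ B (ξ t))
    (hξ : DifferentiableAt ℝ ξ t) :
    HasFDerivAt (fun s => B (ξ s)) ((fderiv ℝ B (ξ t)).comp (fderiv ℝ ξ t)) t :=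
  hB.hasFDerivAt.comp t hξ.hasFDerivAt

theorem fderiv_bilinear_apply {B : E → E →L[ℝ] E →L[ℝ] G} {ξ X Y : F → E} {t : F}
    (hB : DifferentiableAt ℝ B (ξ t)) (hξ : DifferentiableAt ℝ ξ t)
    (hX : DifferentiableAt ℝ X t) (hY : DifferentiableAt ℝ Y t) (v : F) :
    fderiv ℝ (fun s => B (ξ s) (X s) (Y s)) t v =
      fderiv ℝ B (ξ t) (fderiv ℝ ξ t v) (X t) (Y t) + B (ξ t) (fderiv ℝ X t v) (Y t)
        + B (ξ t) (X t) (fderiv ℝ Y t v) := by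
  have h0 : HasFDerivAt (fun s => B (ξ s)) ((fderiv ℝ B (ξ t)).comp (fderiv ℝ ξ t)) t :=
    hasFDerivAt_comp_fun (G := E →L[ℝ] E →L[ℝ] G) hB hξ
  have h1 := (h0.clm_apply hX.hasFDerivAt).clm_apply hY.hasFDerivAt
  have h2 : fderiv ℝ (fun s => B (ξ s) (X s) (Y s)) t = _ := h1.fderiv
  rw [h2]
  simp
  abel

theorem fderiv_fderiv_apply {X : F → G} {t : F} (hX : ContDiffAt ℝ ∞ X t) (v w : F) :
    fderiv ℝ (fun s => fderiv ℝ X s w) t v = fderiv ℝ (fderiv ℝ X) t v w := by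
  have h : DifferentiableAt ℝ (fderiv ℝ X) t :=
    (hX.fderiv_right (m := 1) (by norm_cast)).differentiableAt (by norm_num)
  have h1 := h.hasFDerivAt.clm_apply (hasFDerivAt_const w t)
  rw [h1.fderiv]
  simp

theorem fderiv_fderiv_comm {X : F → G} {t : F} (hX : ContDiffAt ℝ ∞ X t) (v w : F) :
    fderiv ℝ (fderiv ℝ X) t v w = fderiv ℝ (fderiv ℝ X) t w v :=
  (hX.isSymmSndFDerivAt (by simp only [minSmoothness_of_isRCLikeNormedField]; exact ENat.LEInfty.out)).eq v w

theorem contDiffAt_fderiv_apply {X : F → G} {t : F} (hX : ContDiffAt ℝ ∞ X t) (w : F) :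
    ContDiffAt ℝ ∞ (fun s => fderiv ℝ X s w) t :=
  (hX.fderiv_right (m := ∞) (by norm_cast)).clm_apply contDiffAt_const

theorem contDiffAt_covAlong {Γ : E → E →L[ℝ] E →L[ℝ] E} {ξ X : F → E} {t : F}
    (hΓ : ContDiffAt ℝ ∞ Γ (ξ t)) (hξ : ContDiffAt ℝ ∞ ξ t) (hX : ContDiffAt ℝ ∞ X t) (v : F) :
    ContDiffAt ℝ ∞ (covAlong Γ ξ X v) t :=
  (contDiffAt_fderiv_apply hX v).add
    (((hΓ.comp t hξ).clm_apply (contDiffAt_fderiv_apply hξ v)).clm_apply hX)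

/-- Expanding the two iterated derivatives, the second derivatives of `X` and `ξ` are symmetric and
cancel, as do the mixed first-order terms; what is left is the curvature. No symmetry of `Γ` is
needed. -/
theorem covAlong_comm {Γ : E → E →L[ℝ] E →L[ℝ] E} {ξ X : F → E} {t : F}
    (hΓ : ContDiffAt ℝ ∞ Γ (ξ t)) (hξ : ContDiffAt ℝ ∞ ξ t) (hX : ContDiffAt ℝ ∞ X t) (v w : F) :
    covAlong Γ ξ (covAlong Γ ξ X w) v t - covAlong Γ ξ (covAlong Γ ξ X v) w t =
      curvature Γ (ξ t) (fderiv ℝ ξ t v) (fderiv ℝ ξ t w) (X t) := by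
  have key : ∀ a b, covAlong Γ ξ (covAlong Γ ξ X b) a t =
      fderiv ℝ (fderiv ℝ X) t a b
      + (fderiv ℝ Γ (ξ t) (fderiv ℝ ξ t a) (fderiv ℝ ξ t b) (X t)
        + Γ (ξ t) (fderiv ℝ (fderiv ℝ ξ) t a b) (X t)
        + Γ (ξ t) (fderiv ℝ ξ t b) (fderiv ℝ X t a))
      + (Γ (ξ t) (fderiv ℝ ξ t a) (fderiv ℝ X t b)
        + Γ (ξ t) (fderiv ℝ ξ t a) (Γ (ξ t) (fderiv ℝ ξ t b) (X t))) := by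
    intro a b
    have hb : covAlong Γ ξ X b = (fun s => fderiv ℝ X s b) + fun s => Γ (ξ s) (fderiv ℝ ξ s b) (X s) := rfl
    have e1 := fderiv_fderiv_apply hX a b
    have e2 := fderiv_fderiv_apply hξ a b
    have d1 : ∀ {Z : F → E}, ContDiffAt ℝ ∞ Z t → DifferentiableAt ℝ Z t :=
      fun h => h.differentiableAt (by simp)
    have hd : ContDiffAt ℝ ∞ (fun s => Γ (ξ s) (fderiv ℝ ξ s b) (X s)) t :=
      ((hΓ.comp t hξ).clm_apply (contDiffAt_fderiv_apply hξ b)).clm_apply hX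
    rw [covAlong, hb, fderiv_add (d1 (contDiffAt_fderiv_apply hX b)) (d1 hd),
      _root_.add_apply, e1,
      fderiv_bilinear_apply (hΓ.differentiableAt (by simp)) (d1 hξ)
        (d1 (contDiffAt_fderiv_apply hξ b)) (d1 hX), e2]
    simp
  rw [key, key, curvature, fderiv_fderiv_comm hX w v, fderiv_fderiv_comm hξ w v]
  abel

namespace IsLeviCivita

variable {U : Set E} {g : E → E →L[ℝ] E →L[ℝ] ℝ} {Γ : E → E →L[ℝ] E →L[ℝ] E}

theorem contDiffAt_metric (hg : IsLeviCivita U g Γ) {y : E} (hy : y ∈ U) : ContDiffAt ℝ ∞ g y :=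
  hg.contDiffOn_metric.contDiffAt (hg.isOpen.mem_nhds hy)

theorem contDiffAt_connection (hg : IsLeviCivita U g Γ) {y : E} (hy : y ∈ U) :
    ContDiffAt ℝ ∞ Γ y :=
  hg.contDiffOn_connection.contDiffAt (hg.isOpen.mem_nhds hy)

theorem eq_zero_of_metric (hg : IsLeviCivita U g Γ) {y : E} (hy : y ∈ U) {v : E}
    (h : g y v v = 0) : v = 0 := by
  by_contra hv
  exact (hg.metric_pos y hy v hv).ne' h

theorem fderiv_metric_along (hg : IsLeviCivita U g Γ) {ξ X Y : F → E} {t : F} (ht : ξ t ∈ U)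
    (hξ : DifferentiableAt ℝ ξ t) (hX : DifferentiableAt ℝ X t) (hY : DifferentiableAt ℝ Y t)
    (v : F) : fderiv ℝ (fun s => g (ξ s) (X s) (Y s)) t v =
      g (ξ t) (covAlong Γ ξ X v t) (Y t) + g (ξ t) (X t) (covAlong Γ ξ Y v t) := by
  rw [fderiv_bilinear_apply ((hg.contDiffAt_metric ht).differentiableAt (by simp)) hξ hX hY,
    hg.fderiv_metric _ ht]
  simp only [covAlong, map_add, _root_.add_apply]
  ring

/-- The curvature is antisymmetric in the last two arguments. -/
theorem metric_curvature_antisymm (hg : IsLeviCivita U g Γ) {y : E} (hy : y ∈ U) (v w z r : E) :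
    g y (curvature Γ y v w z) r = - g y (curvature Γ y v w r) z := by
  have hid : ContDiffAt ℝ ∞ (id : E → E) y := contDiffAt_id
  have hc : ∀ z : E, ContDiffAt ℝ ∞ (fun _ : E => z) y := fun z => contDiffAt_const
  have dd : ∀ {Z : E → E} {x : E}, ContDiffAt ℝ ∞ Z x → DifferentiableAt ℝ Z x :=
      fun h => h.differentiableAt (by simp)
  have hcov : ∀ x ∈ U, ∀ z v : E, ContDiffAt ℝ ∞ (covAlong Γ id (fun _ : E => z) v) x := fun x hx z v =>
    contDiffAt_covAlong (hg.contDiffAt_connection hx) contDiffAt_id contDiffAt_const v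
  -- Apply metric compatibility twice to `g z r` for constant fields along the identity map. In the
  -- second derivative the cross terms are symmetric in `v`, `w`, so equality of mixed partials
  -- leaves R(v,w) acting on `z` plus R(v,w) acting on `r`.
  have first : ∀ w, ∀ x ∈ U, fderiv ℝ (fun s => g s z r) x w =
      g x (covAlong Γ id (fun _ => z) w x) r + g x z (covAlong Γ id (fun _ => r) w x) := by
    intro w x hx
    exact hg.fderiv_metric_along (ξ := id) (X := fun _ => z) (Y := fun _ => r) hx
      differentiableAt_id (differentiableAt_const _) (differentiableAt_const _) w
  have dg : DifferentiableAt ℝ g y := (hg.contDiffAt_metric hy).differentiableAt (by simp)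
  have second : ∀ v w, fderiv ℝ (fderiv ℝ (fun s => g s z r)) y v w =
      g y (covAlong Γ id (covAlong Γ id (fun _ => z) w) v y) r
      + g y (covAlong Γ id (fun _ => z) w y) (covAlong Γ id (fun _ => r) v y)
      + (g y (covAlong Γ id (fun _ => z) v y) (covAlong Γ id (fun _ => r) w y)
      + g y z (covAlong Γ id (covAlong Γ id (fun _ => r) w) v y)) := by
    intro v w
    have hgz : ContDiffAt ℝ ∞ (fun s => g s z r) y :=
      ((hg.contDiffAt_metric hy).clm_apply contDiffAt_const).clm_apply contDiffAt_const
    rw [← fderiv_fderiv_apply hgz]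
    have hev : (fun s => fderiv ℝ (fun s => g s z r) s w) =ᶠ[𝓝 y]
        (fun x => g (id x) (covAlong Γ id (fun _ => z) w x) r) + (fun x => g (id x) z (covAlong Γ id (fun _ => r) w x)) :=
      Filter.eventually_of_mem (hg.isOpen.mem_nhds hy) fun x hx => first w x hx
    rw [hev.fderiv_eq, fderiv_add, _root_.add_apply,
      hg.fderiv_metric_along (ξ := id) (X := covAlong Γ id (fun _ => z) w) (Y := fun _ => r) hy
        differentiableAt_id (dd (hcov y hy z w)) (differentiableAt_const _),
      hg.fderiv_metric_along (ξ := id) (X := fun _ => z) (Y := covAlong Γ id (fun _ => r) w) hy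
        differentiableAt_id (differentiableAt_const _) (dd (hcov y hy r w))]
    · rfl
    · exact (dg.clm_apply (dd (hcov y hy z w))).clm_apply (differentiableAt_const _)
    · exact (dg.clm_apply (differentiableAt_const _)).clm_apply (dd (hcov y hy r w))
  have c1 := covAlong_comm (hg.contDiffAt_connection hy) hid (hc z) v w
  have c2 := covAlong_comm (hg.contDiffAt_connection hy) hid (hc r) v w
  simp only [id, ContinuousLinearMap.id_apply, fderiv_id] at c1 c2
  have hgz : ContDiffAt ℝ ∞ (fun s => g s z r) y :=
      ((hg.contDiffAt_metric hy).clm_apply contDiffAt_const).clm_apply contDiffAt_const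
  have hs := fderiv_fderiv_comm hgz v w
  rw [second, second] at hs
  rw [hg.metric_symm y hy _ z, ← c1, ← c2]
  simp only [map_sub, _root_.sub_apply]
  linarith

end IsLeviCivita

/-! ### Isometric immersions and the Gauss equation -/

/-- The second fundamental form of the map `ξ` between spaces with connections `Γ'` and `Γ`. -/
def secondFundamental (Γ : E → E →L[ℝ] E →L[ℝ] E) (Γ' : F → F →L[ℝ] F →L[ℝ] F) (ξ : F → E)
    (t v w : F) : E :=
  covAlong Γ ξ (fun s => fderiv ℝ ξ s w) v t - fderiv ℝ ξ t (Γ' t v w)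

section Immersion

variable {U : Set E} {g : E → E →L[ℝ] E →L[ℝ] ℝ} {Γ : E → E →L[ℝ] E →L[ℝ] E}
  {V : Set F} {h : F → F →L[ℝ] F →L[ℝ] ℝ} {Γ' : F → F →L[ℝ] F →L[ℝ] F} {ξ : F → E}

/-- `ξ` is a smooth isometric immersion of `(V, h)` in `(U, g)`. -/
structure IsIsometricOn (U : Set E) (g : E → E →L[ℝ] E →L[ℝ] ℝ) (V : Set F)
    (h : F → F →L[ℝ] F →L[ℝ] ℝ) (ξ : F → E) : Prop where
  contDiffOn : ContDiffOn ℝ ∞ ξ V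
  mapsTo : MapsTo ξ V U
  metric_eq : ∀ t ∈ V, ∀ v w, h t v w = g (ξ t) (fderiv ℝ ξ t v) (fderiv ℝ ξ t w)

/-- This is `h = ξ^* g` differentiated, with the metric compatibility of `Γ` used along `ξ`. It is
the analogue for `Γ` of the compatibility of `Γ'` with `h`; comparing the two controls the second
fundamental form. -/
theorem fderiv_metric_immersion (hg : IsLeviCivita U g Γ) (hh : IsLeviCivita V h Γ')
    (hi : IsIsometricOn U g V h ξ) {t : F} (ht : t ∈ V) (v w z : F) :
    fderiv ℝ h t v w z = g (ξ t) (covAlong Γ ξ (fun s => fderiv ℝ ξ s w) v t) (fderiv ℝ ξ t z)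
      + g (ξ t) (fderiv ℝ ξ t w) (covAlong Γ ξ (fun s => fderiv ℝ ξ s z) v t) := by
  have hξ : ContDiffAt ℝ ∞ ξ t := hi.contDiffOn.contDiffAt (hh.isOpen.mem_nhds ht)
  have dd : ∀ {Z : F → E}, ContDiffAt ℝ ∞ Z t → DifferentiableAt ℝ Z t :=
    fun h => h.differentiableAt (by simp)
  have h1 := hg.fderiv_metric_along (X := fun s => fderiv ℝ ξ s w) (Y := fun s => fderiv ℝ ξ s z)
    (hi.mapsTo ht) (dd hξ) (dd (contDiffAt_fderiv_apply hξ w)) (dd (contDiffAt_fderiv_apply hξ z)) v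
  rw [← h1]
  have hev : (fun s => g (ξ s) (fderiv ℝ ξ s w) (fderiv ℝ ξ s z)) =ᶠ[𝓝 t] fun s => h (id s) w z :=
    Filter.eventually_of_mem (hh.isOpen.mem_nhds ht) fun s hs => (hi.metric_eq s hs w z).symm
  rw [hev.fderiv_eq, fderiv_bilinear_apply (X := fun _ => w) (Y := fun _ => z)
    ((hh.contDiffAt_metric ht).differentiableAt (by simp)) differentiableAt_id
    (differentiableAt_const _) (differentiableAt_const _)]
  simp

theorem secondFundamental_symm (hg : IsLeviCivita U g Γ) (hh : IsLeviCivita V h Γ')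
    (hi : IsIsometricOn U g V h ξ) {t : F} (ht : t ∈ V) (v w : F) :
    secondFundamental Γ Γ' ξ t v w = secondFundamental Γ Γ' ξ t w v := by
  have hξ : ContDiffAt ℝ ∞ ξ t := hi.contDiffOn.contDiffAt (hh.isOpen.mem_nhds ht)
  rw [secondFundamental, secondFundamental, covAlong, covAlong, fderiv_fderiv_apply hξ,
    fderiv_fderiv_apply hξ, fderiv_fderiv_comm hξ, hh.connection_symm t ht v w,
    hg.connection_symm _ (hi.mapsTo ht) (fderiv ℝ ξ t v)]

/-- The trilinear form T(v,w,z) = g(II(v,w), dξ z) is symmetric in `v`, `w` because both connections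
are torsion free, and antisymmetric in `w`, `z` because both are metric. Such a form is zero,
exactly as in the uniqueness proof for the Levi-Civita connection. -/
theorem secondFundamental_normal (hg : IsLeviCivita U g Γ) (hh : IsLeviCivita V h Γ')
    (hi : IsIsometricOn U g V h ξ) {t : F} (ht : t ∈ V) (v w z : F) :
    g (ξ t) (secondFundamental Γ Γ' ξ t v w) (fderiv ℝ ξ t z) = 0 := by
  have anti : ∀ v w z, g (ξ t) (secondFundamental Γ Γ' ξ t v w) (fderiv ℝ ξ t z)
      + g (ξ t) (secondFundamental Γ Γ' ξ t v z) (fderiv ℝ ξ t w) = 0 := by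
    intro v w z
    have h1 := fderiv_metric_immersion hg hh hi ht v w z
    rw [hh.fderiv_metric t ht, hi.metric_eq t ht, hi.metric_eq t ht] at h1
    rw [hg.metric_symm _ (hi.mapsTo ht) _ (fderiv ℝ ξ t w)]
    simp only [secondFundamental, map_sub, _root_.sub_apply]
    linarith
  have s := fun v w => secondFundamental_symm hg hh hi ht v w
  have a1 := anti v w z
  have a2 := anti w v z
  have a3 := anti z v w
  rw [s w v] at a2
  rw [s z v, s z w] at a3
  linarith

/-- The Gauss equation. -/
theorem gauss_equation (hg : IsLeviCivita U g Γ) (hh : IsLeviCivita V h Γ')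
    (hi : IsIsometricOn U g V h ξ) {t : F} (ht : t ∈ V) (v w z r : F) :
    g (ξ t) (curvature Γ (ξ t) (fderiv ℝ ξ t v) (fderiv ℝ ξ t w) (fderiv ℝ ξ t z))
        (fderiv ℝ ξ t r) =
      h t (curvature Γ' t v w z) r
        - g (ξ t) (secondFundamental Γ Γ' ξ t w z) (secondFundamental Γ Γ' ξ t v r)
        + g (ξ t) (secondFundamental Γ Γ' ξ t v z) (secondFundamental Γ Γ' ξ t w r) := by
  have hξ' : ∀ s ∈ V, ContDiffAt ℝ ∞ ξ s := fun s hs =>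
    hi.contDiffOn.contDiffAt (hh.isOpen.mem_nhds hs)
  have hξ := hξ' t ht
  have hU := hi.mapsTo ht
  have dd : ∀ {Z : F → E}, ContDiffAt ℝ ∞ Z t → DifferentiableAt ℝ Z t :=
    fun h => h.differentiableAt (by simp)
  have key : ∀ v w, g (ξ t) (covAlong Γ ξ (covAlong Γ ξ (fun s => fderiv ℝ ξ s z) w) v t)
      (fderiv ℝ ξ t r) = h t (fderiv ℝ Γ' t v w z + Γ' t v (Γ' t w z)) r
        - g (ξ t) (secondFundamental Γ Γ' ξ t w z) (secondFundamental Γ Γ' ξ t v r) := by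
    intro v w
    have hX : ContDiffAt ℝ ∞ (covAlong Γ ξ (fun s => fderiv ℝ ξ s z) w) t :=
      contDiffAt_covAlong (hg.contDiffAt_connection hU) hξ (contDiffAt_fderiv_apply hξ z) w
    have h1 := hg.fderiv_metric_along (X := covAlong Γ ξ (fun s => fderiv ℝ ξ s z) w)
      (Y := fun s => fderiv ℝ ξ s r) hU (dd hξ) (dd hX) (dd (contDiffAt_fderiv_apply hξ r)) v
    -- Since II is normal, pairing ∇_w(dξ z) with dξ r only sees the tangential part Γ'(w,z).
    -- Differentiating this identity once more along `v`, and splitting each ∇(dξ ·) into II plus a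
    -- tangential part, gives `key`; the mixed terms vanish by `n1` and `n2`.
    have hev : (fun s => g (ξ s) (covAlong Γ ξ (fun s => fderiv ℝ ξ s z) w s) (fderiv ℝ ξ s r))
        =ᶠ[𝓝 t] fun s => h (id s) (Γ' s w z) r := by
      refine Filter.eventually_of_mem (hh.isOpen.mem_nhds ht) fun s hs => ?_
      have := secondFundamental_normal hg hh hi hs w z r
      rw [secondFundamental, map_sub, _root_.sub_apply, sub_eq_zero] at this
      simp only [this, id, hi.metric_eq s hs]
    have dΓ : DifferentiableAt ℝ Γ' t := (hh.contDiffAt_connection ht).differentiableAt (by simp)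
    rw [hev.fderiv_eq, fderiv_bilinear_apply (X := fun s => Γ' s w z) (Y := fun _ => r)
      ((hh.contDiffAt_metric ht).differentiableAt (by simp)) differentiableAt_id
      ((dΓ.clm_apply (differentiableAt_const _)).clm_apply (differentiableAt_const _))
      (differentiableAt_const _)] at h1
    have h2 : fderiv ℝ (fun s => Γ' s w z) t v = fderiv ℝ Γ' t v w z := by
      have := fderiv_bilinear_apply (ξ := id) (X := fun _ => w) (Y := fun _ => z) (v := v) dΓ
        differentiableAt_id (differentiableAt_const _) (differentiableAt_const _)
      simpa using this
    have n1 := secondFundamental_normal hg hh hi ht w z (Γ' t v r)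
    have n2 := secondFundamental_normal hg hh hi ht v r (Γ' t w z)
    rw [hg.metric_symm _ hU] at n2
    have m1 := hi.metric_eq t ht (Γ' t w z) (Γ' t v r)
    have m2 := hh.fderiv_metric t ht v (Γ' t w z) r
    simp only [h2, id, fderiv_id, ContinuousLinearMap.id_apply, map_zero, add_zero,
      fderiv_fun_const, Pi.zero_apply, _root_.zero_apply] at h1
    have e1 : covAlong Γ ξ (fun s => fderiv ℝ ξ s z) w t =
      secondFundamental Γ Γ' ξ t w z + fderiv ℝ ξ t (Γ' t w z) := by simp [secondFundamental]
    have e2 : covAlong Γ ξ (fun s => fderiv ℝ ξ s r) v t =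
      secondFundamental Γ Γ' ξ t v r + fderiv ℝ ξ t (Γ' t v r) := by simp [secondFundamental]
    rw [e1, e2] at h1
    simp only [map_add, _root_.add_apply] at h1 ⊢
    linarith
  have c := covAlong_comm (hg.contDiffAt_connection hU) hξ (contDiffAt_fderiv_apply hξ z) v w
  rw [← c, map_sub, _root_.sub_apply, key, key, curvature]
  simp only [map_add, map_sub, _root_.add_apply, _root_.sub_apply]
  ring

/-- Local isometries between spaces of the same dimension have no second fundamental form. -/
theorem secondFundamental_eq_zero (hg : IsLeviCivita U g Γ) (hh : IsLeviCivita V h Γ')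
    (hi : IsIsometricOn U g V h ξ) {t : F} (ht : t ∈ V)
    (hs : Function.Surjective (fderiv ℝ ξ t)) (v w : F) :
    secondFundamental Γ Γ' ξ t v w = 0 := by
  -- When dξ is onto, II is itself tangent, hence orthogonal to itself.
  obtain ⟨z, hz⟩ := hs (secondFundamental Γ Γ' ξ t v w)
  apply hg.eq_zero_of_metric (hi.mapsTo ht)
  conv_lhs => rw [← hz]
  rw [hg.metric_symm _ (hi.mapsTo ht), hz, ← hz]
  rw [hg.metric_symm _ (hi.mapsTo ht)]
  conv_lhs => rw [hz]
  rw [hg.metric_symm _ (hi.mapsTo ht), ← secondFundamental_normal hg hh hi ht v w z, hz]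

/-- With II = 0 the Gauss equation says that both sides have the same products with all tangent
vectors, which are all vectors here. It will make the Ricci form independent of the chart. -/
theorem curvature_map_of_surjective (hg : IsLeviCivita U g Γ) (hh : IsLeviCivita V h Γ')
    (hi : IsIsometricOn U g V h ξ) {t : F} (ht : t ∈ V)
    (hs : Function.Surjective (fderiv ℝ ξ t)) (v w z : F) :
    curvature Γ (ξ t) (fderiv ℝ ξ t v) (fderiv ℝ ξ t w) (fderiv ℝ ξ t z) =
      fderiv ℝ ξ t (curvature Γ' t v w z) := by
  rw [← sub_eq_zero]
  obtain ⟨r, hr⟩ := hs (curvature Γ (ξ t) (fderiv ℝ ξ t v) (fderiv ℝ ξ t w) (fderiv ℝ ξ t z) -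
      fderiv ℝ ξ t (curvature Γ' t v w z))
  apply hg.eq_zero_of_metric (hi.mapsTo ht)
  have := gauss_equation hg hh hi ht v w z r
  simp only [secondFundamental_eq_zero hg hh hi ht hs, map_zero, sub_zero, add_zero] at this
  rw [hi.metric_eq t ht, hr] at this
  rw [map_sub (g (ξ t)) (curvature Γ (ξ t) _ _ _), _root_.sub_apply, this, sub_self]

/-- Covariant derivatives are natural under local isometries. -/
theorem covAlong_map_of_surjective (hg : IsLeviCivita U g Γ) (hh : IsLeviCivita V h Γ')
    (hi : IsIsometricOn U g V h ξ) {t : F} (ht : t ∈ V)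
    (hs : Function.Surjective (fderiv ℝ ξ t)) {X : E → E} {X' : F → F}
    (hX : DifferentiableAt ℝ X (ξ t)) (hX' : DifferentiableAt ℝ X' t)
    (hXX' : ∀ᶠ s in 𝓝 t, X (ξ s) = fderiv ℝ ξ s (X' s)) (v : F) :
    fderiv ℝ X (ξ t) (fderiv ℝ ξ t v) + Γ (ξ t) (fderiv ℝ ξ t v) (X (ξ t)) =
      fderiv ℝ ξ t (fderiv ℝ X' t v + Γ' t v (X' t)) := by
  have hξ : ContDiffAt ℝ ∞ ξ t := hi.contDiffOn.contDiffAt (hh.isOpen.mem_nhds ht)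
  have h0 := secondFundamental_eq_zero hg hh hi ht hs v (X' t)
  rw [secondFundamental, sub_eq_zero, covAlong, fderiv_fderiv_apply hξ] at h0
  have h1 : fderiv ℝ (fun s => X (ξ s)) t v = fderiv ℝ X (ξ t) (fderiv ℝ ξ t v) := by
    have := (hX.hasFDerivAt.comp t (hξ.differentiableAt (by simp)).hasFDerivAt).fderiv
    have h2 : fderiv ℝ (fun s => X (ξ s)) t = _ := this
    rw [h2]; rfl
  have hd : DifferentiableAt ℝ (fderiv ℝ ξ) t :=
    (hξ.fderiv_right (m := 1) (by norm_cast)).differentiableAt (by norm_num)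
  rw [← h1, Filter.EventuallyEq.fderiv_eq hXX', hXX'.self_of_nhds,
    (hd.hasFDerivAt.clm_apply hX'.hasFDerivAt).fderiv, map_add, ← h0]
  simp
  abel

end Immersion

end AbstractCalculus

/-! ### Traces, divergence and the Bochner identity -/

section Divergence

variable {E : Type*} [NormedAddCommGroup E] [NormedSpace ℝ E]

/-- The covariant derivative `v ↦ ∇_v X` of the vector field `X`. -/
def nablaEnd (Γ : E → E →L[ℝ] E →L[ℝ] E) (X : E → E) (y : E) : E →L[ℝ] E :=
  fderiv ℝ X y + (Γ y).flip (X y)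

theorem nablaEnd_apply (Γ : E → E →L[ℝ] E →L[ℝ] E) (X : E → E) (y v : E) :
    nablaEnd Γ X y v = fderiv ℝ X y v + Γ y v (X y) := rfl

/-- The endomorphism `z ↦ R(z, v)w`. -/
def curvatureEnd (Γ : E → E →L[ℝ] E →L[ℝ] E) (y v w : E) : E →L[ℝ] E :=
  ((fderiv ℝ Γ y).flip v).flip w - (fderiv ℝ Γ y v).flip w + (Γ y).flip (Γ y v w)
    - (Γ y v).comp ((Γ y).flip w)

theorem curvatureEnd_apply (Γ : E → E →L[ℝ] E →L[ℝ] E) (y v w z : E) :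
    curvatureEnd Γ y v w z = curvature Γ y z v w := rfl

theorem contDiffAt_nablaEnd {Γ : E → E →L[ℝ] E →L[ℝ] E} {X : E → E} {y : E}
    (hΓ : ContDiffAt ℝ ∞ Γ y) (hX : ContDiffAt ℝ ∞ X y) : ContDiffAt ℝ ∞ (nablaEnd Γ X) y :=
  (hX.fderiv_right (m := ∞) (by norm_cast)).add
    ((ContinuousLinearMap.flipₗᵢ ℝ E E E).contDiff.contDiffAt.comp y hΓ |>.clm_apply hX)

/-- The commutation formula behind the Bochner identity. -/
theorem nablaEnd_nablaEnd_self {Γ : E → E →L[ℝ] E →L[ℝ] E} {u : E → E} {y : E}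
    (hΓ : ContDiffAt ℝ ∞ Γ y) (hu : ContDiffAt ℝ ∞ u y)
    (hs : ∀ᶠ s in 𝓝 y, ∀ v w, Γ s v w = Γ s w v) (w : E) :
    nablaEnd Γ (fun s => nablaEnd Γ u s (u s)) y w =
      nablaEnd Γ u y (nablaEnd Γ u y w) + curvature Γ y w (u y) (u y)
        + (fderiv ℝ (nablaEnd Γ u) y (u y) w + Γ y (u y) (nablaEnd Γ u y w)
          - nablaEnd Γ u y (Γ y (u y) w)) := by
  have hA := (contDiffAt_nablaEnd hΓ hu).differentiableAt (by simp)
  have du := hu.differentiableAt (by simp : (∞ : WithTop ℕ∞) ≠ 0)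
  have dΓ := hΓ.differentiableAt (by simp : (∞ : WithTop ℕ∞) ≠ 0)
  have dfu : DifferentiableAt ℝ (fderiv ℝ u) y :=
    (hu.fderiv_right (m := 1) (by norm_cast)).differentiableAt (by norm_num)
  have hDA : ∀ a b, fderiv ℝ (nablaEnd Γ u) y a b =
      fderiv ℝ (fderiv ℝ u) y a b + fderiv ℝ Γ y a b (u y) + Γ y b (fderiv ℝ u y a) := by
    intro a b
    have e : fderiv ℝ (fun s => nablaEnd Γ u s b) y a = fderiv ℝ (nablaEnd Γ u) y a b := by
      rw [(hA.hasFDerivAt.clm_apply (hasFDerivAt_const b y)).fderiv]; simp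
    have e2 : (fun s => nablaEnd Γ u s b) =
      (fun s => fderiv ℝ u s b) + fun s => Γ (id s) b (u s) := rfl
    have d1 : DifferentiableAt ℝ (fun s => fderiv ℝ u s b) y :=
      dfu.clm_apply (differentiableAt_const _)
    have d2 : DifferentiableAt ℝ (fun s => Γ (id s) b (u s)) y :=
      (dΓ.clm_apply (differentiableAt_const _)).clm_apply du
    rw [← e, e2, fderiv_add d1 d2, _root_.add_apply,
      fderiv_fderiv_apply hu, fderiv_bilinear_apply (X := fun _ => b) (by exact dΓ) differentiableAt_id
      (differentiableAt_const _) du]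
    simp [add_assoc]
  have h1 : fderiv ℝ (fun s => nablaEnd Γ u s (u s)) y w =
      fderiv ℝ (nablaEnd Γ u) y w (u y) + nablaEnd Γ u y (fderiv ℝ u y w) := by
    rw [(hA.hasFDerivAt.clm_apply du.hasFDerivAt).fderiv]; simp [add_comm]
  have hsy := hs.self_of_nhds
  -- The derivative of `Γ` inherits the symmetry because `Γ` is symmetric on a whole neighbourhood,
  -- not only at `y`.
  have hDs : ∀ a v w, fderiv ℝ Γ y a v w = fderiv ℝ Γ y a w v := by
    intro a v w
    have e : ∀ v w, fderiv ℝ (fun s => Γ (id s) v w) y a = fderiv ℝ Γ y a v w := fun v w => by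
      rw [fderiv_bilinear_apply (X := fun _ => v) (Y := fun _ => w) (by exact dΓ)
        differentiableAt_id (differentiableAt_const _) (differentiableAt_const _)]
      simp
    rw [← e v w, ← e w v, Filter.EventuallyEq.fderiv_eq]
    filter_upwards [hs] with s h using h v w
  rw [nablaEnd_apply, h1, hDA, hDA, curvature]
  simp only [nablaEnd_apply, map_add]
  rw [fderiv_fderiv_comm hu w (u y), hsy w (u y), hsy (fderiv ℝ u y w)]
  simp only [hDs _ w (u y)]
  abel

variable [FiniteDimensional ℝ E]

/-- The trace of a continuous endomorphism. -/
def traceCLM : (E →L[ℝ] E) →L[ℝ] ℝ :=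
  LinearMap.toContinuousLinearMap (LinearMap.trace ℝ E ∘ₗ ContinuousLinearMap.coeLM ℝ)

theorem traceCLM_apply (A : E →L[ℝ] E) : traceCLM A = LinearMap.trace ℝ E A := rfl

theorem traceCLM_comp_comm (A B : E →L[ℝ] E) : traceCLM (A.comp B) = traceCLM (B.comp A) :=
  LinearMap.trace_comp_comm' (B : E →ₗ[ℝ] E) A

theorem traceCLM_smulRight (f : E →L[ℝ] ℝ) (v : E) : traceCLM (f.smulRight v) = f v :=
  LinearMap.trace_smulRight (f : E →ₗ[ℝ] ℝ) v

/-- The Ricci form of a connection. -/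
def ricciForm (Γ : E → E →L[ℝ] E →L[ℝ] E) (y v w : E) : ℝ :=
  traceCLM (curvatureEnd Γ y v w)

/-- The divergence of a vector field. -/
def divergence (Γ : E → E →L[ℝ] E →L[ℝ] E) (X : E → E) (y : E) : ℝ :=
  traceCLM (nablaEnd Γ X y)

theorem divergence_sub {Γ : E → E →L[ℝ] E →L[ℝ] E} {X Y : E → E} {y : E}
    (hX : DifferentiableAt ℝ X y) (hY : DifferentiableAt ℝ Y y) :
    divergence Γ (fun s => X s - Y s) y = divergence Γ X y - divergence Γ Y y := by
  rw [divergence, divergence, divergence, ← map_sub]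
  congr 1
  ext v : 1
  have := fderiv_sub hX hY
  simp only [nablaEnd_apply, map_sub, _root_.sub_apply]
  rw [show (fun s => X s - Y s) = X - Y from rfl, this]
  simp
  abel

theorem divergence_smul {Γ : E → E →L[ℝ] E →L[ℝ] E} {a : E → ℝ} {X : E → E} {y : E}
    (ha : DifferentiableAt ℝ a y) (hX : DifferentiableAt ℝ X y) :
    divergence Γ (fun s => a s • X s) y = a y * divergence Γ X y + fderiv ℝ a y (X y) := by
  have : nablaEnd Γ (fun s => a s • X s) y =
      a y • nablaEnd Γ X y + (fderiv ℝ a y).smulRight (X y) := by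
    ext v : 1
    simp only [nablaEnd_apply, map_smul, _root_.add_apply]
    rw [show (fun s => a s • X s) = a • X from rfl, fderiv_smul ha hX]
    simp [nablaEnd_apply]
    abel
  rw [divergence, divergence, this, map_add, map_smul, traceCLM_smulRight, smul_eq_mul]

/-- The Bochner identity `div (∇_u u - (div u) u) = tr (∇u)² + Ric(u, u) - (div u)²`. -/
theorem divergence_bochner {Γ : E → E →L[ℝ] E →L[ℝ] E} {u : E → E} {y : E}
    (hΓ : ContDiffAt ℝ ∞ Γ y) (hu : ContDiffAt ℝ ∞ u y)
    (hs : ∀ᶠ s in 𝓝 y, ∀ v w, Γ s v w = Γ s w v) :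
    divergence Γ (fun s => nablaEnd Γ u s (u s) - divergence Γ u s • u s) y =
      traceCLM ((nablaEnd Γ u y).comp (nablaEnd Γ u y)) + ricciForm Γ y (u y) (u y)
        - divergence Γ u y ^ 2 := by
  have hA := contDiffAt_nablaEnd hΓ hu
  have dA := hA.differentiableAt (by simp)
  have du := hu.differentiableAt (by simp : (∞ : WithTop ℕ∞) ≠ 0)
  have ddiv : HasFDerivAt (divergence Γ u) (traceCLM.comp (fderiv ℝ (nablaEnd Γ u) y)) y :=
    ((traceCLM (E := E)).hasFDerivAt (x := nablaEnd Γ u y)).comp y dA.hasFDerivAt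
  have dsm : DifferentiableAt ℝ (fun s => divergence Γ u s • u s) y := ddiv.differentiableAt.smul du
  rw [divergence_sub (dA.clm_apply du) dsm,
    divergence_smul ddiv.differentiableAt du, ddiv.fderiv]
  -- The last bracket is ∇_u(∇u). In its trace the two terms with `Γ` form a commutator and drop
  -- out, and the rest is the derivative of div u along u, which cancels against the product rule
  -- for (div u) u.
  have e : nablaEnd Γ (fun s => nablaEnd Γ u s (u s)) y =
      (nablaEnd Γ u y).comp (nablaEnd Γ u y) + curvatureEnd Γ y (u y) (u y)
        + (fderiv ℝ (nablaEnd Γ u) y (u y) + (Γ y (u y)).comp (nablaEnd Γ u y)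
          - (nablaEnd Γ u y).comp (Γ y (u y))) := by
    ext w : 1
    exact nablaEnd_nablaEnd_self hΓ hu hs w
  rw [divergence, e]
  simp only [map_add, map_sub, ContinuousLinearMap.comp_apply]
  rw [traceCLM_comp_comm (Γ y (u y)), ricciForm]
  ring

/-- The trace in terms of a family that is orthonormal for a bilinear form. -/
theorem trace_eq_sum_of_orthonormal {ι : Type*} [Fintype ι] [DecidableEq ι]
    (g : E →L[ℝ] E →L[ℝ] ℝ) (b : ι → E) (hb : ∀ i j, g (b i) (b j) = if i = j then 1 else 0)
    (hcard : Fintype.card ι = Module.finrank ℝ E) (A : E →L[ℝ] E) :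
    traceCLM A = ∑ i, g (A (b i)) (b i) := by
  have li : LinearIndependent ℝ b := by
    rw [Fintype.linearIndependent_iff]
    intro c hc i
    have := congrArg (fun v => g v (b i)) hc
    simpa [hb] using this
  let B := basisOfLinearIndependentOfCardEqFinrank' b li hcard
  have hB : ∀ i, B i = b i := fun i => by simp [B]
  have hrepr : ∀ x i, B.repr x i = g x (b i) := by
    intro x i
    conv_rhs => rw [← B.sum_repr x]
    simp [hB, hb]
  rw [traceCLM_apply, LinearMap.trace_eq_matrix_trace ℝ B, Matrix.trace]
  simp [LinearMap.toMatrix_apply, hrepr, hB]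

end Divergence

/-! ### Expansion of multilinear maps in a finite family -/

section Multilinear

set_option synthInstance.maxHeartbeats 200000

variable {E G ι : Type*} [NormedAddCommGroup E] [NormedSpace ℝ E]
  [NormedAddCommGroup G] [NormedSpace ℝ G] [Fintype ι]

theorem bilinear_sum_smul (B : E →L[ℝ] E →L[ℝ] G) (e : ι → E) (a b : ι → ℝ) :
    B (∑ i, a i • e i) (∑ j, b j • e j) = ∑ i, ∑ j, (a i * b j) • B (e i) (e j) := by
  simp only [map_sum, map_smul, _root_.sum_apply, _root_.smul_apply, Finset.smul_sum, smul_smul]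
  rw [Finset.sum_comm]
  exact Finset.sum_congr rfl fun i _ => Finset.sum_congr rfl fun j _ => by rw [mul_comm]

theorem trilinear_sum_smul (T : E →L[ℝ] E →L[ℝ] E →L[ℝ] G) (e : ι → E) (a b : ι → ℝ) (z : E) :
    T (∑ i, a i • e i) (∑ j, b j • e j) z = ∑ i, ∑ j, (a i * b j) • T (e i) (e j) z := by
  rw [bilinear_sum_smul]
  simp only [_root_.sum_apply, _root_.smul_apply]

theorem trilinear_sum_smul_left (T : E →L[ℝ] E →L[ℝ] E →L[ℝ] G) (e : ι → E) (a : ι → ℝ)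
    (v w : E) : T (∑ i, a i • e i) v w = ∑ i, a i • T (e i) v w := by
  simp only [map_sum, map_smul, _root_.sum_apply, _root_.smul_apply]

theorem curvature_sum_smul (Γ : E → E →L[ℝ] E →L[ℝ] E) (y z : E) (e : ι → E) (a b : ι → ℝ) :
    curvature Γ y z (∑ i, a i • e i) (∑ j, b j • e j) =
      ∑ i, ∑ j, (a i * b j) • curvature Γ y z (e i) (e j) := by
  exact bilinear_sum_smul (fderiv ℝ Γ y z - (fderiv ℝ Γ y).flip z
    + (ContinuousLinearMap.compL ℝ E E E (Γ y z)).comp (Γ y)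
    - ((ContinuousLinearMap.compL ℝ E E E).flip (Γ y z)).comp (Γ y)) e a b

end Multilinear

/-! ### The Levi-Civita connection and the curvature of a metric matrix -/

section MetricMatrix

set_option synthInstance.maxHeartbeats 200000

variable {n : ℕ}

/-- The standard basis vectors. -/
abbrev stdVec (i : Fin n) : Coord n := EuclideanSpace.single i (1 : ℝ)

theorem sum_smul_stdVec (v : Coord n) : ∑ i, v i • stdVec i = v := by
  ext j
  simp [stdVec, Pi.single_apply]

theorem map_eq_sum_stdVec {G : Type*} [AddCommGroup G] [Module ℝ G] (A : Coord n →ₗ[ℝ] G)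
    (v : Coord n) : A v = ∑ i, v i • A (stdVec i) := by
  conv_lhs => rw [← sum_smul_stdVec v]
  simp

theorem traceCLM_eq_sum_stdVec (A : Coord n →L[ℝ] Coord n) :
    traceCLM A = ∑ i, A (stdVec i) i := by
  rw [traceCLM_apply, LinearMap.trace_eq_matrix_trace ℝ (EuclideanSpace.basisFun (Fin n) ℝ).toBasis,
    Matrix.trace]
  simp [LinearMap.toMatrix_apply]

/-- The bilinear form with matrix `g`. -/
def metricForm (g : Coord n → Matrix (Fin n) (Fin n) ℝ) (y : Coord n) :
    Coord n →L[ℝ] Coord n →L[ℝ] ℝ :=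
  ∑ i, ∑ j, g y i j • (EuclideanSpace.proj i : Coord n →L[ℝ] ℝ).smulRight
    (EuclideanSpace.proj j : Coord n →L[ℝ] ℝ)

theorem metricForm_apply (g : Coord n → Matrix (Fin n) (Fin n) ℝ) (y v w : Coord n) :
    metricForm g y v w = ∑ i, ∑ j, g y i j * (v i * w j) := by
  simp [metricForm, _root_.sum_apply]

theorem metricForm_stdVec (g : Coord n → Matrix (Fin n) (Fin n) ℝ) (y : Coord n) (i j : Fin n) :
    metricForm g y (stdVec i) (stdVec j) = g y i j := by
  simp [metricForm_apply, stdVec, PiLp.single_apply]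

/-- The Christoffel symbols as a bilinear map. -/
def christoffelForm (g : Coord n → Matrix (Fin n) (Fin n) ℝ) (y : Coord n) :
    Coord n →L[ℝ] Coord n →L[ℝ] Coord n :=
  ∑ k, ∑ i, ∑ j, christoffel g k i j y • (EuclideanSpace.proj i : Coord n →L[ℝ] ℝ).smulRight
    ((EuclideanSpace.proj j : Coord n →L[ℝ] ℝ).smulRight (stdVec k))

theorem christoffelForm_apply (g : Coord n → Matrix (Fin n) (Fin n) ℝ) (y v w : Coord n)
    (k : Fin n) :
    christoffelForm g y v w k = ∑ i, ∑ j, christoffel g k i j y * (v i * w j) := by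
  simp only [christoffelForm, _root_.sum_apply, _root_.smul_apply, WithLp.ofLp_sum,
    Finset.sum_apply]
  rw [Finset.sum_eq_single k]
  · simp [stdVec]
  · intro b _ hb
    simp [stdVec, hb.symm]
  · simp

theorem christoffelForm_stdVec (g : Coord n → Matrix (Fin n) (Fin n) ℝ) (y : Coord n)
    (i j k : Fin n) :
    christoffelForm g y (stdVec i) (stdVec j) k = christoffel g k i j y := by
  simp [christoffelForm_apply, stdVec, PiLp.single_apply]

/-- `g` is the matrix of a smooth Riemannian metric on the open set `U`. -/
structure IsMetricMatrix (U : Set (Coord n)) (g : Coord n → Matrix (Fin n) (Fin n) ℝ) : Prop where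
  isOpen : IsOpen U
  contDiffOn : ∀ i j, ContDiffOn ℝ ∞ (fun y => g y i j) U
  posDef : ∀ y ∈ U, (g y).PosDef

theorem contDiffAt_det {A : Coord n → Matrix (Fin n) (Fin n) ℝ} {y : Coord n}
    (hA : ∀ i j, ContDiffAt ℝ ∞ (fun y => A y i j) y) : ContDiffAt ℝ ∞ (fun y => (A y).det) y := by
  simp only [Matrix.det_apply]
  refine ContDiffAt.sum fun σ _ => ?_
  exact (contDiffAt_prod fun i _ => hA (σ i) i).const_smul _

theorem ContDiffAt.smul_vec {G : Type*} [NormedAddCommGroup G] [NormedSpace ℝ G]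
    {f : Coord n → ℝ} {y : Coord n} (hf : ContDiffAt ℝ ∞ f y) (c : G) :
    ContDiffAt ℝ ∞ (fun s => f s • c) y :=
  hf.smul contDiffAt_const

namespace IsMetricMatrix

variable {U : Set (Coord n)} {g : Coord n → Matrix (Fin n) (Fin n) ℝ}

theorem contDiffAt (hg : IsMetricMatrix U g) {y : Coord n} (hy : y ∈ U) (i j : Fin n) :
    ContDiffAt ℝ ∞ (fun y => g y i j) y :=
  (hg.contDiffOn i j).contDiffAt (hg.isOpen.mem_nhds hy)

theorem contDiffAt_inv (hg : IsMetricMatrix U g) {y : Coord n} (hy : y ∈ U) (i j : Fin n) :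
    ContDiffAt ℝ ∞ (fun y => (g y)⁻¹ i j) y := by
  have hdet : ContDiffAt ℝ ∞ (fun y => (g y).det) y := contDiffAt_det fun i j => hg.contDiffAt hy i j
  have hadj : ContDiffAt ℝ ∞ (fun y => (g y).adjugate i j) y := by
    simp only [Matrix.adjugate_apply]
    refine contDiffAt_det fun k l => ?_
    simp only [Matrix.updateRow_apply]
    split_ifs
    · exact contDiffAt_const
    · exact hg.contDiffAt hy k l
  simp only [Matrix.inv_def, Matrix.smul_apply, Ring.inverse_eq_inv', smul_eq_mul]
  exact (hdet.inv (hg.posDef y hy).det_pos.ne').mul hadj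

theorem contDiffAt_partialDeriv (hg : IsMetricMatrix U g) {y : Coord n} (hy : y ∈ U)
    (i j k : Fin n) : ContDiffAt ℝ ∞ (partialDeriv k fun y => g y i j) y :=
  contDiffAt_fderiv_apply (hg.contDiffAt hy i j) _

theorem contDiffAt_christoffel (hg : IsMetricMatrix U g) {y : Coord n} (hy : y ∈ U)
    (k i j : Fin n) : ContDiffAt ℝ ∞ (christoffel g k i j) y := by
  unfold christoffel
  refine contDiffAt_const.mul (ContDiffAt.sum fun l _ => (hg.contDiffAt_inv hy k l).mul ?_)
  exact ((hg.contDiffAt_partialDeriv hy _ _ _).add (hg.contDiffAt_partialDeriv hy _ _ _)).sub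
    (hg.contDiffAt_partialDeriv hy _ _ _)

theorem contDiffAt_metricForm (hg : IsMetricMatrix U g) {y : Coord n} (hy : y ∈ U) :
    ContDiffAt ℝ ∞ (metricForm g) y := by
  unfold metricForm
  exact ContDiffAt.sum fun i _ => ContDiffAt.sum fun j _ =>
    ContDiffAt.smul_vec (G := Coord n →L[ℝ] Coord n →L[ℝ] ℝ) (hg.contDiffAt hy i j) _

theorem contDiffAt_christoffelForm (hg : IsMetricMatrix U g) {y : Coord n} (hy : y ∈ U) :
    ContDiffAt ℝ ∞ (christoffelForm g) y := by
  unfold christoffelForm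
  exact ContDiffAt.sum fun k _ => ContDiffAt.sum fun i _ => ContDiffAt.sum fun j _ =>
    ContDiffAt.smul_vec (G := Coord n →L[ℝ] Coord n →L[ℝ] Coord n)
      (hg.contDiffAt_christoffel hy k i j) _

theorem symm (hg : IsMetricMatrix U g) {y : Coord n} (hy : y ∈ U) (i j : Fin n) :
    g y i j = g y j i := by
  simpa using (hg.posDef y hy).isHermitian.apply j i

theorem fderiv_metricForm_apply (hg : IsMetricMatrix U g) {y : Coord n} (hy : y ∈ U)
    (a v w : Coord n) :
    fderiv ℝ (fun s => metricForm g s v w) y a = fderiv ℝ (metricForm g) y a v w := by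
  rw [fderiv_bilinear_apply (ξ := fun s => s) (X := fun _ => v) (Y := fun _ => w)
    ((hg.contDiffAt_metricForm hy).differentiableAt (by simp))
    differentiableAt_id (differentiableAt_const _) (differentiableAt_const _)]
  simp

theorem partialDeriv_eq (hg : IsMetricMatrix U g) {y : Coord n} (hy : y ∈ U) (i j k : Fin n) :
    partialDeriv k (fun y => g y i j) y =
      fderiv ℝ (metricForm g) y (stdVec k) (stdVec i) (stdVec j) := by
  rw [← hg.fderiv_metricForm_apply hy]
  simp only [metricForm_stdVec]
  rfl

/-- The Koszul expression, twice `g(∇_v w, z)` for constant fields. -/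
theorem two_mul_metricForm_christoffelForm (hg : IsMetricMatrix U g) {y : Coord n} (hy : y ∈ U)
    (v w z : Coord n) : 2 * metricForm g y (christoffelForm g y v w) z =
      fderiv ℝ (metricForm g) y v w z + fderiv ℝ (metricForm g) y w v z
        - fderiv ℝ (metricForm g) y z v w := by
  set D := fderiv ℝ (metricForm g) y with hD
  -- `κ` is the Koszul covector. The formula for the Christoffel symbols says that Γ(v,w) is half of
  -- `κ` with its index raised by g⁻¹, so pairing with `z` through `g` undoes the inverse.
  set κ : Fin n → ℝ := fun l => D v w (stdVec l) + D w v (stdVec l) - D (stdVec l) v w with hκ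
  have h1 : ∀ k, christoffelForm g y v w k = (1 / 2 : ℝ) * ((g y)⁻¹.mulVec κ) k := by
    intro k
    have e : ∀ l, κ l = ∑ i, ∑ j, (D (stdVec i) (stdVec j) (stdVec l)
        + D (stdVec j) (stdVec i) (stdVec l) - D (stdVec l) (stdVec i) (stdVec j))
          * (v i * w j) := by
      intro l
      have e1 := trilinear_sum_smul D stdVec v w (stdVec l)
      have e2 := trilinear_sum_smul D stdVec w v (stdVec l)
      have e3 := bilinear_sum_smul (D (stdVec l)) stdVec v w
      rw [Finset.sum_comm] at e2
      simp only [sum_smul_stdVec, smul_eq_mul] at e1 e2 e3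
      rw [hκ]
      simp only [e1, e2, e3, ← Finset.sum_add_distrib, ← Finset.sum_sub_distrib]
      exact Finset.sum_congr rfl fun i _ => Finset.sum_congr rfl fun j _ => by ring
    rw [christoffelForm_apply]
    simp only [christoffel, hg.partialDeriv_eq hy, ← hD, Matrix.mulVec, dotProduct, e,
      Finset.mul_sum, Finset.sum_mul]
    rw [Finset.sum_congr rfl fun i _ => Finset.sum_comm, Finset.sum_comm]
    exact Finset.sum_congr rfl fun i _ => Finset.sum_congr rfl fun j _ =>
      Finset.sum_congr rfl fun l _ => by ring
  have hu : IsUnit (g y).det := (hg.posDef y hy).det_pos.ne'.isUnit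
  have h2 : (g y).mulVec ((g y)⁻¹.mulVec κ) = κ := by
    rw [Matrix.mulVec_mulVec, Matrix.mul_nonsing_inv _ hu, Matrix.one_mulVec]
  have h3 : metricForm g y (christoffelForm g y v w) z = (1 / 2 : ℝ) * ∑ l, κ l * z l := by
    rw [metricForm_apply]
    conv_rhs => rw [← h2]
    simp only [h1, Matrix.mulVec, dotProduct, Finset.mul_sum, Finset.sum_mul]
    rw [Finset.sum_comm]
    refine Finset.sum_congr rfl fun i _ => Finset.sum_congr rfl fun j _ => Finset.sum_congr rfl fun l _ => ?_
    rw [hg.symm hy j i]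
    ring
  have h4 : ∑ l, κ l * z l = D v w z + D w v z - D z v w := by
    have e1 := map_eq_sum_stdVec (D v w : Coord n →ₗ[ℝ] ℝ) z
    have e2 := map_eq_sum_stdVec (D w v : Coord n →ₗ[ℝ] ℝ) z
    have e3 := trilinear_sum_smul_left D stdVec z v w
    simp only [sum_smul_stdVec, smul_eq_mul, ContinuousLinearMap.coe_coe] at e1 e2 e3
    rw [e1, e2, e3]
    simp only [hκ, ← Finset.sum_add_distrib, ← Finset.sum_sub_distrib]
    exact Finset.sum_congr rfl fun l _ => by ring
  rw [h3, h4]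
  ring

theorem metricForm_symm (hg : IsMetricMatrix U g) {y : Coord n} (hy : y ∈ U) (v w : Coord n) :
    metricForm g y v w = metricForm g y w v := by
  rw [metricForm_apply, metricForm_apply, Finset.sum_comm]
  exact Finset.sum_congr rfl fun i _ => Finset.sum_congr rfl fun j _ => by
    rw [hg.symm hy]; ring

theorem metricForm_pos (hg : IsMetricMatrix U g) {y : Coord n} (hy : y ∈ U) {v : Coord n}
    (hv : v ≠ 0) : 0 < metricForm g y v v := by
  have := (hg.posDef y hy).dotProduct_mulVec_pos (x := v) (by simpa using hv)
  have e : metricForm g y v v = star v.ofLp ⬝ᵥ (g y).mulVec v.ofLp := by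
    rw [metricForm_apply]
    simp only [dotProduct, Matrix.mulVec, Finset.mul_sum]
    exact Finset.sum_congr rfl fun i _ => Finset.sum_congr rfl fun j _ => by
      simp; ring
  rwa [e]

theorem fderiv_metricForm_symm (hg : IsMetricMatrix U g) {y : Coord n} (hy : y ∈ U)
    (a v w : Coord n) :
    fderiv ℝ (metricForm g) y a v w = fderiv ℝ (metricForm g) y a w v := by
  rw [← hg.fderiv_metricForm_apply hy, ← hg.fderiv_metricForm_apply hy,
    Filter.EventuallyEq.fderiv_eq]
  filter_upwards [hg.isOpen.mem_nhds hy] with s hs using hg.metricForm_symm hs v w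

theorem eq_of_metricForm (hg : IsMetricMatrix U g) {y : Coord n} (hy : y ∈ U) {v w : Coord n}
    (h : ∀ z, metricForm g y v z = metricForm g y w z) : v = w := by
  by_contra hne
  have := hg.metricForm_pos hy (sub_ne_zero.2 hne)
  rw [map_sub (metricForm g y) v w, _root_.sub_apply, h, sub_self] at this
  exact lt_irrefl _ this

/-- The Christoffel form of `g` is its Levi-Civita connection. -/
theorem isLeviCivita (hg : IsMetricMatrix U g) :
    IsLeviCivita U (metricForm g) (christoffelForm g) where
  isOpen := hg.isOpen
  contDiffOn_metric := fun _ hy => (hg.contDiffAt_metricForm hy).contDiffWithinAt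
  contDiffOn_connection := fun _ hy => (hg.contDiffAt_christoffelForm hy).contDiffWithinAt
  metric_symm := fun _ hy => hg.metricForm_symm hy
  metric_pos := fun _ hy _ hv => hg.metricForm_pos hy hv
  connection_symm := fun y hy v w => by
    refine hg.eq_of_metricForm hy fun z => ?_
    have h1 := hg.two_mul_metricForm_christoffelForm hy v w z
    have h2 := hg.two_mul_metricForm_christoffelForm hy w v z
    rw [hg.fderiv_metricForm_symm hy z] at h1
    linarith
  fderiv_metric := fun y hy v w z => by
    -- In the sum of the Koszul expressions for (v,w,z) and (v,z,w) everything cancels except twice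
    -- the derivative along `v`.
    have h1 := hg.two_mul_metricForm_christoffelForm hy v w z
    have h2 := hg.two_mul_metricForm_christoffelForm hy v z w
    rw [hg.metricForm_symm hy w]
    linarith [hg.fderiv_metricForm_symm hy v z w, hg.fderiv_metricForm_symm hy z v w,
      hg.fderiv_metricForm_symm hy w v z]

theorem fderiv_christoffelForm_stdVec (hg : IsMetricMatrix U g) {y : Coord n} (hy : y ∈ U)
    (l i j k : Fin n) : fderiv ℝ (christoffelForm g) y (stdVec l) (stdVec i) (stdVec j) k =
      partialDeriv l (christoffel g k i j) y := by
  have h1 := fderiv_bilinear_apply (ξ := fun s => s) (X := fun _ => stdVec i) (v := stdVec l)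
    (Y := fun _ => stdVec j) ((hg.contDiffAt_christoffelForm hy).differentiableAt (by simp))
    differentiableAt_id (differentiableAt_const _) (differentiableAt_const _)
  have hd : DifferentiableAt ℝ (fun s => christoffelForm g s (stdVec i) (stdVec j)) y :=
    (((hg.contDiffAt_christoffelForm hy).clm_apply contDiffAt_const).clm_apply
      contDiffAt_const).differentiableAt (by simp : (∞ : WithTop ℕ∞) ≠ 0)
  have h2 := ((EuclideanSpace.proj k : Coord n →L[ℝ] ℝ).hasFDerivAt (x :=
      christoffelForm g y (stdVec i) (stdVec j))).comp y hd.hasFDerivAt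
  have h4 : fderiv ℝ (fun s => christoffelForm g s (stdVec i) (stdVec j) k) y = _ := h2.fderiv
  simp only [christoffelForm_stdVec] at h4
  have h3 : partialDeriv l (christoffel g k i j) y =
      (fderiv ℝ (fun s => christoffelForm g s (stdVec i) (stdVec j)) y (stdVec l)) k := by
    exact congrArg (fun L => L (stdVec l)) h4
  rw [h3, h1]
  simp

theorem ricciForm_stdVec (hg : IsMetricMatrix U g) {y : Coord n} (hy : y ∈ U) (j k : Fin n) :
    ricciForm (christoffelForm g) y (stdVec j) (stdVec k) = ricciCoord g j k y := by
  rw [ricciForm, traceCLM_eq_sum_stdVec, ricciCoord]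
  refine Finset.sum_congr rfl fun i _ => ?_
  have hc : ∀ a b c : Fin n, christoffelForm g y (stdVec a)
      (christoffelForm g y (stdVec b) (stdVec c)) i =
        ∑ p, christoffel g i a p y * christoffel g p b c y := by
    intro a b c
    rw [christoffelForm_apply]
    simp [christoffelForm_stdVec, stdVec, PiLp.single_apply]
  rw [curvatureEnd_apply, curvature]
  simp only [PiLp.add_apply, PiLp.sub_apply, hg.fderiv_christoffelForm_stdVec hy, hc,
    Finset.sum_sub_distrib]
  ring

theorem sum_ricciCoord_mul (hg : IsMetricMatrix U g) {y : Coord n} (hy : y ∈ U) (v w : Coord n) :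
    ∑ j, ∑ k, ricciCoord g j k y * v j * w k = ricciForm (christoffelForm g) y v w := by
  have hb : ∀ v w z : Coord n, curvature (christoffelForm g) y z v w =
      ∑ j, ∑ k, (v j * w k) • curvature (christoffelForm g) y z (stdVec j) (stdVec k) := by
    intro v w z
    have := curvature_sum_smul (christoffelForm g) y z stdVec v w
    rwa [sum_smul_stdVec, sum_smul_stdVec] at this
  have : curvatureEnd (christoffelForm g) y v w =
      ∑ j, ∑ k, (v j * w k) • curvatureEnd (christoffelForm g) y (stdVec j) (stdVec k) := by
    ext z : 1
    simp only [_root_.sum_apply, _root_.smul_apply, curvatureEnd_apply]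
    exact hb v w z
  rw [ricciForm, this]
  simp only [map_sum, map_smul, smul_eq_mul]
  exact Finset.sum_congr rfl fun j _ => Finset.sum_congr rfl fun k _ => by
    rw [← hg.ricciForm_stdVec hy, ricciForm]; ring

end IsMetricMatrix

/-- Contraction with the inverse metric in terms of an orthonormal family. -/
theorem sum_inv_mul_eq_sum_of_orthonormal {ι : Type*} [Fintype ι] [DecidableEq ι]
    {g : Coord n → Matrix (Fin n) (Fin n) ℝ} {y : Coord n} (b : ι → Coord n)
    (hb : ∀ i j, metricForm g y (b i) (b j) = if i = j then 1 else 0)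
    (hcard : Fintype.card ι = n) (B : Fin n → Fin n → ℝ) :
    ∑ j, ∑ k, (g y)⁻¹ j k * B j k = ∑ a, ∑ j, ∑ k, B j k * b a j * b a k := by
  obtain ⟨e⟩ : Nonempty (ι ≃ Fin n) := ⟨Fintype.equivFinOfCardEq hcard⟩
  let P : Matrix (Fin n) (Fin n) ℝ := Matrix.of fun j a => b (e.symm a) j
  have h1 : P.transpose * ((g y) * P) = 1 := by
    ext a c
    have := hb (e.symm a) (e.symm c)
    rw [metricForm_apply] at this
    simp only [EmbeddingLike.apply_eq_iff_eq] at this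
    rw [Matrix.one_apply, ← this]
    simp only [Matrix.mul_apply, Matrix.transpose_apply, P, Matrix.of_apply, Finset.mul_sum]
    exact Finset.sum_congr rfl fun i _ => Finset.sum_congr rfl fun j _ => by ring
  -- `P` has the orthonormal vectors as columns, so Pᵀ(gP) = 1. For square matrices also (gP)Pᵀ = 1,
  -- which exhibits g⁻¹ as P Pᵀ.
  have h2 : (g y)⁻¹ = P * P.transpose := by
    refine Matrix.inv_eq_right_inv ?_
    have h3 := mul_eq_one_comm.1 h1
    rw [← Matrix.mul_assoc, h3]
  rw [h2]
  simp only [Matrix.mul_apply, Matrix.transpose_apply, P, Matrix.of_apply, Finset.sum_mul]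
  rw [← e.symm.sum_comp, Finset.sum_congr rfl fun i _ => Finset.sum_comm, Finset.sum_comm]
  exact Finset.sum_congr rfl fun i _ => Finset.sum_congr rfl fun j _ =>
    Finset.sum_congr rfl fun l _ => by ring

theorem scalarCoord_eq_sum_of_orthonormal {ι : Type*} [Fintype ι] [DecidableEq ι]
    {U : Set (Coord n)} {g : Coord n → Matrix (Fin n) (Fin n) ℝ} (hg : IsMetricMatrix U g)
    {y : Coord n} (hy : y ∈ U) (b : ι → Coord n)
    (hb : ∀ i j, metricForm g y (b i) (b j) = if i = j then 1 else 0)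
    (hcard : Fintype.card ι = n) :
    scalarCoord g y = ∑ a, ricciForm (christoffelForm g) y (b a) (b a) := by
  rw [scalarCoord, sum_inv_mul_eq_sum_of_orthonormal b hb hcard]
  exact Finset.sum_congr rfl fun a _ => hg.sum_ricciCoord_mul hy _ _

end MetricMatrix

/-! ### Parametrizations and charts as isometric immersions -/

section ManifoldCharts

variable {m : ℕ} {M : Type*} [TopologicalSpace M] [ChartedSpace (Coord m) M]

/-- The differential of a map from a coordinate space. -/
def pushforward {n : ℕ} (ψ : Coord n → M) (y : Coord n) :
    Coord n →L[ℝ] TangentSpace (𝓡 m) (ψ y) :=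
  (mfderiv (𝓡 n) (𝓡 m) ψ y).comp
    (NormedSpace.fromTangentSpace (𝕜 := ℝ) y).symm.toContinuousLinearMap

theorem metricForm_pullbackMetric [RiemannianBundle (fun x : M => TangentSpace (𝓡 m) x)] {n : ℕ}
    (ψ : Coord n → M) (y v w : Coord n) :
    metricForm (pullbackMetric m ψ) y v w =
      inner ℝ (pushforward (m := m) ψ y v) (pushforward (m := m) ψ y w) := by
  have e1 := map_eq_sum_stdVec (pushforward (m := m) ψ y).toLinearMap v
  have e2 := map_eq_sum_stdVec (pushforward (m := m) ψ y).toLinearMap w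
  simp only [ContinuousLinearMap.coe_coe] at e1 e2
  rw [metricForm_apply, e1, e2, sum_inner]
  refine Finset.sum_congr rfl fun i _ => ?_
  rw [inner_sum]
  refine Finset.sum_congr rfl fun j _ => ?_
  rw [real_inner_smul_left, real_inner_smul_right]
  simp only [pullbackMetric, Matrix.of_apply, pushforward, ContinuousLinearMap.comp_apply,
    ContinuousLinearEquiv.coe_coe]
  ring

variable [IsManifold (𝓡 m) ∞ M]

section Smooth

/-- The tangent map of `ψ` is smooth and is here composed with a constant section. As a statement in
the total space of the tangent bundle it feeds `ContMDiffOn.inner_bundle`, the source of smoothness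
for the metric coefficients. -/
theorem contMDiffOn_pushforward {n : ℕ} {ψ : Coord n → M} {V : Set (Coord n)} (hV : IsOpen V)
    (hψ : ContMDiffOn (𝓡 n) (𝓡 m) ∞ ψ V) (v : Coord n) :
    ContMDiffOn (𝓡 n) ((𝓡 m).prod 𝓘(ℝ, Coord m)) ∞
      (fun y => (⟨ψ y, pushforward ψ y v⟩ : TotalSpace (Coord m) (TangentSpace (𝓡 m) : M → Type _)))
      V := by
  have h1 := hψ.contMDiffOn_tangentMapWithin (m := ∞) (by norm_cast) hV.uniqueMDiffOn
  have h2 : ContMDiffOn (𝓡 n) ((𝓡 n).prod 𝓘(ℝ, Coord n)) ∞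
      (fun y : Coord n => (⟨y, v⟩ : TangentBundle (𝓡 n) (Coord n))) V :=
    contMDiffOn_vectorSpace_iff_contDiffOn.2 contDiffOn_const
  have h3 := h1.comp h2 fun y hy => hy
  refine h3.congr fun y hy => ?_
  simp only [Function.comp, tangentMapWithin, mfderivWithin_of_isOpen hV hy]
  rfl

variable [RiemannianBundle (fun x : M => TangentSpace (𝓡 m) x)]
  [IsContMDiffRiemannianBundle (𝓡 m) ∞ (EuclideanSpace ℝ (Fin m))
    (fun x : M => TangentSpace (𝓡 m) x)]

/-- Injectivity of the differential is what makes the first fundamental form positive definite. The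
lemma serves both inverse charts and parametrizations of level sets. -/
theorem isMetricMatrix_pullbackMetric {n : ℕ} {ψ : Coord n → M} {V : Set (Coord n)}
    (hV : IsOpen V) (hψ : ContMDiffOn (𝓡 n) (𝓡 m) ∞ ψ V)
    (hinj : ∀ y ∈ V, Function.Injective (mfderiv (𝓡 n) (𝓡 m) ψ y)) :
    IsMetricMatrix V (pullbackMetric m ψ) where
  isOpen := hV
  contDiffOn i j := by
    rw [← contMDiffOn_iff_contDiffOn]
    exact ContMDiffOn.inner_bundle (IB := 𝓡 m) (F := Coord m)
      (contMDiffOn_pushforward hV hψ (stdVec i)) (contMDiffOn_pushforward hV hψ (stdVec j))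
  posDef y hy := by
    refine Matrix.PosDef.of_dotProduct_mulVec_pos ?_ fun v hv => ?_
    · ext i j
      simp only [Matrix.conjTranspose_apply, star_trivial, pullbackMetric, Matrix.of_apply]
      exact real_inner_comm _ _
    · have e : star v ⬝ᵥ (pullbackMetric m ψ y).mulVec v =
          metricForm (pullbackMetric m ψ) y (WithLp.toLp 2 v) (WithLp.toLp 2 v) := by
        rw [metricForm_apply]
        simp only [dotProduct, Matrix.mulVec, Finset.mul_sum]
        exact Finset.sum_congr rfl fun i _ => Finset.sum_congr rfl fun j _ => by
          simp; ring
      rw [e, metricForm_pullbackMetric]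
      refine real_inner_self_pos.2 fun h0 => hv ?_
      have h1 : (NormedSpace.fromTangentSpace y).symm (WithLp.toLp 2 v) =
          (0 : TangentSpace (𝓡 n) y) := hinj y hy (h0.trans (map_zero _).symm)
      have h2 := (NormedSpace.fromTangentSpace y).symm.map_eq_zero_iff.1 h1
      simpa using congrArg WithLp.ofLp h2

end Smooth

section Chart

variable (x₀ : M)

theorem contMDiffOn_chartSymm :
    ContMDiffOn (𝓡 m) (𝓡 m) ∞ (chartAt (Coord m) x₀).symm (chartAt (Coord m) x₀).target :=
  contMDiffOn_chart_symm

theorem mdifferentiable_chartAt : (chartAt (Coord m) x₀).MDifferentiable (𝓡 m) (𝓡 m) :=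
  have : IsManifold (𝓡 m) 1 M := IsManifold.of_le (n := ∞) (by simp)
  mdifferentiable_chart x₀

variable {x₀}

/-- The differential at `x` of the chart around `x₀`. -/
def chartEquiv {x : M} (hx : x ∈ (chartAt (Coord m) x₀).source) :
    TangentSpace (𝓡 m) x ≃L[ℝ] Coord m :=
  ((mdifferentiable_chartAt x₀).mfderiv hx).trans (NormedSpace.fromTangentSpace _)

theorem coe_chartEquiv {x : M} (hx : x ∈ (chartAt (Coord m) x₀).source) :
    (chartEquiv hx : TangentSpace (𝓡 m) x →L[ℝ] Coord m) =
      mvfderiv (𝓡 m) (chartAt (Coord m) x₀) x := rfl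

theorem chartEquiv_apply {x : M} (hx : x ∈ (chartAt (Coord m) x₀).source)
    (v : TangentSpace (𝓡 m) x) :
    chartEquiv hx v = mvfderiv (𝓡 m) (chartAt (Coord m) x₀) x v := rfl

theorem pushforward_chartSymm {y : Coord m} (hy : y ∈ (chartAt (Coord m) x₀).target)
    (v : Coord m) :
    pushforward (chartAt (Coord m) x₀).symm y v =
      (chartEquiv ((chartAt (Coord m) x₀).map_target hy)).symm v := by
  rw [ContinuousLinearEquiv.eq_symm_apply, chartEquiv_apply]
  have := (mdifferentiable_chartAt x₀).comp_symm_deriv hy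
  exact congrArg (fun L => L v) this

/-- The chain rule for a parametrization read in a chart. -/
theorem hasFDerivAt_chart_comp {n : ℕ} {ψ : Coord n → M} {y : Coord n}
    (hψ : MDifferentiableAt (𝓡 n) (𝓡 m) ψ y) (hy : ψ y ∈ (chartAt (Coord m) x₀).source) :
    HasFDerivAt (fun s => chartAt (Coord m) x₀ (ψ s))
      ((mvfderiv (𝓡 m) (chartAt (Coord m) x₀) (ψ y)).comp (pushforward ψ y)) y := by
  have h1 := ((mdifferentiable_chartAt x₀).mdifferentiableAt hy).hasMFDerivAt.comp y
    hψ.hasMFDerivAt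
  exact h1.hasFDerivAt

/-- The chain rule for a function on `M` read in a chart. -/
theorem hasFDerivAt_comp_chartSymm {G : Type*} [NormedAddCommGroup G] [NormedSpace ℝ G]
    {f : M → G} {y : Coord m} (hy : y ∈ (chartAt (Coord m) x₀).target)
    (hf : MDifferentiableAt (𝓡 m) 𝓘(ℝ, G) f ((chartAt (Coord m) x₀).symm y)) :
    HasFDerivAt (fun s => f ((chartAt (Coord m) x₀).symm s))
      ((mvfderiv (𝓡 m) f ((chartAt (Coord m) x₀).symm y)).comp
        (pushforward (chartAt (Coord m) x₀).symm y)) y := by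
  have h1 := hf.hasMFDerivAt.comp y ((mdifferentiable_chartAt x₀).mdifferentiableAt_symm hy).hasMFDerivAt
  exact h1.hasFDerivAt

variable [RiemannianBundle (fun x : M => TangentSpace (𝓡 m) x)]

theorem metricForm_chartMetric {x : M} (hx : x ∈ (chartAt (Coord m) x₀).source)
    (v w : TangentSpace (𝓡 m) x) :
    metricForm (chartMetric m x₀) (chartAt (Coord m) x₀ x)
      (mvfderiv (𝓡 m) (chartAt (Coord m) x₀) x v) (mvfderiv (𝓡 m) (chartAt (Coord m) x₀) x w) =
        inner ℝ v w := by
  obtain ⟨y, hy, rfl⟩ : ∃ y ∈ (chartAt (Coord m) x₀).target, (chartAt (Coord m) x₀).symm y = x :=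
    ⟨_, (chartAt (Coord m) x₀).map_source hx, (chartAt (Coord m) x₀).left_inv hx⟩
  rw [(chartAt (Coord m) x₀).right_inv hy, chartMetric, metricForm_pullbackMetric,
    pushforward_chartSymm hy, pushforward_chartSymm hy, ← chartEquiv_apply hx,
    ← chartEquiv_apply hx]
  simp

/-- A parametrization read in a chart is an isometric immersion. -/
theorem isIsometricOn_chart_comp {n : ℕ} {ψ : Coord n → M} {V : Set (Coord n)} (hV : IsOpen V)
    (hψ : ContMDiffOn (𝓡 n) (𝓡 m) ∞ ψ V) (hmaps : MapsTo ψ V (chartAt (Coord m) x₀).source) :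
    IsIsometricOn (chartAt (Coord m) x₀).target (metricForm (chartMetric m x₀)) V
      (metricForm (pullbackMetric m ψ)) (fun s => chartAt (Coord m) x₀ (ψ s)) where
  contDiffOn := by
    rw [← contMDiffOn_iff_contDiffOn]
    exact (contMDiffOn_chart (I := 𝓡 m) (n := ∞) (x := x₀)).comp hψ hmaps
  mapsTo := fun y hy => (chartAt (Coord m) x₀).map_source (hmaps hy)
  metric_eq := fun t ht v w => by
    have hd := hasFDerivAt_chart_comp ((hψ.contMDiffAt (hV.mem_nhds ht)).mdifferentiableAt
      (by simp)) (hmaps ht)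
    rw [hd.fderiv, metricForm_pullbackMetric, ContinuousLinearMap.comp_apply,
      ContinuousLinearMap.comp_apply, metricForm_chartMetric (hmaps ht)]

variable [IsContMDiffRiemannianBundle (𝓡 m) ∞ (EuclideanSpace ℝ (Fin m))
    (fun x : M => TangentSpace (𝓡 m) x)]

theorem isMetricMatrix_chartMetric (x₀ : M) :
    IsMetricMatrix (chartAt (Coord m) x₀).target (chartMetric m x₀) :=
  isMetricMatrix_pullbackMetric (chartAt (Coord m) x₀).open_target (contMDiffOn_chartSymm x₀)
    fun _ hy => (mdifferentiable_chartAt x₀).symm.mfderiv_injective hy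

/-- The Levi-Civita connection in the chart around `x₀`. -/
theorem isLeviCivita_chart (x₀ : M) :
    IsLeviCivita (chartAt (Coord m) x₀).target (metricForm (chartMetric m x₀))
      (christoffelForm (chartMetric m x₀)) :=
  (isMetricMatrix_chartMetric x₀).isLeviCivita

end Chart

end ManifoldCharts

theorem IsLeviCivita.mono {E : Type*} [NormedAddCommGroup E] [NormedSpace ℝ E] {U V : Set E}
    {g : E → E →L[ℝ] E →L[ℝ] ℝ} {Γ : E → E →L[ℝ] E →L[ℝ] E} (h : IsLeviCivita U g Γ)
    (hV : IsOpen V) (hVU : V ⊆ U) : IsLeviCivita V g Γ where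
  isOpen := hV
  contDiffOn_metric := h.contDiffOn_metric.mono hVU
  contDiffOn_connection := h.contDiffOn_connection.mono hVU
  metric_symm := fun y hy => h.metric_symm y (hVU hy)
  metric_pos := fun y hy => h.metric_pos y (hVU hy)
  connection_symm := fun y hy => h.connection_symm y (hVU hy)
  fderiv_metric := fun y hy => h.fderiv_metric y (hVU hy)

theorem traceCLM_conj {E F : Type*} [NormedAddCommGroup E] [NormedSpace ℝ E]
    [FiniteDimensional ℝ E] [NormedAddCommGroup F] [NormedSpace ℝ F] [FiniteDimensional ℝ F]
    (L : F ≃L[ℝ] E) {A : E →L[ℝ] E} {B : F →L[ℝ] F} (h : ∀ v, A (L v) = L (B v)) :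
    traceCLM A = traceCLM B := by
  rw [traceCLM_apply, traceCLM_apply, ← LinearMap.trace_conj' (B : F →ₗ[ℝ] F) L.toLinearEquiv]
  congr 1
  ext v
  simp [LinearEquiv.conj_apply, ← h]

/-! ### Independence of the chart -/

section ChartInvariance

variable {m : ℕ} {M : Type*} [TopologicalSpace M] [ChartedSpace (Coord m) M]
  [IsManifold (𝓡 m) ∞ M] {x₀ x₁ x : M}

/-- The change of charts at `x`, on tangent vectors. -/
def transitionEquiv (h₀ : x ∈ (chartAt (Coord m) x₀).source)
    (h₁ : x ∈ (chartAt (Coord m) x₁).source) : Coord m ≃L[ℝ] Coord m :=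
  (chartEquiv h₁).symm.trans (chartEquiv h₀)

theorem transitionEquiv_apply (h₀ : x ∈ (chartAt (Coord m) x₀).source)
    (h₁ : x ∈ (chartAt (Coord m) x₁).source) (v : TangentSpace (𝓡 m) x) :
    transitionEquiv h₀ h₁ (mvfderiv (𝓡 m) (chartAt (Coord m) x₁) x v) =
      mvfderiv (𝓡 m) (chartAt (Coord m) x₀) x v := by
  rw [← chartEquiv_apply h₁, ← chartEquiv_apply h₀]
  simp [transitionEquiv]

/-- The overlap of two charts, in the second one. -/
def overlap (x₀ x₁ : M) : Set (Coord m) :=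
  (chartAt (Coord m) x₁).target ∩ (chartAt (Coord m) x₁).symm ⁻¹' (chartAt (Coord m) x₀).source

omit [IsManifold (𝓡 m) ∞ M] in
theorem isOpen_overlap (x₀ x₁ : M) : IsOpen (overlap (m := m) x₀ x₁) :=
  (chartAt (Coord m) x₁).isOpen_inter_preimage_symm (chartAt (Coord m) x₀).open_source

omit [IsManifold (𝓡 m) ∞ M] in
theorem mem_overlap (h₀ : x ∈ (chartAt (Coord m) x₀).source)
    (h₁ : x ∈ (chartAt (Coord m) x₁).source) : chartAt (Coord m) x₁ x ∈ overlap (m := m) x₀ x₁ :=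
  ⟨(chartAt (Coord m) x₁).map_source h₁, by
    rwa [mem_preimage, (chartAt (Coord m) x₁).left_inv h₁]⟩

theorem hasFDerivAt_transition (h₀ : x ∈ (chartAt (Coord m) x₀).source)
    (h₁ : x ∈ (chartAt (Coord m) x₁).source) :
    HasFDerivAt (fun s => chartAt (Coord m) x₀ ((chartAt (Coord m) x₁).symm s))
      (transitionEquiv h₀ h₁ : Coord m →L[ℝ] Coord m) (chartAt (Coord m) x₁ x) := by
  obtain ⟨y, hy, rfl⟩ : ∃ y ∈ (chartAt (Coord m) x₁).target, (chartAt (Coord m) x₁).symm y = x :=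
    ⟨_, (chartAt (Coord m) x₁).map_source h₁, (chartAt (Coord m) x₁).left_inv h₁⟩
  rw [(chartAt (Coord m) x₁).right_inv hy]
  have := hasFDerivAt_chart_comp (x₀ := x₀)
    ((mdifferentiable_chartAt x₁).mdifferentiableAt_symm hy) h₀
  have e : (transitionEquiv h₀ h₁ : Coord m →L[ℝ] Coord m) =
      (mvfderiv (𝓡 m) (chartAt (Coord m) x₀) ((chartAt (Coord m) x₁).symm y)).comp
        (pushforward (chartAt (Coord m) x₁).symm y) := by
    ext v : 1
    rw [ContinuousLinearMap.comp_apply, pushforward_chartSymm hy]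
    rfl
  rw [e]
  exact this

variable [RiemannianBundle (fun x : M => TangentSpace (𝓡 m) x)]

/-- An inverse chart is a parametrization and `chartMetric` is its pullback metric, so a change of
charts is an instance of `isIsometricOn_chart_comp`. -/
theorem isIsometricOn_transition (x₀ x₁ : M) :
    IsIsometricOn (chartAt (Coord m) x₀).target (metricForm (chartMetric m x₀)) (overlap x₀ x₁)
      (metricForm (chartMetric m x₁))
      (fun s => chartAt (Coord m) x₀ ((chartAt (Coord m) x₁).symm s)) :=
  isIsometricOn_chart_comp (isOpen_overlap x₀ x₁)
    ((contMDiffOn_chartSymm x₁).mono inter_subset_left) fun _ hs => hs.2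

variable [IsContMDiffRiemannianBundle (𝓡 m) ∞ (EuclideanSpace ℝ (Fin m))
    (fun x : M => TangentSpace (𝓡 m) x)]

theorem isLeviCivita_overlap (x₀ x₁ : M) :
    IsLeviCivita (overlap x₀ x₁) (metricForm (chartMetric m x₁))
      (christoffelForm (chartMetric m x₁)) :=
  (isLeviCivita_chart x₁).mono (isOpen_overlap x₀ x₁) inter_subset_left

/-- The Ricci form can be computed in any chart. -/
theorem ricci_eq_ricciForm (h₀ : x ∈ (chartAt (Coord m) x₀).source)
    (v w : TangentSpace (𝓡 m) x) :
    ricci m x v w = ricciForm (christoffelForm (chartMetric m x₀)) (chartAt (Coord m) x₀ x)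
      (mvfderiv (𝓡 m) (chartAt (Coord m) x₀) x v)
      (mvfderiv (𝓡 m) (chartAt (Coord m) x₀) x w) := by
  have h₁ := mem_chart_source (Coord m) x
  have ht := mem_overlap h₀ h₁
  have hd := (hasFDerivAt_transition h₀ h₁).fderiv
  have hξ : (chartAt (Coord m) x₀) ((chartAt (Coord m) x).symm (chartAt (Coord m) x x)) =
      chartAt (Coord m) x₀ x := by rw [(chartAt (Coord m) x).left_inv h₁]
  rw [ricci, (isMetricMatrix_chartMetric x).sum_ricciCoord_mul ht.1, ricciForm, ricciForm]
  refine (traceCLM_conj (transitionEquiv h₀ h₁) fun z => ?_).symm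
  have := curvature_map_of_surjective (isLeviCivita_chart x₀) (isLeviCivita_overlap x₀ x)
    (isIsometricOn_transition x₀ x) ht (by rw [hd]; exact (transitionEquiv h₀ h₁).surjective)
    z (chartDiff m x v) (chartDiff m x w)
  simp only [hd, ContinuousLinearEquiv.coe_coe, hξ] at this
  rw [curvatureEnd_apply, curvatureEnd_apply, ← this, chartDiff, transitionEquiv_apply,
    transitionEquiv_apply]

/-- The covariant derivative can be computed in any chart. -/
theorem mvfderiv_covDeriv (X : ∀ z : M, TangentSpace (𝓡 m) z)
    (h₀ : x ∈ (chartAt (Coord m) x₀).source)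
    (hX₀ : DifferentiableAt ℝ (fieldInChart m X x₀) (chartAt (Coord m) x₀ x))
    (hX : DifferentiableAt ℝ (fieldInChart m X x) (chartAt (Coord m) x x))
    (v : TangentSpace (𝓡 m) x) :
    mvfderiv (𝓡 m) (chartAt (Coord m) x₀) x (covDeriv m X x v) =
      nablaEnd (christoffelForm (chartMetric m x₀)) (fieldInChart m X x₀)
        (chartAt (Coord m) x₀ x) (mvfderiv (𝓡 m) (chartAt (Coord m) x₀) x v) := by
  have h₁ := mem_chart_source (Coord m) x
  have ht := mem_overlap h₀ h₁
  have hd := (hasFDerivAt_transition h₀ h₁).fderiv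
  have hξ : (chartAt (Coord m) x₀) ((chartAt (Coord m) x).symm (chartAt (Coord m) x x)) =
      chartAt (Coord m) x₀ x := by rw [(chartAt (Coord m) x).left_inv h₁]
  have own : mvfderiv (𝓡 m) (chartAt (Coord m) x) x (covDeriv m X x v) =
      nablaEnd (christoffelForm (chartMetric m x)) (fieldInChart m X x)
        (chartAt (Coord m) x x) (chartDiff m x v) := by
    -- `ContinuousLinearMap.inverse` is zero by default on maps that are not invertible; the
    -- differential of a chart is invertible on its domain, so here it is the true inverse.
    have hinv : (chartDiff m x).inverse = ((chartEquiv h₁).symm : Coord m →L[ℝ] _) := by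
      rw [chartDiff, ← coe_chartEquiv h₁]
      exact ContinuousLinearMap.inverse_equiv _
    rw [covDeriv, hinv, ← chartEquiv_apply h₁]
    simp only [ContinuousLinearMap.comp_apply, ContinuousLinearEquiv.coe_coe,
      ContinuousLinearEquiv.apply_symm_apply, _root_.add_apply, nablaEnd_apply]
    congr 1
    ext k
    rw [christoffelForm_apply, Matrix.ofLp_toEuclideanCLM]
    simp only [Matrix.mulVec, dotProduct, Matrix.of_apply, Finset.sum_mul]
    exact Finset.sum_congr rfl fun i _ => Finset.sum_congr rfl fun j _ => by ring
  have key := covAlong_map_of_surjective (isLeviCivita_chart x₀) (isLeviCivita_overlap x₀ x)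
    (isIsometricOn_transition x₀ x) ht (by rw [hd]; exact (transitionEquiv h₀ h₁).surjective)
    (X := fieldInChart m X x₀) (X' := fieldInChart m X x) (by rwa [hξ]) hX
    (by
      filter_upwards [(isOpen_overlap x₀ x).mem_nhds ht] with s hs
      have h1' : (chartAt (Coord m) x).symm s ∈ (chartAt (Coord m) x).source :=
        (chartAt (Coord m) x).map_target hs.1
      have := (hasFDerivAt_transition hs.2 h1').fderiv
      rw [(chartAt (Coord m) x).right_inv hs.1] at this
      rw [this, fieldInChart, fieldInChart, (chartAt (Coord m) x₀).left_inv hs.2]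
      exact (transitionEquiv_apply hs.2 h1' _).symm) (chartDiff m x v)
  simp only [hd, ContinuousLinearEquiv.coe_coe, hξ] at key
  rw [← transitionEquiv_apply h₀ h₁, own, nablaEnd_apply, nablaEnd_apply, ← key,
    ← transitionEquiv_apply h₀ h₁]
  rfl

end ChartInvariance

/-! ### The gradient in coordinates -/

section GradientCoord

variable {n : ℕ} {U : Set (Coord n)} {g : Coord n → Matrix (Fin n) (Fin n) ℝ} {F : Coord n → ℝ}

/-- The gradient of `F` with respect to the metric with matrix `g`. -/
def gradCoord (g : Coord n → Matrix (Fin n) (Fin n) ℝ) (F : Coord n → ℝ) (y : Coord n) : Coord n :=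
  ∑ i, (∑ j, (g y)⁻¹ i j * fderiv ℝ F y (stdVec j)) • stdVec i

theorem gradCoord_apply (g : Coord n → Matrix (Fin n) (Fin n) ℝ) (F : Coord n → ℝ) (y : Coord n)
    (i : Fin n) : gradCoord g F y i = ∑ j, (g y)⁻¹ i j * fderiv ℝ F y (stdVec j) := by
  simp [gradCoord, stdVec, Pi.single_apply]

theorem IsMetricMatrix.metricForm_gradCoord (hg : IsMetricMatrix U g) {y : Coord n} (hy : y ∈ U)
    (w : Coord n) : metricForm g y (gradCoord g F y) w = fderiv ℝ F y w := by
  set κ : Fin n → ℝ := fun j => fderiv ℝ F y (stdVec j)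
  have hu : IsUnit (g y).det := (hg.posDef y hy).det_pos.ne'.isUnit
  have h2 : (g y).mulVec ((g y)⁻¹.mulVec κ) = κ := by
    rw [Matrix.mulVec_mulVec, Matrix.mul_nonsing_inv _ hu, Matrix.one_mulVec]
  have e := map_eq_sum_stdVec (fderiv ℝ F y).toLinearMap w
  simp only [ContinuousLinearMap.coe_coe, smul_eq_mul] at e
  have e2 : ∑ i, w i * fderiv ℝ F y (stdVec i) = ∑ i, w i * κ i := rfl
  rw [metricForm_apply, e, e2, ← h2]
  simp only [gradCoord_apply, Matrix.mulVec, dotProduct, Finset.mul_sum, Finset.sum_mul]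
  rw [Finset.sum_comm]
  refine Finset.sum_congr rfl fun i _ => Finset.sum_congr rfl fun j _ =>
    Finset.sum_congr rfl fun l _ => ?_
  rw [hg.symm hy j i]
  ring

theorem IsMetricMatrix.contDiffAt_gradCoord (hg : IsMetricMatrix U g) {y : Coord n} (hy : y ∈ U)
    (hF : ContDiffAt ℝ ∞ F y) : ContDiffAt ℝ ∞ (gradCoord g F) y := by
  unfold gradCoord
  exact ContDiffAt.sum fun i _ => ContDiffAt.smul_vec
    (ContDiffAt.sum fun j _ => (hg.contDiffAt_inv hy i j).mul (contDiffAt_fderiv_apply hF _)) _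

end GradientCoord

/-! ### The unit normal field and its covariant derivative in a chart -/

section UnitNormal

variable {m : ℕ} {M : Type*} [TopologicalSpace M] [ChartedSpace (Coord m) M]
  [IsManifold (𝓡 m) ∞ M] [RiemannianBundle (fun x : M => TangentSpace (𝓡 m) x)]
  [IsContMDiffRiemannianBundle (𝓡 m) ∞ (EuclideanSpace ℝ (Fin m))
    (fun x : M => TangentSpace (𝓡 m) x)]
  {x₀ x : M} {f : M → ℝ}

omit [IsManifold (𝓡 m) ∞ M] [IsContMDiffRiemannianBundle (𝓡 m) ∞ (EuclideanSpace ℝ (Fin m))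
    (fun x : M => TangentSpace (𝓡 m) x)] in
theorem inner_grad (f : M → ℝ) (x : M) (v : TangentSpace (𝓡 m) x) :
    inner ℝ (grad m f x) v = mvfderiv (𝓡 m) f x v := by
  rw [grad, InnerProductSpace.toDual_symm_apply]

omit [IsContMDiffRiemannianBundle (𝓡 m) ∞ (EuclideanSpace ℝ (Fin m))
    (fun x : M => TangentSpace (𝓡 m) x)] [RiemannianBundle (fun x : M => TangentSpace (𝓡 m) x)] in
/-- The differential of a function, computed in a chart. -/
theorem fderiv_chart_apply (hx : x ∈ (chartAt (Coord m) x₀).source)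
    (hf : MDifferentiableAt (𝓡 m) 𝓘(ℝ, ℝ) f x) (v : TangentSpace (𝓡 m) x) :
    fderiv ℝ (fun s => f ((chartAt (Coord m) x₀).symm s)) (chartAt (Coord m) x₀ x)
      (mvfderiv (𝓡 m) (chartAt (Coord m) x₀) x v) = mvfderiv (𝓡 m) f x v := by
  obtain ⟨y, hy, rfl⟩ : ∃ y ∈ (chartAt (Coord m) x₀).target, (chartAt (Coord m) x₀).symm y = x :=
    ⟨_, (chartAt (Coord m) x₀).map_source hx, (chartAt (Coord m) x₀).left_inv hx⟩
  rw [(chartAt (Coord m) x₀).right_inv hy, (hasFDerivAt_comp_chartSymm hy hf).fderiv,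
    ContinuousLinearMap.comp_apply, pushforward_chartSymm hy, ← chartEquiv_apply hx]
  simp

/-- Both sides represent the differential of `f` with respect to the same nondegenerate form.
Smoothness of `grad`, which is defined pointwise by duality, is read off the coordinate formula. -/
theorem mvfderiv_grad (hx : x ∈ (chartAt (Coord m) x₀).source)
    (hf : MDifferentiableAt (𝓡 m) 𝓘(ℝ, ℝ) f x) :
    mvfderiv (𝓡 m) (chartAt (Coord m) x₀) x (grad m f x) =
      gradCoord (chartMetric m x₀) (fun s => f ((chartAt (Coord m) x₀).symm s))
        (chartAt (Coord m) x₀ x) := by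
  have hy := (chartAt (Coord m) x₀).map_source hx
  have hg := isMetricMatrix_chartMetric (m := m) x₀
  refine hg.eq_of_metricForm hy fun z => ?_
  obtain ⟨z, rfl⟩ := (chartEquiv hx).surjective z
  rw [hg.metricForm_gradCoord hy, chartEquiv_apply, metricForm_chartMetric hx, inner_grad,
    fderiv_chart_apply hx hf]

variable {Ω : Set M}

/-- The part of the open set `Ω` in the domain of a chart, in coordinates. -/
def chartRegion (m : ℕ) [ChartedSpace (Coord m) M] (Ω : Set M) (x₀ : M) : Set (Coord m) :=
  (chartAt (Coord m) x₀).target ∩ (chartAt (Coord m) x₀).symm ⁻¹' Ω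

omit [IsManifold (𝓡 m) ∞ M] [RiemannianBundle (fun x : M => TangentSpace (𝓡 m) x)]
  [IsContMDiffRiemannianBundle (𝓡 m) ∞ (EuclideanSpace ℝ (Fin m))
    (fun x : M => TangentSpace (𝓡 m) x)] in
theorem isOpen_chartRegion (hΩ : IsOpen Ω) (x₀ : M) : IsOpen (chartRegion m Ω x₀) :=
  (chartAt (Coord m) x₀).isOpen_inter_preimage_symm hΩ

omit [IsManifold (𝓡 m) ∞ M] [RiemannianBundle (fun x : M => TangentSpace (𝓡 m) x)]
  [IsContMDiffRiemannianBundle (𝓡 m) ∞ (EuclideanSpace ℝ (Fin m))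
    (fun x : M => TangentSpace (𝓡 m) x)] in
theorem mem_chartRegion (hx : x ∈ (chartAt (Coord m) x₀).source) (hΩx : x ∈ Ω) :
    chartAt (Coord m) x₀ x ∈ chartRegion m Ω x₀ :=
  ⟨(chartAt (Coord m) x₀).map_source hx, by
    rwa [mem_preimage, (chartAt (Coord m) x₀).left_inv hx]⟩

omit [RiemannianBundle (fun x : M => TangentSpace (𝓡 m) x)]
  [IsContMDiffRiemannianBundle (𝓡 m) ∞ (EuclideanSpace ℝ (Fin m))
    (fun x : M => TangentSpace (𝓡 m) x)] in
theorem contDiffAt_chart (hΩ : IsOpen Ω) (hf : ContMDiffOn (𝓡 m) 𝓘(ℝ, ℝ) ∞ f Ω) {y : Coord m}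
    (hy : y ∈ chartRegion m Ω x₀) :
    ContDiffAt ℝ ∞ (fun s => f ((chartAt (Coord m) x₀).symm s)) y := by
  have h1 : ContMDiffOn (𝓡 m) 𝓘(ℝ, ℝ) ∞ (fun s => f ((chartAt (Coord m) x₀).symm s))
      (chartRegion m Ω x₀) :=
    hf.comp ((contMDiffOn_chartSymm x₀).mono inter_subset_left) fun s hs => hs.2
  rw [← contMDiffAt_iff_contDiffAt]
  exact h1.contMDiffAt ((isOpen_chartRegion hΩ x₀).mem_nhds hy)

/-- `Ω` is open and `f` is smooth without critical points on `Ω`. -/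
structure IsRegularOn (m : ℕ) [ChartedSpace (Coord m) M] (Ω : Set M) (f : M → ℝ) : Prop where
  isOpen : IsOpen Ω
  contMDiffOn : ContMDiffOn (𝓡 m) 𝓘(ℝ, ℝ) ∞ f Ω
  mfderiv_ne_zero : ∀ x ∈ Ω, mfderiv (𝓡 m) 𝓘(ℝ, ℝ) f x ≠ 0

/-- The slope `|∇f|` in a chart. -/
def slopeCoord (m : ℕ) [ChartedSpace (Coord m) M]
    [RiemannianBundle (fun x : M => TangentSpace (𝓡 m) x)] (f : M → ℝ) (x₀ : M)
    (y : Coord m) : ℝ :=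
  Real.sqrt (metricForm (chartMetric m x₀) y
    (gradCoord (chartMetric m x₀) (fun s => f ((chartAt (Coord m) x₀).symm s)) y)
    (gradCoord (chartMetric m x₀) (fun s => f ((chartAt (Coord m) x₀).symm s)) y))

namespace IsRegularOn

omit [IsManifold (𝓡 m) ∞ M] [RiemannianBundle (fun x : M => TangentSpace (𝓡 m) x)]
  [IsContMDiffRiemannianBundle (𝓡 m) ∞ (EuclideanSpace ℝ (Fin m))
    (fun x : M => TangentSpace (𝓡 m) x)] in
theorem mdifferentiableAt (h : IsRegularOn m Ω f) (hx : x ∈ Ω) :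
    MDifferentiableAt (𝓡 m) 𝓘(ℝ, ℝ) f x :=
  (h.contMDiffOn.contMDiffAt (h.isOpen.mem_nhds hx)).mdifferentiableAt (by simp)

omit [IsManifold (𝓡 m) ∞ M]
  [IsContMDiffRiemannianBundle (𝓡 m) ∞ (EuclideanSpace ℝ (Fin m))
    (fun x : M => TangentSpace (𝓡 m) x)] in
theorem grad_ne_zero (h : IsRegularOn m Ω f) (hx : x ∈ Ω) : grad m f x ≠ 0 := by
  intro h0
  apply h.mfderiv_ne_zero x hx
  ext v
  have := inner_grad f x v
  rw [h0, inner_zero_left] at this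
  exact this.symm

theorem norm_grad (h : IsRegularOn m Ω f) (hx : x ∈ (chartAt (Coord m) x₀).source)
    (hΩx : x ∈ Ω) : ‖grad m f x‖ = slopeCoord m f x₀ (chartAt (Coord m) x₀ x) := by
  rw [slopeCoord, ← mvfderiv_grad hx (h.mdifferentiableAt hΩx), metricForm_chartMetric hx,
    norm_eq_sqrt_real_inner]

theorem fieldInChart_unitNormal (h : IsRegularOn m Ω f) {y : Coord m}
    (hy : y ∈ chartRegion m Ω x₀) :
    fieldInChart m (unitNormal m f) x₀ y = (slopeCoord m f x₀ y)⁻¹ •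
      gradCoord (chartMetric m x₀) (fun s => f ((chartAt (Coord m) x₀).symm s)) y := by
  have hx := (chartAt (Coord m) x₀).map_target hy.1
  rw [fieldInChart, unitNormal, map_smul, mvfderiv_grad hx (h.mdifferentiableAt hy.2),
    h.norm_grad hx hy.2, (chartAt (Coord m) x₀).right_inv hy.1]

theorem slopeCoord_pos (h : IsRegularOn m Ω f) {y : Coord m} (hy : y ∈ chartRegion m Ω x₀) :
    0 < slopeCoord m f x₀ y := by
  have hx := (chartAt (Coord m) x₀).map_target hy.1
  have := h.norm_grad hx hy.2
  rw [(chartAt (Coord m) x₀).right_inv hy.1] at this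
  rw [← this]
  exact norm_pos_iff.2 (h.grad_ne_zero hy.2)

theorem contDiffAt_slopeCoord (h : IsRegularOn m Ω f) {y : Coord m}
    (hy : y ∈ chartRegion m Ω x₀) : ContDiffAt ℝ ∞ (slopeCoord m f x₀) y := by
  have hg := isMetricMatrix_chartMetric (m := m) x₀
  have hG := hg.contDiffAt_gradCoord hy.1 (contDiffAt_chart h.isOpen h.contMDiffOn hy)
  refine ContDiffAt.sqrt (((hg.contDiffAt_metricForm hy.1).clm_apply hG).clm_apply hG) ?_
  exact (Real.sqrt_pos.1 (h.slopeCoord_pos hy)).ne'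

theorem contDiffAt_unitNormal (h : IsRegularOn m Ω f) {y : Coord m}
    (hy : y ∈ chartRegion m Ω x₀) : ContDiffAt ℝ ∞ (fieldInChart m (unitNormal m f) x₀) y := by
  have hg := isMetricMatrix_chartMetric (m := m) x₀
  have hG := hg.contDiffAt_gradCoord hy.1 (contDiffAt_chart h.isOpen h.contMDiffOn hy)
  have h1 : ContDiffAt ℝ ∞ (fun s => (slopeCoord m f x₀ s)⁻¹ •
      gradCoord (chartMetric m x₀) (fun s => f ((chartAt (Coord m) x₀).symm s)) s) y :=
    ((h.contDiffAt_slopeCoord hy).inv (h.slopeCoord_pos hy).ne').smul hG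
  refine h1.congr_of_eventuallyEq ?_
  filter_upwards [(isOpen_chartRegion h.isOpen x₀).mem_nhds hy] with s hs
  exact h.fieldInChart_unitNormal hs

theorem metricForm_unitNormal (h : IsRegularOn m Ω f) {y : Coord m}
    (hy : y ∈ chartRegion m Ω x₀) (w : Coord m) :
    metricForm (chartMetric m x₀) y (fieldInChart m (unitNormal m f) x₀ y) w =
      (slopeCoord m f x₀ y)⁻¹ *
        fderiv ℝ (fun s => f ((chartAt (Coord m) x₀).symm s)) y w := by
  have hg := isMetricMatrix_chartMetric (m := m) x₀
  rw [h.fieldInChart_unitNormal hy, map_smul, _root_.smul_apply, hg.metricForm_gradCoord hy.1,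
    smul_eq_mul]

omit [IsContMDiffRiemannianBundle (𝓡 m) ∞ (EuclideanSpace ℝ (Fin m))
    (fun x : M => TangentSpace (𝓡 m) x)] in
theorem metricForm_unitNormal_self (h : IsRegularOn m Ω f) {y : Coord m}
    (hy : y ∈ chartRegion m Ω x₀) :
    metricForm (chartMetric m x₀) y (fieldInChart m (unitNormal m f) x₀ y)
      (fieldInChart m (unitNormal m f) x₀ y) = 1 := by
  have hx := (chartAt (Coord m) x₀).map_target hy.1
  have h2 := metricForm_chartMetric hx (unitNormal m f _) (unitNormal m f _)
  rw [(chartAt (Coord m) x₀).right_inv hy.1] at h2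
  rw [fieldInChart, h2, unitNormal, real_inner_smul_left, real_inner_smul_right,
    real_inner_self_eq_norm_sq]
  have := norm_ne_zero_iff.2 (h.grad_ne_zero hy.2)
  field_simp

/-- The covariant derivative of the unit normal, in a chart. -/
theorem mvfderiv_covDeriv_unitNormal (h : IsRegularOn m Ω f)
    (hx : x ∈ (chartAt (Coord m) x₀).source) (hΩx : x ∈ Ω) (v : TangentSpace (𝓡 m) x) :
    mvfderiv (𝓡 m) (chartAt (Coord m) x₀) x (covDeriv m (unitNormal m f) x v) =
      nablaEnd (christoffelForm (chartMetric m x₀)) (fieldInChart m (unitNormal m f) x₀)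
        (chartAt (Coord m) x₀ x) (mvfderiv (𝓡 m) (chartAt (Coord m) x₀) x v) :=
  mvfderiv_covDeriv _ hx
    ((h.contDiffAt_unitNormal (mem_chartRegion hx hΩx)).differentiableAt (by simp))
    ((h.contDiffAt_unitNormal (mem_chartRegion (mem_chart_source _ x) hΩx)).differentiableAt
      (by simp)) v

/-- `∇u` takes values in the tangent spaces of the level sets. -/
theorem metricForm_nablaEnd_unitNormal (h : IsRegularOn m Ω f) {y : Coord m}
    (hy : y ∈ chartRegion m Ω x₀) (v : Coord m) :
    metricForm (chartMetric m x₀) y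
      (nablaEnd (christoffelForm (chartMetric m x₀)) (fieldInChart m (unitNormal m f) x₀) y v)
      (fieldInChart m (unitNormal m f) x₀ y) = 0 := by
  have hLC := isLeviCivita_chart (m := m) x₀
  have du := (h.contDiffAt_unitNormal hy).differentiableAt (by simp)
  have h1 := hLC.fderiv_metric_along (ξ := id) (X := fieldInChart m (unitNormal m f) x₀)
    (Y := fieldInChart m (unitNormal m f) x₀) hy.1 differentiableAt_id du du v
  -- Differentiate ⟨u,u⟩ = 1: the two resulting terms are equal, hence both zero.
  have hev : (fun s => metricForm (chartMetric m x₀) (id s) (fieldInChart m (unitNormal m f) x₀ s)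
      (fieldInChart m (unitNormal m f) x₀ s)) =ᶠ[𝓝 y] fun _ => 1 := by
    filter_upwards [(isOpen_chartRegion h.isOpen x₀).mem_nhds hy] with s hs
    exact h.metricForm_unitNormal_self hs
  rw [hev.fderiv_eq] at h1
  simp only [id, covAlong, fderiv_id, ContinuousLinearMap.id_apply, fderiv_fun_const,
    Pi.zero_apply, _root_.zero_apply] at h1
  rw [hLC.metric_symm y hy.1 (fieldInChart m (unitNormal m f) x₀ y)] at h1
  rw [nablaEnd_apply]
  linarith

/-- `∇u` is symmetric on the tangent spaces of the level sets. -/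
theorem metricForm_nablaEnd_comm (h : IsRegularOn m Ω f) {y : Coord m}
    (hy : y ∈ chartRegion m Ω x₀) {v w : Coord m}
    (hv : fderiv ℝ (fun s => f ((chartAt (Coord m) x₀).symm s)) y v = 0)
    (hw : fderiv ℝ (fun s => f ((chartAt (Coord m) x₀).symm s)) y w = 0) :
    metricForm (chartMetric m x₀) y
      (nablaEnd (christoffelForm (chartMetric m x₀)) (fieldInChart m (unitNormal m f) x₀) y v) w =
    metricForm (chartMetric m x₀) y
      (nablaEnd (christoffelForm (chartMetric m x₀)) (fieldInChart m (unitNormal m f) x₀) y w)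
        v := by
  have hLC := isLeviCivita_chart (m := m) x₀
  have du := (h.contDiffAt_unitNormal hy).differentiableAt (by simp)
  have hF := contDiffAt_chart h.isOpen h.contMDiffOn hy
  have dl : DifferentiableAt ℝ (fun s => (slopeCoord m f x₀ s)⁻¹) y :=
    ((h.contDiffAt_slopeCoord hy).inv (h.slopeCoord_pos hy).ne').differentiableAt (by simp)
  -- Differentiate ⟨u,b⟩ = |∇f|⁻¹ df(b) along `a` for a constant vector `b`. The derivative of
  -- |∇f|⁻¹ is multiplied by df(b) = 0, so only the second derivative of `f` and a Christoffel term
  -- survive, and both are symmetric.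
  have key : ∀ a b, fderiv ℝ (fun s => f ((chartAt (Coord m) x₀).symm s)) y b = 0 →
      metricForm (chartMetric m x₀) y (nablaEnd (christoffelForm (chartMetric m x₀))
        (fieldInChart m (unitNormal m f) x₀) y a) b
      + metricForm (chartMetric m x₀) y (fieldInChart m (unitNormal m f) x₀ y)
        (christoffelForm (chartMetric m x₀) y a b) =
      (slopeCoord m f x₀ y)⁻¹ *
        fderiv ℝ (fderiv ℝ (fun s => f ((chartAt (Coord m) x₀).symm s))) y a b := by
    intro a b hb
    have h1 := hLC.fderiv_metric_along (ξ := id) (X := fieldInChart m (unitNormal m f) x₀)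
      (Y := fun _ => b) hy.1 differentiableAt_id du (differentiableAt_const _) a
    have hev : (fun s => metricForm (chartMetric m x₀) (id s)
        (fieldInChart m (unitNormal m f) x₀ s) b) =ᶠ[𝓝 y] fun s => (slopeCoord m f x₀ s)⁻¹ *
          fderiv ℝ (fun s => f ((chartAt (Coord m) x₀).symm s)) s b := by
      filter_upwards [(isOpen_chartRegion h.isOpen x₀).mem_nhds hy] with s hs
      exact h.metricForm_unitNormal hs b
    rw [hev.fderiv_eq, fderiv_fun_mul dl
      ((contDiffAt_fderiv_apply hF b).differentiableAt (by simp))] at h1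
    simp only [id, covAlong, fderiv_id, ContinuousLinearMap.id_apply, fderiv_fun_const, hb,
      Pi.zero_apply, _root_.zero_apply, _root_.add_apply, _root_.smul_apply, smul_eq_mul,
      zero_mul, add_zero, zero_add, fderiv_fderiv_apply hF] at h1
    rw [nablaEnd_apply, ← h1]
  have k1 := key v w hw
  have k2 := key w v hv
  rw [fderiv_fderiv_comm hF, hLC.connection_symm y hy.1] at k1
  linarith

end IsRegularOn

end UnitNormal

/-! ### Symmetric functions of the eigenvalues as traces -/

section SymmetricRoots

/-- Newton's identity p₁² = p₂ + 2e₂, by the recursion e₂(a, s) = e₂(s) + a e₁(s). -/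
theorem Multiset.sum_sq_eq (s : Multiset ℝ) :
    s.sum ^ 2 = (s.map fun a => a ^ 2).sum + 2 * s.esymm 2 := by
  induction s using Multiset.induction with
  | empty => simp [Multiset.esymm, Multiset.powersetCard_zero_right 1]
  | cons a s ih =>
    have h : (a ::ₘ s).esymm 2 = s.esymm 2 + a * s.sum := by
      simp only [Multiset.esymm]
      rw [show (2 : ℕ) = 1 + 1 from rfl, Multiset.powersetCard_cons]
      have h1 := Multiset.sum_map_mul_left (s := s) (a := a) (f := fun b => b)
      rw [Multiset.map_id'] at h1
      simp [Multiset.powersetCard_one, Multiset.map_map, h1]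
    rw [h]
    simp only [Multiset.sum_cons, Multiset.map_cons]
    linear_combination ih

variable {V : Type*} [NormedAddCommGroup V] [InnerProductSpace ℝ V] [FiniteDimensional ℝ V]

/-- A symmetric operator is diagonal in an orthonormal eigenbasis, so its characteristic polynomial
splits over ℝ and no eigenvalue is missing from `roots`. -/
theorem sum_roots_charpoly_of_isSymmetric {T : V →ₗ[ℝ] V} (hT : T.IsSymmetric) :
    T.charpoly.roots.sum = LinearMap.trace ℝ V T := by
  rw [hT.roots_charpoly_eq_eigenvalues rfl,
    LinearMap.trace_eq_matrix_trace ℝ (hT.eigenvectorBasis rfl).toBasis,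
    hT.toMatrix_eigenvectorBasis rfl, Matrix.trace_diagonal]
  rfl

theorem two_mul_esymm_roots_charpoly_of_isSymmetric {T : V →ₗ[ℝ] V} (hT : T.IsSymmetric) :
    2 * T.charpoly.roots.esymm 2 =
      LinearMap.trace ℝ V T ^ 2 - LinearMap.trace ℝ V (T ∘ₗ T) := by
  have h1 : (T.charpoly.roots.map fun a => a ^ 2).sum = LinearMap.trace ℝ V (T ∘ₗ T) := by
    rw [hT.roots_charpoly_eq_eigenvalues rfl,
      LinearMap.trace_eq_matrix_trace ℝ (hT.eigenvectorBasis rfl).toBasis,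
      LinearMap.toMatrix_comp _ (hT.eigenvectorBasis rfl).toBasis,
      hT.toMatrix_eigenvectorBasis rfl, Matrix.diagonal_mul_diagonal, Matrix.trace_diagonal,
      Multiset.map_map]
    simp only [pow_two]
    rfl
  have h2 := Multiset.sum_sq_eq T.charpoly.roots
  rw [h1, sum_roots_charpoly_of_isSymmetric hT] at h2
  linarith

end SymmetricRoots

/-! ### Mean curvature and extrinsic term from ∇u -/

section PrincipalCurvatures

variable {m : ℕ} {M : Type*} [TopologicalSpace M] [ChartedSpace (Coord m) M]
  [IsManifold (𝓡 m) ∞ M] [RiemannianBundle (fun x : M => TangentSpace (𝓡 m) x)]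
  [IsContMDiffRiemannianBundle (𝓡 m) ∞ (EuclideanSpace ℝ (Fin m))
    (fun x : M => TangentSpace (𝓡 m) x)]
  {x₀ x : M} {f : M → ℝ} {Ω : Set M}

/-- `∇u` in the chart around `x₀`. -/
def shapeCoord (m : ℕ) [ChartedSpace (Coord m) M]
    [RiemannianBundle (fun x : M => TangentSpace (𝓡 m) x)] (f : M → ℝ) (x₀ : M)
    (y : Coord m) : Coord m →L[ℝ] Coord m :=
  nablaEnd (christoffelForm (chartMetric m x₀)) (fieldInChart m (unitNormal m f) x₀) y

omit [IsManifold (𝓡 m) ∞ M] [RiemannianBundle (fun x : M => TangentSpace (𝓡 m) x)]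
  [IsContMDiffRiemannianBundle (𝓡 m) ∞ (EuclideanSpace ℝ (Fin m))
    (fun x : M => TangentSpace (𝓡 m) x)] in
theorem mem_levelTangent {v : TangentSpace (𝓡 m) x} :
    v ∈ levelTangent m f x ↔ mvfderiv (𝓡 m) f x v = 0 := Iff.rfl

namespace IsRegularOn

omit [IsManifold (𝓡 m) ∞ M] [IsContMDiffRiemannianBundle (𝓡 m) ∞ (EuclideanSpace ℝ (Fin m))
    (fun x : M => TangentSpace (𝓡 m) x)] in
theorem mem_levelTangent_iff (h : IsRegularOn m Ω f) (hΩx : x ∈ Ω) {v : TangentSpace (𝓡 m) x} :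
    v ∈ levelTangent m f x ↔ inner ℝ v (unitNormal m f x) = 0 := by
  have := norm_ne_zero_iff.2 (h.grad_ne_zero hΩx)
  rw [mem_levelTangent, unitNormal, real_inner_smul_right, real_inner_comm, inner_grad]
  simp [this]

theorem covDeriv_mem_levelTangent (h : IsRegularOn m Ω f) (hΩx : x ∈ Ω)
    (v : TangentSpace (𝓡 m) x) : covDeriv m (unitNormal m f) x v ∈ levelTangent m f x := by
  have hx := mem_chart_source (Coord m) x
  rw [h.mem_levelTangent_iff hΩx, ← metricForm_chartMetric hx,
    h.mvfderiv_covDeriv_unitNormal hx hΩx]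
  have := h.metricForm_nablaEnd_unitNormal (mem_chartRegion hx hΩx)
    (mvfderiv (𝓡 m) (chartAt (Coord m) x) x v)
  rwa [fieldInChart, (chartAt (Coord m) x).left_inv hx] at this

/-- The projection in the definition does nothing, since ∇_v u is already tangent to the level set.
-/
theorem coe_shapeOperator (h : IsRegularOn m Ω f) (hΩx : x ∈ Ω) (v : levelTangent m f x) :
    (shapeOperator m f x v : TangentSpace (𝓡 m) x) = covDeriv m (unitNormal m f) x v := by
  have h1 : shapeOperator m f x v = (levelTangent m f x).orthogonalProjectionOnto
      (covDeriv m (unitNormal m f) x v) := rfl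
  rw [h1]
  exact congrArg Subtype.val (Submodule.orthogonalProjectionOnto_mem_subspace_eq_self
    (⟨_, h.covDeriv_mem_levelTangent hΩx v⟩ : levelTangent m f x))

theorem isSymmetric_shapeOperator (h : IsRegularOn m Ω f) (hΩx : x ∈ Ω) :
    (shapeOperator m f x).IsSymmetric := by
  intro v w
  have hx := mem_chart_source (Coord m) x
  rw [Submodule.coe_inner, Submodule.coe_inner, h.coe_shapeOperator hΩx, h.coe_shapeOperator hΩx,
    real_inner_comm _ (v : TangentSpace (𝓡 m) x),
    ← metricForm_chartMetric hx, ← metricForm_chartMetric hx,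
    h.mvfderiv_covDeriv_unitNormal hx hΩx, h.mvfderiv_covDeriv_unitNormal hx hΩx]
  refine h.metricForm_nablaEnd_comm (mem_chartRegion hx hΩx) ?_ ?_
  · rw [fderiv_chart_apply hx (h.mdifferentiableAt hΩx)]
    exact v.2
  · rw [fderiv_chart_apply hx (h.mdifferentiableAt hΩx)]
    exact w.2

/-- An endomorphism with values in a subspace has the trace of its restriction there. Thus ∇_u u,
although in general not zero, does not contribute to the trace. -/
theorem trace_shapeOperator (h : IsRegularOn m Ω f) (hΩx : x ∈ Ω) :
    LinearMap.trace ℝ _ (shapeOperator m f x) =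
      LinearMap.trace ℝ _ (covDeriv m (unitNormal m f) x).toLinearMap := by
  rw [← LinearMap.trace_restrict_eq_of_forall_mem (levelTangent m f x)
    (covDeriv m (unitNormal m f) x).toLinearMap (h.covDeriv_mem_levelTangent hΩx)]
  congr 1
  ext v
  exact h.coe_shapeOperator hΩx v

theorem trace_shapeOperator_comp_self (h : IsRegularOn m Ω f) (hΩx : x ∈ Ω) :
    LinearMap.trace ℝ _ (shapeOperator m f x ∘ₗ shapeOperator m f x) =
      LinearMap.trace ℝ _ ((covDeriv m (unitNormal m f) x).toLinearMap ∘ₗ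
        (covDeriv m (unitNormal m f) x).toLinearMap) := by
  rw [← LinearMap.trace_restrict_eq_of_forall_mem (levelTangent m f x)
    ((covDeriv m (unitNormal m f) x).toLinearMap ∘ₗ (covDeriv m (unitNormal m f) x).toLinearMap)
      fun v => h.covDeriv_mem_levelTangent hΩx _]
  congr 1
  ext v
  have h1 := h.coe_shapeOperator hΩx (shapeOperator m f x v)
  rw [h.coe_shapeOperator hΩx v] at h1
  exact h1

theorem meanCurvature_eq_trace (h : IsRegularOn m Ω f) (hΩx : x ∈ Ω) :
    meanCurvature m f x = LinearMap.trace ℝ _ (shapeOperator m f x) :=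
  sum_roots_charpoly_of_isSymmetric (h.isSymmetric_shapeOperator hΩx)

theorem extrinsicGauss_eq_trace (h : IsRegularOn m Ω f) (hΩx : x ∈ Ω) :
    extrinsicGauss m f x = LinearMap.trace ℝ _ (shapeOperator m f x) ^ 2 -
      LinearMap.trace ℝ _ (shapeOperator m f x ∘ₗ shapeOperator m f x) :=
  two_mul_esymm_roots_charpoly_of_isSymmetric (h.isSymmetric_shapeOperator hΩx)

theorem conj_covDeriv_unitNormal (h : IsRegularOn m Ω f)
    (hx : x ∈ (chartAt (Coord m) x₀).source) (hΩx : x ∈ Ω) :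
    (chartEquiv hx).toLinearEquiv.conj (covDeriv m (unitNormal m f) x).toLinearMap =
      (shapeCoord m f x₀ (chartAt (Coord m) x₀ x)).toLinearMap := by
  refine LinearMap.ext fun v => ?_
  obtain ⟨v, rfl⟩ := (chartEquiv hx).surjective v
  change chartEquiv hx (covDeriv m (unitNormal m f) x
    ((chartEquiv hx).symm (chartEquiv hx v))) = _
  rw [ContinuousLinearEquiv.symm_apply_apply]
  exact h.mvfderiv_covDeriv_unitNormal hx hΩx v

theorem meanCurvature_eq_chart (h : IsRegularOn m Ω f)
    (hx : x ∈ (chartAt (Coord m) x₀).source) (hΩx : x ∈ Ω) :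
    meanCurvature m f x = traceCLM (shapeCoord m f x₀ (chartAt (Coord m) x₀ x)) := by
  rw [h.meanCurvature_eq_trace hΩx, h.trace_shapeOperator hΩx, traceCLM_apply,
    ← h.conj_covDeriv_unitNormal hx hΩx, LinearMap.trace_conj']

theorem extrinsicGauss_eq_chart (h : IsRegularOn m Ω f)
    (hx : x ∈ (chartAt (Coord m) x₀).source) (hΩx : x ∈ Ω) :
    extrinsicGauss m f x = traceCLM (shapeCoord m f x₀ (chartAt (Coord m) x₀ x)) ^ 2 -
      traceCLM ((shapeCoord m f x₀ (chartAt (Coord m) x₀ x)).comp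
        (shapeCoord m f x₀ (chartAt (Coord m) x₀ x))) := by
  rw [h.extrinsicGauss_eq_trace hΩx, h.trace_shapeOperator hΩx,
    h.trace_shapeOperator_comp_self hΩx, traceCLM_apply, traceCLM_apply,
    ContinuousLinearMap.toLinearMap_comp,
    ← h.conj_covDeriv_unitNormal hx hΩx, ← LinearEquiv.conj_comp, LinearMap.trace_conj',
    LinearMap.trace_conj']

end IsRegularOn

end PrincipalCurvatures

/-! ### Summing the curvature over an orthonormal family -/

section ScalarSum

variable {E : Type*} [NormedAddCommGroup E] [NormedSpace ℝ E] [FiniteDimensional ℝ E]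
  {U : Set E} {g : E → E →L[ℝ] E →L[ℝ] ℝ} {Γ : E → E →L[ℝ] E →L[ℝ] E}

omit [FiniteDimensional ℝ E] in
theorem curvature_swap (Γ : E → E →L[ℝ] E →L[ℝ] E) (y v w z : E) :
    curvature Γ y v w z = -curvature Γ y w v z := by
  simp only [curvature]
  abel

omit [FiniteDimensional ℝ E] in
theorem curvature_self (Γ : E → E →L[ℝ] E →L[ℝ] E) (y v z : E) : curvature Γ y v v z = 0 := by
  simp [curvature]

omit [FiniteDimensional ℝ E] in
-- Antisymmetry in each of the two pairs of arguments suffices for this special case of the pair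
-- symmetry, so the Bianchi identity is not called upon.
theorem IsLeviCivita.sectional_comm (hg : IsLeviCivita U g Γ) {y : E} (hy : y ∈ U) (v w : E) :
    g y (curvature Γ y v w w) v = g y (curvature Γ y w v v) w := by
  rw [curvature_swap, map_neg, _root_.neg_apply, hg.metric_curvature_antisymm hy, neg_neg]

/-- The trace of the Ricci form over a hyperplane with unit normal `u`. -/
theorem IsLeviCivita.sum_ricciForm_option (hg : IsLeviCivita U g Γ) {y : E} (hy : y ∈ U)
    {ι : Type*} [Fintype ι] [DecidableEq ι] (b : Option ι → E)
    (hb : ∀ i j, g y (b i) (b j) = if i = j then 1 else 0)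
    (hcard : Fintype.card (Option ι) = Module.finrank ℝ E) :
    ∑ i, ∑ j, g y (curvature Γ y (b (some j)) (b (some i)) (b (some i))) (b (some j)) =
      ∑ a, ricciForm Γ y (b a) (b a) - 2 * ricciForm Γ y (b none) (b none) := by
  have h1 : ∀ v w, ricciForm Γ y v w = ∑ c, g y (curvature Γ y (b c) v w) (b c) := fun v w => by
    rw [ricciForm, trace_eq_sum_of_orthonormal (g y) b hb hcard]
    rfl
  simp only [h1, Fintype.sum_option, curvature_self, map_zero, _root_.zero_apply, zero_add]
  rw [Finset.sum_add_distrib]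
  -- The terms pairing the normal with a tangent vector occur twice in the full sum: once in the
  -- Ricci curvature of the normal, once spread over those of the tangent vectors. Either way they
  -- add up to Ric(u,u), whence the factor 2.
  have h2 : ∀ i : ι, g y (curvature Γ y (b none) (b (some i)) (b (some i))) (b none) =
      g y (curvature Γ y (b (some i)) (b none) (b none)) (b (some i)) :=
    fun i => hg.sectional_comm hy _ _
  simp only [h2]
  ring

end ScalarSum

/-! ### The extrinsic term in an orthonormal basis -/

section ShapeTraces

variable {V ι : Type*} [NormedAddCommGroup V] [InnerProductSpace ℝ V]
  [Fintype ι]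

/-- The double sum is arranged so that its summands are the correction terms of the Gauss equation,
one for each pair (i, j). -/
theorem trace_sq_sub_trace_comp_of_isSymmetric {T : V →ₗ[ℝ] V} (hT : T.IsSymmetric)
    (c : OrthonormalBasis ι ℝ V) :
    LinearMap.trace ℝ V T ^ 2 - LinearMap.trace ℝ V (T ∘ₗ T) =
      ∑ i, ∑ j, (inner ℝ (T (c i)) (c i) * inner ℝ (T (c j)) (c j)
        - inner ℝ (T (c j)) (c i) * inner ℝ (T (c i)) (c j)) := by
  have h1 : LinearMap.trace ℝ V T = ∑ i, inner ℝ (T (c i)) (c i) := by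
    rw [LinearMap.trace_eq_sum_inner T c]
    exact Finset.sum_congr rfl fun i _ => real_inner_comm _ _
  have h2 : LinearMap.trace ℝ V (T ∘ₗ T) =
      ∑ i, ∑ j, inner ℝ (T (c j)) (c i) * inner ℝ (T (c i)) (c j) := by
    rw [LinearMap.trace_eq_sum_inner _ c]
    refine Finset.sum_congr rfl fun i _ => ?_
    rw [LinearMap.comp_apply, ← hT, ← c.sum_inner_mul_inner]
    refine Finset.sum_congr rfl fun j _ => ?_
    rw [hT (c j) (c i), real_inner_comm (c j) (T (c i)), real_inner_comm (T (c i)) (c j)]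
  rw [h1, h2, pow_two, Finset.sum_mul_sum]
  simp only [Finset.sum_sub_distrib]

end ShapeTraces

/-! ### The Gauss formula for a parametrized level set -/

section GaussFormula

variable {m : ℕ} {M : Type*} [TopologicalSpace M] [ChartedSpace (Coord m) M]
  [IsManifold (𝓡 m) ∞ M] [RiemannianBundle (fun x : M => TangentSpace (𝓡 m) x)]
  [IsContMDiffRiemannianBundle (𝓡 m) ∞ (EuclideanSpace ℝ (Fin m))
    (fun x : M => TangentSpace (𝓡 m) x)]
  {x : M} {f : M → ℝ} {Ω : Set M}

theorem scalarCurvature_eq_sum {ι : Type*} [Fintype ι] [DecidableEq ι]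
    (b : ι → TangentSpace (𝓡 m) x) (hb : ∀ i j, inner ℝ (b i) (b j) = if i = j then (1 : ℝ) else 0)
    (hcard : Fintype.card ι = m) :
    scalarCurvature m x = ∑ a, ricci m x (b a) (b a) := by
  have hx := mem_chart_source (Coord m) x
  rw [scalarCurvature, scalarCoord_eq_sum_of_orthonormal (isMetricMatrix_chartMetric x)
    ((chartAt (Coord m) x).map_source hx) (fun a => mvfderiv (𝓡 m) (chartAt (Coord m) x) x (b a))
    (fun i j => by rw [metricForm_chartMetric hx, hb]) hcard]
  exact Finset.sum_congr rfl fun a _ => (ricci_eq_ricciForm hx _ _).symm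

omit [IsManifold (𝓡 m) ∞ M] [IsContMDiffRiemannianBundle (𝓡 m) ∞ (EuclideanSpace ℝ (Fin m))
    (fun x : M => TangentSpace (𝓡 m) x)] in
theorem IsRegularOn.norm_unitNormal (h : IsRegularOn m Ω f) (hΩx : x ∈ Ω) :
    ‖unitNormal m f x‖ = 1 := by
  rw [unitNormal, norm_smul, norm_inv, norm_norm,
    inv_mul_cancel₀ (norm_ne_zero_iff.2 (h.grad_ne_zero hΩx))]

omit [IsManifold (𝓡 m) ∞ M]
  [IsContMDiffRiemannianBundle (𝓡 m) ∞ (EuclideanSpace ℝ (Fin m))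
    (fun x : M => TangentSpace (𝓡 m) x)] [RiemannianBundle (fun x : M => TangentSpace (𝓡 m) x)] in
-- The kernel of a nonzero functional is a hyperplane. The additive form also records that a regular
-- point forces `m ≥ 1`, which `m - 1` alone would hide.
theorem IsRegularOn.finrank_levelTangent (h : IsRegularOn m Ω f) (hΩx : x ∈ Ω) :
    Module.finrank ℝ (levelTangent m f x) + 1 = m := by
  have hne : (mvfderiv (𝓡 m) f x).toLinearMap ≠ 0 := by
    intro h0
    apply h.mfderiv_ne_zero x hΩx
    ext v
    exact congrArg (fun L => L v) h0
  have hsurj : Function.Surjective (mvfderiv (𝓡 m) f x).toLinearMap :=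
    LinearMap.surjective hne
  have h1 := (mvfderiv (𝓡 m) f x).toLinearMap.finrank_range_add_finrank_ker
  rw [LinearMap.range_eq_top.2 hsurj, finrank_top, Module.finrank_self] at h1
  have h2 : Module.finrank ℝ (TangentSpace (𝓡 m) x) = m := finrank_euclideanSpace_fin
  rw [h2] at h1
  change Module.finrank ℝ (mvfderiv (𝓡 m) f x).toLinearMap.ker + 1 = m
  omega

/-- The Gauss formula for a parametrized piece of a level set. -/
theorem IsRegularOn.scalarCoord_pullbackMetric {n : ℕ} (h : IsRegularOn m Ω f) (hΩx : x ∈ Ω)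
    (hn : n + 1 = m) {V : Set (Coord n)} {ψ : Coord n → M}
    (hψ : IsLocalParametrization m (f ⁻¹' {f x}) x V ψ) :
    scalarCoord (pullbackMetric m ψ) 0 = scalarCurvature m x
      - 2 * ricci m x (unitNormal m f x) (unitNormal m f x) + extrinsicGauss m f x := by
  obtain ⟨hVo, hV0, rfl, hsm, hinj, -, hlev, -⟩ := hψ
  set x := ψ 0 with hxdef
  set e := chartAt (Coord m) x with he
  have hx : x ∈ e.source := mem_chart_source (Coord m) x
  -- The parametrization is only assumed to map into the level set; near 0 it also stays in `Ω` and
  -- in one chart.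
  set V' : Set (Coord n) := V ∩ ψ ⁻¹' (e.source ∩ Ω) with hV'
  have hV'o : IsOpen V' :=
    hsm.continuousOn.isOpen_inter_preimage hVo (e.open_source.inter h.isOpen)
  have h0 : (0 : Coord n) ∈ V' := ⟨hV0, hx, hΩx⟩
  have hsm' : ContMDiffOn (𝓡 n) (𝓡 m) ∞ ψ V' := hsm.mono inter_subset_left
  have hh := isMetricMatrix_pullbackMetric hV'o hsm' fun y hy => hinj y hy.1
  have hLC := isLeviCivita_chart (m := m) x
  set ξ : Coord n → Coord m := fun s => e (ψ s) with hξ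
  have hi := isIsometricOn_chart_comp (x₀ := x) hV'o hsm' fun s hs => hs.2.1
  set g := metricForm (chartMetric m x) with hgdef
  set Γ := christoffelForm (chartMetric m x) with hΓdef
  set Γ' := christoffelForm (pullbackMetric m ψ) with hΓ'def
  set y := e x with hy
  have hyU : y ∈ e.target := e.map_source hx
  have hξ0 : ξ 0 = y := rfl
  have hreg : ∀ s ∈ V', ξ s ∈ chartRegion m Ω x := fun s hs => mem_chartRegion hs.2.1 hs.2.2
  set û := fieldInChart m (unitNormal m f) x with hû
  have hûy : û y = mvfderiv (𝓡 m) e x (unitNormal m f x) := by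
    rw [hû, fieldInChart, hy, ← he, e.left_inv hx]
  have hmd : ∀ s ∈ V', MDifferentiableAt (𝓡 n) (𝓡 m) ψ s := fun s hs =>
    (hsm'.contMDiffAt (hV'o.mem_nhds hs)).mdifferentiableAt (by simp)
  have hDξ : ∀ s (hs : s ∈ V') (v : Coord n), fderiv ℝ ξ s v =
      mvfderiv (𝓡 m) e (ψ s) (pushforward ψ s v) := fun s hs v => by
    rw [(hasFDerivAt_chart_comp (hmd s hs) hs.2.1).fderiv]; rfl
  -- the differential of the parametrization is tangent to the level sets
  have htan : ∀ s ∈ V', ∀ v, mvfderiv (𝓡 m) f (ψ s) (pushforward ψ s v) = 0 := by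
    intro s hs v
    have h1 : HasFDerivAt (fun s => f (ψ s))
        ((mvfderiv (𝓡 m) f (ψ s)).comp (pushforward ψ s)) s :=
      ((h.mdifferentiableAt hs.2.2).hasMFDerivAt.comp s (hmd s hs).hasMFDerivAt).hasFDerivAt
    have h2 : (fun s => f (ψ s)) =ᶠ[𝓝 s] fun _ => f x := by
      filter_upwards [hVo.mem_nhds hs.1] with r hr using hlev hr
    have h3 := h1.fderiv
    rw [h2.fderiv_eq] at h3
    have h4 := congrArg (fun L => L v) h3
    simp only [fderiv_fun_const] at h4
    exact h4.symm
  have horth : ∀ s ∈ V', ∀ v, g (ξ s) (û (ξ s)) (fderiv ℝ ξ s v) = 0 := by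
    intro s hs v
    rw [hgdef, hû, h.metricForm_unitNormal (hreg s hs), hDξ s hs,
      fderiv_chart_apply hs.2.1 (h.mdifferentiableAt hs.2.2), htan s hs, mul_zero]
  -- an orthonormal basis of the tangent space of the level set
  have hfr : Module.finrank ℝ (levelTangent m f x) = n := by
    have := h.finrank_levelTangent hΩx
    omega
  let c : OrthonormalBasis (Fin n) ℝ (levelTangent m f x) :=
    (stdOrthonormalBasis ℝ (levelTangent m f x)).reindex (finCongr hfr)
  let dψ : Coord n →ₗ[ℝ] levelTangent m f x :=
    (pushforward (m := m) ψ 0).toLinearMap.codRestrict _ fun v => htan 0 h0 v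
  have hdinj : Function.Injective dψ := by
    intro v w hvw
    have h1 : pushforward (m := m) ψ 0 v = pushforward ψ 0 w := congrArg Subtype.val hvw
    exact (NormedSpace.fromTangentSpace (𝕜 := ℝ) (0 : Coord n)).symm.injective (hinj 0 hV0 h1)
  have hdsurj : Function.Surjective dψ :=
    (LinearMap.injective_iff_surjective_of_finrank_eq_finrank
      (by rw [hfr]; exact finrank_euclideanSpace_fin)).1 hdinj
  choose a ha using fun i => hdsurj (c i)
  have ha' : ∀ i, pushforward ψ 0 (a i) = (c i : TangentSpace (𝓡 m) x) := fun i =>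
    congrArg Subtype.val (ha i)
  have hb : ∀ i, fderiv ℝ ξ 0 (a i) = mvfderiv (𝓡 m) e x (c i : TangentSpace (𝓡 m) x) := fun i => by
    rw [hDξ 0 h0, ha' i]
  have hcc : ∀ i j, inner ℝ (c i : TangentSpace (𝓡 m) x) (c j : TangentSpace (𝓡 m) x) =
      if i = j then (1 : ℝ) else 0 := fun i j => by
    rw [← Submodule.coe_inner, orthonormal_iff_ite.1 c.orthonormal i j]
  have haa : ∀ i j, metricForm (pullbackMetric m ψ) 0 (a i) (a j) = if i = j then 1 else 0 :=
    fun i j => by rw [metricForm_pullbackMetric, ha', ha', hcc]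
  -- the second fundamental form
  set N := secondFundamental Γ Γ' ξ 0 with hN
  have hNu : ∀ i j, g y (N (a i) (a j)) (û y) =
      - inner ℝ (shapeOperator m f x (c i)) (c j) := by
    intro i j
    have hξs : ContDiffAt ℝ ∞ ξ 0 := hi.contDiffOn.contDiffAt (hV'o.mem_nhds h0)
    have dξ := hξs.differentiableAt (by simp : (∞ : WithTop ℕ∞) ≠ 0)
    have du : DifferentiableAt ℝ û y :=
      (h.contDiffAt_unitNormal (hreg 0 h0)).differentiableAt (by simp)
    have hcomp : HasFDerivAt (fun s => û (ξ s)) ((fderiv ℝ û y).comp (fderiv ℝ ξ 0)) 0 :=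
      hasFDerivAt_comp_fun (ξ := ξ) (t := 0) du dξ
    have h1 := hLC.fderiv_metric_along (X := fun s => fderiv ℝ ξ s (a j)) (Y := fun s => û (ξ s))
      (t := 0) (ξ := ξ) hyU dξ ((contDiffAt_fderiv_apply hξs _).differentiableAt (by simp))
      hcomp.differentiableAt (a i)
    -- Weingarten's formula: differentiate ⟨dξ(a j), u⟩ = 0 along `a i`. The tangential part of
    -- ∇(dξ(a j)) is orthogonal to u, so ⟨N(a i, a j), u⟩ = -⟨dξ(a j), ∇_{c i} u⟩.
    have hev : (fun s => metricForm (chartMetric m x) (ξ s) (fderiv ℝ ξ s (a j)) (û (ξ s)))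
        =ᶠ[𝓝 0] fun _ => 0 := by
      filter_upwards [hV'o.mem_nhds h0] with s hs
      rw [hLC.metric_symm _ (hi.mapsTo hs)]
      exact horth s hs _
    rw [hev.fderiv_eq] at h1
    have h2 : covAlong Γ ξ (fun s => û (ξ s)) (a i) 0 =
        mvfderiv (𝓡 m) e x (covDeriv m (unitNormal m f) x (c i : TangentSpace (𝓡 m) x)) := by
      rw [h.mvfderiv_covDeriv_unitNormal hx hΩx, covAlong, hcomp.fderiv, nablaEnd_apply, ← hb]
      rfl
    have h3 : covAlong Γ ξ (fun s => fderiv ℝ ξ s (a j)) (a i) 0 =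
        N (a i) (a j) + fderiv ℝ ξ 0 (Γ' 0 (a i) (a j)) := by
      rw [hN, secondFundamental, sub_add_cancel]
    have h4 := horth 0 h0 (Γ' 0 (a i) (a j))
    rw [hLC.metric_symm _ hyU] at h4
    have h5 : inner ℝ (c j : TangentSpace (𝓡 m) x)
        (covDeriv m (unitNormal m f) x (c i : TangentSpace (𝓡 m) x)) =
          inner ℝ (shapeOperator m f x (c i)) (c j) := by
      rw [Submodule.coe_inner, h.coe_shapeOperator hΩx, real_inner_comm]
    rw [h3, h2, hb, metricForm_chartMetric hx, h5, map_add, _root_.add_apply] at h1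
    simp only [fderiv_fun_const, Pi.zero_apply, _root_.zero_apply] at h1
    change 0 = g y (N (a i) (a j)) (û y) + g y (fderiv ℝ ξ 0 (Γ' 0 (a i) (a j))) (û y) + _ at h1
    change g y (fderiv ℝ ξ 0 (Γ' 0 (a i) (a j))) (û y) = 0 at h4
    linarith
  -- The tangent space is the image of dψ plus the line of u. Since N is orthogonal to the image,
  -- its values lie on the normal line and their inner products are products of the u-components.
  have hNN : ∀ v w v' w', g y (N v w) (N v' w') = g y (N v w) (û y) * g y (N v' w') (û y) := by
    intro v w v' w'
    obtain ⟨z, hz⟩ := (chartEquiv hx).surjective (N v' w')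
    rw [chartEquiv_apply] at hz
    have h1 : z - inner ℝ z (unitNormal m f x) • unitNormal m f x ∈ levelTangent m f x := by
      rw [h.mem_levelTangent_iff hΩx, inner_sub_left, real_inner_smul_left,
        real_inner_self_eq_norm_sq, h.norm_unitNormal hΩx]
      ring
    obtain ⟨q, hq⟩ := hdsurj ⟨_, h1⟩
    have hq' : pushforward ψ 0 q = z - inner ℝ z (unitNormal m f x) • unitNormal m f x :=
      congrArg Subtype.val hq
    have h2 : N v' w' = fderiv ℝ ξ 0 q + inner ℝ z (unitNormal m f x) • û y := by
      rw [hDξ 0 h0, hq', ← hz, hûy, map_sub, map_smul, sub_add_cancel]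
    have h3 : g y (N v w) (fderiv ℝ ξ 0 q) = 0 :=
      secondFundamental_normal hLC hh.isLeviCivita hi h0 v w q
    have h4 : g y (N v' w') (û y) = inner ℝ z (unitNormal m f x) := by
      rw [← hz, hûy, hgdef, metricForm_chartMetric hx]
    rw [h4]
    conv_lhs => rw [h2]
    rw [map_add, map_smul, h3, zero_add, smul_eq_mul, mul_comm]
  -- the Gauss equation, traced
  have hG : ∀ i j, metricForm (pullbackMetric m ψ) 0 (curvature Γ' 0 (a j) (a i) (a i)) (a j) =
      g y (curvature Γ y (fderiv ℝ ξ 0 (a j)) (fderiv ℝ ξ 0 (a i)) (fderiv ℝ ξ 0 (a i)))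
        (fderiv ℝ ξ 0 (a j))
      + (inner ℝ (shapeOperator m f x (c i)) (c i) * inner ℝ (shapeOperator m f x (c j)) (c j)
        - inner ℝ (shapeOperator m f x (c j)) (c i)
          * inner ℝ (shapeOperator m f x (c i)) (c j)) := by
    intro i j
    have h1 := gauss_equation hLC hh.isLeviCivita hi h0 (a j) (a i) (a i) (a j)
    change g y (curvature Γ y (fderiv ℝ ξ 0 (a j)) (fderiv ℝ ξ 0 (a i)) (fderiv ℝ ξ 0 (a i)))
        (fderiv ℝ ξ 0 (a j)) = metricForm (pullbackMetric m ψ) 0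
          (curvature Γ' 0 (a j) (a i) (a i)) (a j) - g y (N (a i) (a i)) (N (a j) (a j))
            + g y (N (a j) (a i)) (N (a i) (a j)) at h1
    rw [hNN, hNN, hNu, hNu, hNu, hNu] at h1
    linarith
  -- The unit normal, at `none`, completes the tangent basis to an orthonormal basis of the ambient
  -- tangent space.
  let B : Option (Fin n) → TangentSpace (𝓡 m) x :=
    fun o => o.elim (unitNormal m f x) fun i => (c i : TangentSpace (𝓡 m) x)
  have hB : ∀ i j, inner ℝ (B i) (B j) = if i = j then (1 : ℝ) else 0 := by
    rintro (_ | i) (_ | j)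
    · simp [B, h.norm_unitNormal hΩx]
    · have := (h.mem_levelTangent_iff hΩx).1 (c j).2
      rw [real_inner_comm] at this
      simpa [B] using this
    · have := (h.mem_levelTangent_iff hΩx).1 (c i).2
      simpa [B] using this
    · simp [B, hcc]
  have hcard : Fintype.card (Option (Fin n)) = m := by simp [hn]
  have hS := hLC.sum_ricciForm_option hyU (fun o => mvfderiv (𝓡 m) e x (B o))
    (fun i j => by rw [metricForm_chartMetric hx, hB]) (by rw [hcard]; simp)
  rw [scalarCurvature_eq_sum B hB hcard, h.extrinsicGauss_eq_trace hΩx,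
    trace_sq_sub_trace_comp_of_isSymmetric (h.isSymmetric_shapeOperator hΩx) c,
    scalarCoord_eq_sum_of_orthonormal hh h0 a haa (by simp)]
  have hR : ∀ v, ricciForm Γ' 0 v v =
      ∑ j, metricForm (pullbackMetric m ψ) 0 (curvature Γ' 0 (a j) v v) (a j) := fun v => by
    rw [ricciForm, trace_eq_sum_of_orthonormal _ a haa (by simp)]
    rfl
  rw [Finset.sum_congr rfl fun i _ => hR (a i)]
  simp only [hG, Finset.sum_add_distrib]
  congr 1
  rw [ricci_eq_ricciForm hx, Finset.sum_congr rfl fun a _ => ricci_eq_ricciForm hx (B a) (B a)]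
  simp only [hb]
  exact hS

end GaussFormula

/-! ### Coordinates adapted to a regular point -/

section ImplicitFunction

variable {E : Type*} [NormedAddCommGroup E] [NormedSpace ℝ E] [FiniteDimensional ℝ E]

/-- Near a regular point of `F` there are smooth coordinates `(F, p)` with `p` affine. -/
theorem exists_adapted_coordinates {n : ℕ} (hn : Module.finrank ℝ E = n + 1) {W : Set E}
    (hW : IsOpen W) {F : E → ℝ} (hF : ContDiffOn ℝ ∞ F W) {a : E} (ha : a ∈ W)
    (hd : fderiv ℝ F a ≠ 0) :
    ∃ (p : E →L[ℝ] Coord n) (R : OpenPartialHomeomorph E (ℝ × Coord n)), a ∈ R.source ∧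
      R.source ⊆ W ∧ (∀ y ∈ R.source, R y = (F y, p (y - a))) ∧
      ContDiffOn ℝ ∞ R.symm R.target := by
  have : CompleteSpace E := FiniteDimensional.complete ℝ E
  obtain ⟨v, hv⟩ : ∃ v, fderiv ℝ F a v = 1 := by
    obtain ⟨w, hw⟩ : ∃ w, fderiv ℝ F a w ≠ 0 := by
      by_contra hcon
      push Not at hcon
      exact hd (ContinuousLinearMap.ext hcon)
    exact ⟨(fderiv ℝ F a w)⁻¹ • w, by simp [hw]⟩
  set L := fderiv ℝ F a with hL
  have hker : Module.finrank ℝ L.toLinearMap.ker = Module.finrank ℝ (Coord n) := by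
    have h1 := L.toLinearMap.finrank_range_add_finrank_ker
    have h2 : Function.Surjective L.toLinearMap := fun r => ⟨r • v, by simp [hv]⟩
    rw [LinearMap.range_eq_top.2 h2, finrank_top, Module.finrank_self, hn] at h1
    rw [finrank_euclideanSpace_fin]
    omega
  let κ := ContinuousLinearEquiv.ofFinrankEq hker
  -- The projection onto ker dF(a) along a vector `v` with dF(a)v = 1; `p` is this projection in
  -- coordinates and its kernel is the line of `v`.
  let ρ : E →L[ℝ] L.toLinearMap.ker :=
    (ContinuousLinearMap.id ℝ E - L.smulRight v).codRestrict _ fun w => by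
      simp [hv]
  let p : E →L[ℝ] Coord n := (κ : _ →L[ℝ] Coord n).comp ρ
  have hp : ∀ w, p w = 0 → w = L w • v := by
    intro w hw
    have h1 : ρ w = 0 := κ.map_eq_zero_iff.1 hw
    have h2 : w - L w • v = 0 := congrArg Subtype.val h1
    exact sub_eq_zero.1 h2
  -- Where ∂_v F ≠ 0 the map (dF, p) is injective, hence invertible. Restricting to `N` makes the
  -- inverse smooth on the whole target, not only at the image of `a`.
  let N : Set E := W ∩ (fun y => fderiv ℝ F y v) ⁻¹' {0}ᶜ
  have hN : IsOpen N := by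
    refine ContinuousOn.isOpen_inter_preimage (fun y hy => ?_) hW isOpen_compl_singleton
    exact (contDiffAt_fderiv_apply (hF.contDiffAt (hW.mem_nhds hy)) v).continuousAt.continuousWithinAt
  have haN : a ∈ N := ⟨ha, by simp [← hL, hv]⟩
  let Φ : E → ℝ × Coord n := fun y => (F y, p (y - a))
  have hΦ : ∀ y ∈ W, ContDiffAt ℝ ∞ Φ y := fun y hy =>
    (hF.contDiffAt (hW.mem_nhds hy)).prodMk (p.contDiff.contDiffAt.comp y
      (contDiffAt_id.sub contDiffAt_const))
  have hdΦ : ∀ y ∈ W, HasFDerivAt Φ ((fderiv ℝ F y).prod p) y := fun y hy =>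
    ((hF.contDiffAt (hW.mem_nhds hy)).differentiableAt (by simp)).hasFDerivAt.prodMk
      (p.hasFDerivAt.comp y ((hasFDerivAt_id y).sub_const a))
  have hequiv : ∀ y ∈ N, ∃ T : E ≃L[ℝ] ℝ × Coord n,
      (T : E →L[ℝ] ℝ × Coord n) = (fderiv ℝ F y).prod p := by
    intro y hy
    have hinj : Function.Injective ((fderiv ℝ F y).prod p) := by
      rw [injective_iff_map_eq_zero]
      intro w hw
      have h1 : fderiv ℝ F y w = 0 := congrArg Prod.fst hw
      have h2 := hp w (congrArg Prod.snd hw)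
      rw [h2, map_smul, smul_eq_mul] at h1
      rcases mul_eq_zero.1 h1 with h3 | h3
      · rw [h2, h3, zero_smul]
      · exact absurd h3 hy.2
    have hfr : Module.finrank ℝ E = Module.finrank ℝ (ℝ × Coord n) := by
      rw [Module.finrank_prod, Module.finrank_self, finrank_euclideanSpace_fin, hn, add_comm]
    refine ⟨(LinearEquiv.ofInjectiveOfFinrankEq
      ((fderiv ℝ F y).prod p).toLinearMap hinj hfr).toContinuousLinearEquiv, ?_⟩
    ext w <;> rfl
  obtain ⟨T, hT⟩ := hequiv a haN
  let R₀ := (hΦ a ha).toOpenPartialHomeomorph Φ (by rw [hT]; exact hdΦ a ha) (by simp)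
  have hR₀ : ∀ y, R₀ y = Φ y := fun y => rfl
  have haR₀ : a ∈ R₀.source := (hΦ a ha).mem_toOpenPartialHomeomorph_source _ _
  refine ⟨p, R₀.restrOpen N hN, ⟨haR₀, haN⟩, fun y hy => hy.2.1, fun y _ => rfl, fun q hq => ?_⟩
  have hq2 := (R₀.restrOpen N hN).map_target hq
  obtain ⟨T', hT'⟩ := hequiv _ hq2.2
  refine ContDiffAt.contDiffWithinAt ?_
  refine OpenPartialHomeomorph.contDiffAt_symm (f₀' := T') _ hq ?_ ?_
  · rw [hT']
    exact hdΦ _ hq2.2.1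
  · exact hΦ _ hq2.2.1

end ImplicitFunction

/-! ### Level sets are submanifolds -/

section LevelSet

variable {m : ℕ} {M : Type*} [TopologicalSpace M] [ChartedSpace (Coord m) M]
  [IsManifold (𝓡 m) ∞ M] {x : M} {f : M → ℝ} {Ω : Set M}

/-- In the coordinates (F, p) the level set is the slice where the first coordinate is f(x);
freezing that coordinate in the inverse map gives the parametrization. -/
theorem IsRegularOn.exists_isLocalParametrization {n : ℕ} (h : IsRegularOn m Ω f) (hΩx : x ∈ Ω)
    (hn : m = n + 1) : ∃ (ψ : Coord n → M) (V : Set (Coord n)),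
      IsLocalParametrization m (f ⁻¹' {f x}) x V ψ := by
  set e := chartAt (Coord m) x with he
  have hx : x ∈ e.source := mem_chart_source (Coord m) x
  set F : Coord m → ℝ := fun s => f (e.symm s) with hFdef
  have hW := isOpen_chartRegion (m := m) h.isOpen x
  have hF : ContDiffOn ℝ ∞ F (chartRegion m Ω x) := fun y hy =>
    (contDiffAt_chart h.isOpen h.contMDiffOn hy).contDiffWithinAt
  have hd : fderiv ℝ F (e x) ≠ 0 := by
    intro h0
    apply h.mfderiv_ne_zero x hΩx
    ext v
    have := fderiv_chart_apply hx (h.mdifferentiableAt hΩx) v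
    rw [← he, ← hFdef, h0] at this
    exact this.symm
  obtain ⟨p, R, haR, hRW, hR, hRs⟩ := exists_adapted_coordinates (n := n)
    (by rw [finrank_euclideanSpace_fin, hn]) hW hF (mem_chartRegion hx hΩx) hd
  rw [← he] at haR hR
  have hRx : R (e x) = (f x, 0) := by
    rw [hR _ haR, hFdef]
    simp only [e.left_inv hx, sub_self, map_zero]
  let V : Set (Coord n) := (fun t => (f x, t)) ⁻¹' R.target
  let σ : Coord n → Coord m := fun t => R.symm (f x, t)
  have hσR : ∀ t ∈ V, σ t ∈ R.source := fun t ht => R.map_target ht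
  have hσe : ∀ t ∈ V, σ t ∈ e.target := fun t ht => (hRW (hσR t ht)).1
  have hRσ : ∀ t ∈ V, (F (σ t), p (σ t - e x)) = (f x, t) := fun t ht => by
    rw [← hR _ (hσR t ht), R.right_inv ht]
  have hVo : IsOpen V := R.open_target.preimage (by fun_prop)
  have hσ : ContDiffOn ℝ ∞ σ V :=
    hRs.comp (by fun_prop : ContDiff ℝ ∞ fun t : Coord n => (f x, t)).contDiffOn fun t ht => ht
  have hψ : ContMDiffOn (𝓡 n) (𝓡 m) ∞ (fun t => e.symm (σ t)) V :=
    (contMDiffOn_chartSymm x).comp hσ.contMDiffOn hσe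
  refine ⟨fun t => e.symm (σ t), V, hVo, ?_, ?_, hψ, ?_, ?_, ?_, ?_⟩
  · change (f x, (0 : Coord n)) ∈ R.target
    rw [← hRx]
    exact R.map_source haR
  · change e.symm (R.symm (f x, 0)) = x
    rw [← hRx, R.left_inv haR, e.left_inv hx]
  · intro t ht
    rw [injective_iff_map_eq_zero]
    intro v hv
    have hmd := (hψ.contMDiffAt (hVo.mem_nhds ht)).mdifferentiableAt (by simp)
    have h1 := hasFDerivAt_chart_comp (x₀ := x) hmd (e.map_target (hσe t ht))
    -- The affine coordinate `p` is a smooth left inverse of the parametrization, so its chain rule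
    -- shows that the differential is injective.
    have h2 : HasFDerivAt (fun s => p (e (e.symm (σ s)) - e x)) (p.comp _) t :=
      p.hasFDerivAt.comp t (h1.sub_const (e x))
    have h3 : (fun s => p (e (e.symm (σ s)) - e x)) =ᶠ[𝓝 t] id := by
      filter_upwards [hVo.mem_nhds ht] with s hs
      rw [e.right_inv (hσe s hs)]
      exact congrArg Prod.snd (hRσ s hs)
    have h4 := h2.unique ((hasFDerivAt_id t).congr_of_eventuallyEq h3)
    have h5 := congrArg (fun L => L v) h4
    have h6 : pushforward (m := m) (fun t => e.symm (σ t)) t v = 0 := hv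
    have h7 : p (mvfderiv (𝓡 m) e (e.symm (σ t))
      (pushforward (m := m) (fun t => e.symm (σ t)) t v)) = v := h5
    rw [h6, map_zero, map_zero] at h7
    exact h7.symm
  · intro s hs t ht hst
    have h1 : σ s = σ t := by
      rw [← e.right_inv (hσe s hs), ← e.right_inv (hσe t ht)]
      exact congrArg e hst
    have h2 := congrArg Prod.snd (hRσ s hs)
    rw [h1, hRσ t ht] at h2
    exact h2.symm
  · intro t ht
    exact congrArg Prod.fst (hRσ t ht)
  · rw [mem_nhdsWithin]
    -- A point of the level set in the adapted chart is recovered from its p-coordinate, so the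
    -- image covers a neighbourhood of x in the level set.
    refine ⟨e.source ∩ e ⁻¹' R.source, e.isOpen_inter_preimage R.open_source, ⟨hx, haR⟩, ?_⟩
    rintro z ⟨⟨hz, hzR⟩, hzf⟩
    have h1 : R (e z) = (f x, p (e z - e x)) := by
      rw [hR _ hzR, hFdef]
      simp only [e.left_inv hz]
      rw [show f z = f x from hzf]
    refine ⟨p (e z - e x), ?_, ?_⟩
    · change (f x, _) ∈ R.target
      rw [← h1]
      exact R.map_source hzR
    · change e.symm (R.symm (f x, _)) = z
      rw [← h1, R.left_inv hzR, e.left_inv hz]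

variable [RiemannianBundle (fun x : M => TangentSpace (𝓡 m) x)]
  [IsContMDiffRiemannianBundle (𝓡 m) ∞ (EuclideanSpace ℝ (Fin m))
    (fun x : M => TangentSpace (𝓡 m) x)]

/-- The Gauss formula for level sets. -/
theorem IsRegularOn.levelScalarCurvature_eq (h : IsRegularOn m Ω f) (hΩx : x ∈ Ω) :
    levelScalarCurvature m f x = scalarCurvature m x
      - 2 * ricci m x (unitNormal m f x) (unitNormal m f x) + extrinsicGauss m f x := by
  -- The subtraction is truncated; a regular point excludes `m = 0`.
  have hm : m - 1 + 1 = m := by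
    have := h.finrank_levelTangent hΩx
    omega
  have hex : ∃ (ψ : Coord (m - 1) → M) (V : Set (Coord (m - 1))),
      IsLocalParametrization m (f ⁻¹' {f x}) x V ψ :=
    h.exists_isLocalParametrization hΩx hm.symm
  rw [levelScalarCurvature, submanifoldScalarCurvature, dif_pos hex]
  -- The Gauss formula holds for every parametrization, so the one selected by choice does not
  -- matter.
  obtain ⟨V, hV⟩ := hex.choose_spec
  exact h.scalarCoord_pullbackMetric hΩx hm hV

end LevelSet

/-! ### Gluing compatible measures -/

section GluingMeasures

variable {α ι : Type*} [MeasurableSpace α]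

/-- The supremum of a family of measures, each carried by a set of a countably generated cover,
that agree on the overlaps, restricts to each of them. -/
theorem iSup_measure_apply_of_agree {μ : ι → Measure α} {U : ι → Set α}
    (hU : ∀ i, MeasurableSet (U i)) (hμ : ∀ i, μ i (U i)ᶜ = 0)
    (hagree : ∀ i j s, MeasurableSet s → s ⊆ U i → s ⊆ U j → μ i s = μ j s)
    {c : ℕ → ι} (hc : ⋃ n, U (c n) = univ) {i : ι} {s : Set α} (hs : MeasurableSet s)
    (hsi : s ⊆ U i) : (⨆ j, μ j) s = μ i s := by
  -- A countable measurable partition subordinate to the cover. It yields an explicit glued measure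
  -- `ν`, whereas the supremum of measures is not computed setwise.
  set P := disjointed (U ∘ c) with hP
  have hPm : ∀ n, MeasurableSet (P n) := fun n => MeasurableSet.disjointed (fun n => hU (c n)) n
  have hPd : Pairwise (Function.onFun Disjoint P) := disjoint_disjointed _
  have hPU : ∀ n, P n ⊆ U (c n) := fun n => disjointed_subset _ n
  have hPc : ⋃ n, P n = univ := by rw [hP, iUnion_disjointed]; exact hc
  have hsum : ∀ (ν : Measure α) (t : Set α), MeasurableSet t → ν t = ∑' n, ν (t ∩ P n) := by
    intro ν t ht
    rw [← measure_iUnion (fun a b hab => (hPd hab).mono inter_subset_right inter_subset_right)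
      fun n => ht.inter (hPm n), ← inter_iUnion, hPc, inter_univ]
  set ν : Measure α := Measure.sum fun n => (μ (c n)).restrict (P n) with hν
  have hνapp : ∀ t, MeasurableSet t → ν t = ∑' n, μ (c n) (t ∩ P n) := by
    intro t ht
    rw [hν, Measure.sum_apply _ ht]
    exact tsum_congr fun n => Measure.restrict_apply ht
  have hsub : ∀ j t, MeasurableSet t → t ⊆ U j → ν t = μ j t := by
    intro j t ht htj
    rw [hνapp t ht, hsum (μ j) t ht]
    exact tsum_congr fun n => hagree _ _ _ (ht.inter (hPm n)) (inter_subset_right.trans (hPU n))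
      (inter_subset_left.trans htj)
  refine le_antisymm ?_ (Measure.le_iff'.1 (le_iSup μ i) s)
  -- Each `μ j` is carried by `U j`, where it equals `ν`; so `ν` is an upper bound of the family,
  -- attained by `μ i` on subsets of `U i`.
  have hle : (⨆ j, μ j) ≤ ν := by
    refine iSup_le fun j => Measure.le_iff.2 fun t ht => ?_
    calc μ j t ≤ μ j (t ∩ U j) + μ j (U j)ᶜ :=
          (measure_mono fun z hz => by
            by_cases h : z ∈ U j
            · exact Or.inl ⟨hz, h⟩
            · exact Or.inr h).trans (measure_union_le _ _)
      _ = ν (t ∩ U j) := by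
          rw [hμ, add_zero, hsub j _ (ht.inter (hU j)) inter_subset_right]
      _ ≤ ν t := measure_mono inter_subset_left
  exact (Measure.le_iff'.1 hle s).trans (hsub i s hs hsi).le

end GluingMeasures

/-! ### The Riemannian volume in a chart -/

section Volume

variable {m : ℕ} {M : Type*} [TopologicalSpace M] [ChartedSpace (Coord m) M]
  [RiemannianBundle (fun x : M => TangentSpace (𝓡 m) x)]
  [MeasurableSpace M]

/-- The Riemannian density in the chart around `x₀`. -/
def chartDensity (m : ℕ) [ChartedSpace (Coord m) M]
    [RiemannianBundle (fun x : M => TangentSpace (𝓡 m) x)] (x₀ : M) (y : Coord m) : ℝ :=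
  Real.sqrt (chartMetric m x₀ y).det

/-- The Riemannian measure of the domain of the chart around `x₀`. -/
def chartMeasure (m : ℕ) [ChartedSpace (Coord m) M]
    [RiemannianBundle (fun x : M => TangentSpace (𝓡 m) x)] (x₀ : M) : Measure M :=
  (((volume : Measure (Coord m)).restrict (chartAt (Coord m) x₀).target).withDensity
    (fun y => ENNReal.ofReal (chartDensity m x₀ y))).map (chartAt (Coord m) x₀).symm

theorem riemannianVolume_eq_iSup : riemannianVolume m M = ⨆ x : M, chartMeasure m x := rfl

variable [BorelSpace M]

omit [RiemannianBundle (fun x : M => TangentSpace (𝓡 m) x)] in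
theorem aemeasurable_chartSymm (x₀ : M) (ρ : Coord m → ENNReal) :
    AEMeasurable (chartAt (Coord m) x₀).symm
      (((volume : Measure (Coord m)).restrict (chartAt (Coord m) x₀).target).withDensity ρ) :=
  ((chartAt (Coord m) x₀).continuousOn_symm.aemeasurable
    (chartAt (Coord m) x₀).open_target.measurableSet).mono_ac (withDensity_absolutelyContinuous _ _)

theorem chartMeasure_apply (x₀ : M) {s : Set M} (hs : MeasurableSet s) :
    chartMeasure m x₀ s = ∫⁻ y in (chartAt (Coord m) x₀).symm ⁻¹' s ∩ (chartAt (Coord m) x₀).target,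
      ENNReal.ofReal (chartDensity m x₀ y) := by
  rw [chartMeasure, Measure.map_apply_of_aemeasurable (aemeasurable_chartSymm x₀ _) hs,
    withDensity_apply', Measure.restrict_restrict' (chartAt (Coord m) x₀).open_target.measurableSet]

theorem chartMeasure_compl_source (x₀ : M) :
    chartMeasure m x₀ (chartAt (Coord m) x₀).sourceᶜ = 0 := by
  rw [chartMeasure_apply x₀ (chartAt (Coord m) x₀).open_source.measurableSet.compl]
  have : (chartAt (Coord m) x₀).symm ⁻¹' (chartAt (Coord m) x₀).sourceᶜ ∩
      (chartAt (Coord m) x₀).target = ∅ := by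
    ext y
    simp only [mem_inter_iff, mem_preimage, mem_compl_iff, mem_empty_iff_false, iff_false,
      not_and]
    exact fun h hy => h ((chartAt (Coord m) x₀).map_target hy)
  rw [this]
  simp

variable [IsManifold (𝓡 m) ∞ M]

omit [MeasurableSpace M] [BorelSpace M] in
-- The metric matrices are related by g₁ = Jᵀ g₀ J with J the Jacobian matrix; take determinants and
-- square roots.
theorem chartDensity_transition {x₀ x₁ x : M} (h₀ : x ∈ (chartAt (Coord m) x₀).source)
    (h₁ : x ∈ (chartAt (Coord m) x₁).source) :
    chartDensity m x₁ (chartAt (Coord m) x₁ x) =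
      |(transitionEquiv h₀ h₁ : Coord m →L[ℝ] Coord m).det| *
        chartDensity m x₀ (chartAt (Coord m) x₀ x) := by
  set L := (transitionEquiv h₀ h₁ : Coord m →L[ℝ] Coord m) with hL
  let b := (EuclideanSpace.basisFun (Fin m) ℝ).toBasis
  set J := LinearMap.toMatrix b b L.toLinearMap with hJ
  have hJij : ∀ i j, J i j = L (stdVec j) i := fun i j => by
    simp [hJ, LinearMap.toMatrix_apply, b]
  have h := (isIsometricOn_transition (m := m) x₀ x₁).metric_eq _ (mem_overlap h₀ h₁)
  have hξ : (chartAt (Coord m) x₀) ((chartAt (Coord m) x₁).symm (chartAt (Coord m) x₁ x)) =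
      chartAt (Coord m) x₀ x := by rw [(chartAt (Coord m) x₁).left_inv h₁]
  have hmat : chartMetric m x₁ (chartAt (Coord m) x₁ x) =
      J.transpose * (chartMetric m x₀ (chartAt (Coord m) x₀ x) * J) := by
    ext i j
    have hij := h (stdVec i) (stdVec j)
    rw [metricForm_stdVec, (hasFDerivAt_transition h₀ h₁).fderiv, hξ, metricForm_apply] at hij
    rw [hij]
    simp only [Matrix.mul_apply, Matrix.transpose_apply, hJij, Finset.mul_sum]
    exact Finset.sum_congr rfl fun k _ => Finset.sum_congr rfl fun l _ => by ring
  have hdet : L.det = J.det := by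
    rw [hJ, LinearMap.det_toMatrix]
  rw [chartDensity, chartDensity, hmat, Matrix.det_mul, Matrix.det_mul, Matrix.det_transpose, hdet,
    show ∀ a b : ℝ, a * (b * a) = a ^ 2 * b from fun a b => by ring,
    Real.sqrt_mul (sq_nonneg _), Real.sqrt_sq_eq_abs]

/-- The Jacobian factor of the density is the one in the change of variables formula for the
transition map. -/
theorem chartMeasure_agree (x₀ x₁ : M) {s : Set M} (hs : MeasurableSet s)
    (h₀ : s ⊆ (chartAt (Coord m) x₀).source) (h₁ : s ⊆ (chartAt (Coord m) x₁).source) :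
    chartMeasure m x₀ s = chartMeasure m x₁ s := by
  set A : Set (Coord m) := (chartAt (Coord m) x₁).symm ⁻¹' s ∩ (chartAt (Coord m) x₁).target with hA
  have hAm : MeasurableSet A := by
    -- The inverse chart is continuous only on its target, so measurability is obtained on the
    -- subtype and carried over by the inclusion.
    have h := (chartAt (Coord m) x₁).continuousOn_symm
    have h3 : Measurable ((chartAt (Coord m) x₁).target.domRestrict (chartAt (Coord m) x₁).symm) :=
      (continuousOn_iff_continuous_domRestrict.1 h).measurable
    have h4 := ((MeasurableEmbedding.subtype_coe
      (chartAt (Coord m) x₁).open_target.measurableSet).measurableSet_image).2 (h3 hs)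
    convert h4 using 1
    ext y
    simp [hA, and_comm]
  have himg : (chartAt (Coord m) x₀).symm ⁻¹' s ∩ (chartAt (Coord m) x₀).target =
      (fun y => chartAt (Coord m) x₀ ((chartAt (Coord m) x₁).symm y)) '' A := by
    ext y
    constructor
    · rintro ⟨hy, hyt⟩
      refine ⟨chartAt (Coord m) x₁ ((chartAt (Coord m) x₀).symm y), ⟨?_, ?_⟩, ?_⟩
      · rwa [mem_preimage, (chartAt (Coord m) x₁).left_inv (h₁ hy)]
      · exact (chartAt (Coord m) x₁).map_source (h₁ hy)
      · simp only
        rw [(chartAt (Coord m) x₁).left_inv (h₁ hy), (chartAt (Coord m) x₀).right_inv hyt]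
    · rintro ⟨z, ⟨hz, hzt⟩, rfl⟩
      refine ⟨?_, (chartAt (Coord m) x₀).map_source (h₀ hz)⟩
      rwa [mem_preimage, (chartAt (Coord m) x₀).left_inv (h₀ hz)]
  have hd : ∀ y ∈ A, HasFDerivAt (fun y => chartAt (Coord m) x₀ ((chartAt (Coord m) x₁).symm y))
      (fderiv ℝ (fun y => chartAt (Coord m) x₀ ((chartAt (Coord m) x₁).symm y)) y) y := by
    intro y hy
    have := hasFDerivAt_transition (h₀ hy.1) (h₁ hy.1)
    rw [(chartAt (Coord m) x₁).right_inv hy.2] at this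
    exact this.differentiableAt.hasFDerivAt
  have hinj : InjOn (fun y => chartAt (Coord m) x₀ ((chartAt (Coord m) x₁).symm y)) A := by
    intro y hy z hz hyz
    have h2 := (chartAt (Coord m) x₀).injOn (h₀ hy.1) (h₀ hz.1) hyz
    rw [← (chartAt (Coord m) x₁).right_inv hy.2, h2, (chartAt (Coord m) x₁).right_inv hz.2]
  rw [chartMeasure_apply x₀ hs, chartMeasure_apply x₁ hs, himg,
    lintegral_image_eq_lintegral_abs_det_fderiv_mul volume hAm
      (fun y hy => (hd y hy).hasFDerivWithinAt) hinj]
  refine setLIntegral_congr_fun hAm fun y hy => ?_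
  have ht := hasFDerivAt_transition (h₀ hy.1) (h₁ hy.1)
  have hden := chartDensity_transition (h₀ hy.1) (h₁ hy.1)
  rw [(chartAt (Coord m) x₁).right_inv hy.2] at ht hden
  rw [hden, ht.fderiv, ENNReal.ofReal_mul (abs_nonneg _)]

variable [SecondCountableTopology M]

theorem riemannianVolume_apply (x₀ : M) {s : Set M} (hs : MeasurableSet s)
    (h₀ : s ⊆ (chartAt (Coord m) x₀).source) :
    riemannianVolume m M s = chartMeasure m x₀ s := by
  obtain ⟨C, hC, hcov⟩ := TopologicalSpace.countable_cover_nhds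
    (f := fun x : M => (chartAt (Coord m) x).source)
    fun x => (chartAt (Coord m) x).open_source.mem_nhds (mem_chart_source _ x)
  -- The gluing lemma wants a cover indexed by ℕ; the existence of `x₀` makes the countable cover
  -- nonempty and so enumerable.
  have hne : C.Nonempty := by
    by_contra hempty
    rw [Set.not_nonempty_iff_eq_empty.1 hempty] at hcov
    have := hcov.symm ▸ mem_univ x₀
    simp at this
  obtain ⟨c, rfl⟩ := hC.exists_eq_range hne
  rw [riemannianVolume_eq_iSup]
  refine iSup_measure_apply_of_agree (U := fun x => (chartAt (Coord m) x).source) (c := c)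
    (fun x => (chartAt (Coord m) x).open_source.measurableSet) chartMeasure_compl_source
    (fun x y t ht hx hy => chartMeasure_agree x y ht hx hy) (by simpa using hcov) hs h₀

theorem restrict_riemannianVolume (x₀ : M) :
    (riemannianVolume m M).restrict (chartAt (Coord m) x₀).source = chartMeasure m x₀ := by
  have hS := (chartAt (Coord m) x₀).open_source.measurableSet
  refine Measure.ext fun s hs => ?_
  rw [Measure.restrict_apply hs, riemannianVolume_apply x₀ (hs.inter hS) inter_subset_right]
  refine le_antisymm (measure_mono inter_subset_left) ?_
  refine (measure_mono (t := (s ∩ (chartAt (Coord m) x₀).source) ∪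
    (chartAt (Coord m) x₀).sourceᶜ) fun z hz => ?_).trans ((measure_union_le _ _).trans ?_)
  · by_cases h : z ∈ (chartAt (Coord m) x₀).source
    · exact Or.inl ⟨hz, h⟩
    · exact Or.inr h
  · rw [chartMeasure_compl_source, add_zero]

variable [IsContMDiffRiemannianBundle (𝓡 m) ∞ (EuclideanSpace ℝ (Fin m))
    (fun x : M => TangentSpace (𝓡 m) x)]

omit [MeasurableSpace M] [BorelSpace M] [SecondCountableTopology M] in
theorem contDiffAt_chartDensity {x₀ : M} {y : Coord m} (hy : y ∈ (chartAt (Coord m) x₀).target) :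
    ContDiffAt ℝ ∞ (chartDensity m x₀) y := by
  have hg := isMetricMatrix_chartMetric (m := m) x₀
  exact (contDiffAt_det fun i j => hg.contDiffAt hy i j).sqrt (hg.posDef y hy).det_pos.ne'

omit [MeasurableSpace M] [BorelSpace M] [SecondCountableTopology M] in
theorem continuousOn_chartDensity (x₀ : M) :
    ContinuousOn (chartDensity m x₀) (chartAt (Coord m) x₀).target := fun _ hy =>
  (contDiffAt_chartDensity hy).continuousAt.continuousWithinAt

/-- The density is continuous, hence integrable over a compact neighbourhood in the chart.
Integrability of all integrands rests on this. -/
theorem isLocallyFiniteMeasure_riemannianVolume :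
    IsLocallyFiniteMeasure (riemannianVolume m M) where
  finiteAtNhds x := by
    set e := chartAt (Coord m) x with he
    have hx : x ∈ e.source := mem_chart_source (Coord m) x
    obtain ⟨K, hK, hxK, hKT⟩ := exists_compact_subset e.open_target (e.map_source hx)
    set O := e.source ∩ e ⁻¹' interior K with hO
    have hOo : IsOpen O := e.isOpen_inter_preimage isOpen_interior
    refine ⟨O, hOo.mem_nhds ⟨hx, hxK⟩, ?_⟩
    rw [riemannianVolume_apply x hOo.measurableSet inter_subset_left,
      chartMeasure_apply x hOo.measurableSet]
    have hsub : e.symm ⁻¹' O ∩ e.target ⊆ K := by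
      rintro y ⟨hy, hyt⟩
      have := hy.2
      rw [mem_preimage, e.right_inv hyt] at this
      exact interior_subset this
    refine (lintegral_mono_set hsub).trans_lt ?_
    have hint : IntegrableOn (chartDensity m x) K :=
      ((continuousOn_chartDensity x).mono hKT).integrableOn_compact hK
    exact hint.lintegral_lt_top

theorem integral_riemannianVolume_of_support {x₀ : M} {F : M → ℝ} (hF : Continuous F)
    (hsupp : Function.support F ⊆ (chartAt (Coord m) x₀).source) :
    ∫ x, F x ∂(riemannianVolume m M) = ∫ y in (chartAt (Coord m) x₀).target,
      chartDensity m x₀ y * F ((chartAt (Coord m) x₀).symm y) := by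
  rw [← setIntegral_eq_integral_of_forall_compl_eq_zero (s := (chartAt (Coord m) x₀).source)
    fun x hx => by
      by_contra hne
      exact hx (hsupp hne), restrict_riemannianVolume, chartMeasure,
    integral_map (aemeasurable_chartSymm x₀ _) hF.measurable.aestronglyMeasurable]
  have hm : AEMeasurable (fun y => Real.toNNReal (chartDensity m x₀ y))
      ((volume : Measure (Coord m)).restrict (chartAt (Coord m) x₀).target) :=
    ((continuousOn_chartDensity x₀).aemeasurable
      (chartAt (Coord m) x₀).open_target.measurableSet).real_toNNReal
  have h := integral_withDensity_eq_integral_smul₀ hm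
    fun y => F ((chartAt (Coord m) x₀).symm y)
  refine h.trans (integral_congr_ae (Filter.Eventually.of_forall fun y => ?_))
  simp only [NNReal.smul_def, smul_eq_mul]
  rw [Real.coe_toNNReal _ (show 0 ≤ chartDensity m x₀ y from Real.sqrt_nonneg _)]

end Volume

/-! ### The divergence theorem in coordinates -/

section Density

variable {n : ℕ} {U : Set (Coord n)} {g : Coord n → Matrix (Fin n) (Fin n) ℝ}

/-- Laplace expansion along the replaced row, which the cofactors of that row do not involve. These
are the summands of the derivative of the determinant. -/
theorem det_updateRow_eq_sum_adjugate (A : Matrix (Fin n) (Fin n) ℝ) (k : Fin n) (b : Fin n → ℝ) :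
    (A.updateRow k b).det = ∑ j, b j * A.adjugate j k := by
  rw [Matrix.det_eq_sum_mul_adjugate_row _ k]
  refine Finset.sum_congr rfl fun j _ => ?_
  rw [Matrix.adjugate_apply, Matrix.adjugate_apply, Matrix.updateRow_self,
    Matrix.updateRow_idem]

/-- Jacobi's formula. -/
theorem fderiv_det {A : Coord n → Matrix (Fin n) (Fin n) ℝ} {y : Coord n}
    (hA : ∀ i j, DifferentiableAt ℝ (fun s => A s i j) y) (v : Coord n) :
    fderiv ℝ (fun s => (A s).det) y v =
      ∑ i, ∑ j, (A y).adjugate j i * fderiv ℝ (fun s => A s i j) y v := by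
  let D : ContinuousMultilinearMap ℝ (fun _ : Fin n => Fin n → ℝ) ℝ :=
    ⟨(Matrix.detRowAlternating (n := Fin n) (R := ℝ)).toMultilinearMap,
      continuous_id.matrix_det⟩
  have hrow : HasFDerivAt (fun s i j => A s i j)
      (ContinuousLinearMap.pi fun i => ContinuousLinearMap.pi fun j =>
        fderiv ℝ (fun s => A s i j) y) y :=
    hasFDerivAt_pi.2 fun i => hasFDerivAt_pi.2 fun j => (hA i j).hasFDerivAt
  have h := (D.hasFDerivAt (fun i j => A y i j)).comp y hrow
  have h2 : HasFDerivAt (fun s => (A s).det) _ y := h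
  rw [h2.fderiv, ContinuousLinearMap.comp_apply, ContinuousMultilinearMap.linearDeriv_apply]
  refine Finset.sum_congr rfl fun i _ => ?_
  have := det_updateRow_eq_sum_adjugate (A y) i fun j => fderiv ℝ (fun s => A s i j) y v
  refine Eq.trans ?_ (this.trans (Finset.sum_congr rfl fun j _ => mul_comm _ _))
  rfl

namespace IsMetricMatrix

/-- The contraction of the Christoffel symbols is the logarithmic derivative of the density. -/
theorem fderiv_det_eq (hg : IsMetricMatrix U g) {y : Coord n} (hy : y ∈ U) (v : Coord n) :
    fderiv ℝ (fun s => (g s).det) y v =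
      2 * (g y).det * traceCLM ((christoffelForm g y).flip v) := by
  have hd := (hg.posDef y hy).det_pos.ne'
  have hinv : ∀ i j, (g y).adjugate i j = (g y).det * (g y)⁻¹ i j := fun i j => by
    rw [Matrix.inv_def, Ring.inverse_eq_inv', Matrix.smul_apply, smul_eq_mul,
      mul_inv_cancel_left₀ hd]
  have hT : (g y)⁻¹.transpose = (g y)⁻¹ := by
    rw [Matrix.transpose_nonsing_inv]
    congr 1
    ext i j
    exact hg.symm hy _ _
  have hsi : ∀ i j, (g y)⁻¹ i j = (g y)⁻¹ j i := fun i j => congrFun (congrFun hT j) i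
  have hp : ∀ k i j, partialDeriv k (fun z => g z i j) y = partialDeriv k (fun z => g z j i) y := by
    intro k i j
    rw [partialDeriv, partialDeriv, Filter.EventuallyEq.fderiv_eq]
    filter_upwards [hg.isOpen.mem_nhds hy] with s hs using hg.symm hs i j
  have hc : ∀ k, ∑ i, christoffel g i i k y =
      (1 / 2 : ℝ) * ∑ i, ∑ l, (g y)⁻¹ i l * partialDeriv k (fun z => g z i l) y := by
    intro k
    simp only [christoffel, ← Finset.mul_sum, mul_sub, mul_add, Finset.sum_sub_distrib,
      Finset.sum_add_distrib]
    -- Contracting the Christoffel symbols with the symmetric g⁻¹ cancels two of their three terms;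
    -- the remaining one is the logarithmic derivative in Jacobi's formula.
    have : ∑ i, ∑ l, (g y)⁻¹ i l * partialDeriv i (fun z => g z k l) y =
        ∑ i, ∑ l, (g y)⁻¹ i l * partialDeriv l (fun z => g z i k) y := by
      rw [Finset.sum_comm]
      exact Finset.sum_congr rfl fun i _ => Finset.sum_congr rfl fun l _ => by
        rw [hsi, hp l k i]
    rw [this]
    ring
  have hstd : ∀ k, fderiv ℝ (fun s => (g s).det) y (stdVec k) =
      2 * (g y).det * traceCLM ((christoffelForm g y).flip (stdVec k)) := by
    intro k
    rw [fderiv_det fun i j => (hg.contDiffAt hy i j).differentiableAt (by simp),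
      traceCLM_eq_sum_stdVec]
    simp only [ContinuousLinearMap.flip_apply, christoffelForm_stdVec]
    rw [hc, Finset.mul_sum, Finset.mul_sum]
    refine Finset.sum_congr rfl fun i _ => ?_
    rw [Finset.mul_sum, Finset.mul_sum]
    refine Finset.sum_congr rfl fun j _ => ?_
    rw [hinv, hsi, partialDeriv]
    change _ * fderiv ℝ (fun z => g z i j) y (stdVec k) = _ * (_ * (_ * fderiv ℝ _ y (stdVec k)))
    ring
  have e1 := map_eq_sum_stdVec (fderiv ℝ (fun s => (g s).det) y).toLinearMap v
  have e2 := map_eq_sum_stdVec (traceCLM.toLinearMap ∘ₗ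
    (christoffelForm g y).flip.toLinearMap) v
  simp only [ContinuousLinearMap.coe_coe, smul_eq_mul, LinearMap.comp_apply] at e1 e2
  rw [e1, e2, Finset.mul_sum]
  refine Finset.sum_congr rfl fun k _ => ?_
  rw [hstd]
  ring

/-- Halving the logarithmic derivative of det g. The zeroth-order term of the covariant divergence
is thus what the product rule adds when √det g is moved inside the derivative. -/
theorem fderiv_sqrt_det (hg : IsMetricMatrix U g) {y : Coord n} (hy : y ∈ U) (v : Coord n) :
    fderiv ℝ (fun s => Real.sqrt (g s).det) y v =
      Real.sqrt (g y).det * traceCLM ((christoffelForm g y).flip v) := by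
  have hd := (hg.posDef y hy).det_pos
  have hdiff : DifferentiableAt ℝ (fun s => (g s).det) y :=
    (contDiffAt_det fun i j => hg.contDiffAt hy i j).differentiableAt (by simp)
  rw [(hdiff.hasFDerivAt.sqrt hd.ne').fderiv, _root_.smul_apply, hg.fderiv_det_eq hy, smul_eq_mul]
  have h := Real.sqrt_pos.2 hd
  have h2 := Real.mul_self_sqrt hd.le
  field_simp
  linear_combination (-traceCLM ((christoffelForm g y).flip v)) * h2

/-- The divergence of a vector field in coordinates. -/
theorem sqrt_det_mul_divergence (hg : IsMetricMatrix U g) {y : Coord n} (hy : y ∈ U)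
    {X : Coord n → Coord n} (hX : DifferentiableAt ℝ X y) :
    Real.sqrt (g y).det * divergence (christoffelForm g) X y =
      traceCLM (fderiv ℝ (fun s => Real.sqrt (g s).det • X s) y) := by
  have hd := (hg.posDef y hy).det_pos
  have hdiff : DifferentiableAt ℝ (fun s => Real.sqrt (g s).det) y :=
    ((contDiffAt_det fun i j => hg.contDiffAt hy i j).sqrt hd.ne').differentiableAt (by simp)
  rw [fderiv_fun_smul hdiff hX, map_add, map_smul, traceCLM_smulRight, hg.fderiv_sqrt_det hy,
    divergence, nablaEnd, map_add, smul_eq_mul]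
  ring

end IsMetricMatrix

/-- The divergence theorem for compactly supported vector fields on `ℝⁿ`. -/
theorem integral_traceCLM_fderiv_eq_zero {Y : Coord n → Coord n} (hY : ContDiff ℝ 1 Y)
    (hc : HasCompactSupport Y) : ∫ y, traceCLM (fderiv ℝ Y y) = 0 := by
  have hcomp : ∀ i, ContDiff ℝ 1 fun y => Y y i := fun i =>
    (EuclideanSpace.proj i : Coord n →L[ℝ] ℝ).contDiff.comp hY
  have hcs : ∀ i, HasCompactSupport fun y => Y y i := fun i =>
    hc.comp_left (g := fun v : Coord n => v i) rfl
  have hd : ∀ i y v, fderiv ℝ (fun s => Y s i) y v = fderiv ℝ Y y v i := fun i y v => by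
    have h := ((EuclideanSpace.proj i : Coord n →L[ℝ] ℝ).hasFDerivAt.comp y
      ((hY.differentiable (by simp)) y).hasFDerivAt)
    have h2 : HasFDerivAt (fun s => Y s i) _ y := h
    rw [h2.fderiv]
    rfl
  have hint : ∀ i, Integrable fun y => fderiv ℝ (fun s => Y s i) y (stdVec i) := fun i =>
    (((hcomp i).continuous_fderiv (by simp)).clm_apply
      continuous_const).integrable_of_hasCompactSupport ((hcs i).fderiv_apply ℝ _)
  have hz : ∀ i, ∫ y, fderiv ℝ (fun s => Y s i) y (stdVec i) = 0 := fun i => by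
    -- Integration by parts against the constant 1, which need not be integrable itself: only its
    -- products with the compactly supported component and its derivative have to be.
    have h := integral_mul_fderiv_eq_neg_fderiv_mul_of_integrable (μ := (volume : Measure (Coord n)))
      (f := fun _ => (1 : ℝ)) (g := fun y => Y y i) (v := stdVec i) (by simp)
      (by simpa using hint i)
      (by simpa using (hcomp i).continuous.integrable_of_hasCompactSupport (hcs i))
      (fun _ _ => differentiableAt_const _) (fun y _ => (hcomp i).differentiable (by simp) y)
    simpa using h
  simp only [traceCLM_eq_sum_stdVec, ← hd]
  rw [integral_finsetSum _ fun i _ => hint i]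
  exact Finset.sum_eq_zero fun i _ => hz i

end Density

/-! ### Smoothness of the curvature in coordinates -/

section CurvatureCoord

variable {n : ℕ} {U : Set (Coord n)} {g : Coord n → Matrix (Fin n) (Fin n) ℝ}

theorem IsMetricMatrix.contDiffAt_ricciCoord (hg : IsMetricMatrix U g) {y : Coord n} (hy : y ∈ U)
    (j k : Fin n) : ContDiffAt ℝ ∞ (ricciCoord g j k) y := by
  unfold ricciCoord
  refine ContDiffAt.sum fun i _ => ?_
  refine ((contDiffAt_fderiv_apply (hg.contDiffAt_christoffel hy _ _ _) _).sub
    (contDiffAt_fderiv_apply (hg.contDiffAt_christoffel hy _ _ _) _)).add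
    (ContDiffAt.sum fun p _ => ?_)
  exact ((hg.contDiffAt_christoffel hy _ _ _).mul (hg.contDiffAt_christoffel hy _ _ _)).sub
    ((hg.contDiffAt_christoffel hy _ _ _).mul (hg.contDiffAt_christoffel hy _ _ _))

theorem IsMetricMatrix.contDiffAt_scalarCoord (hg : IsMetricMatrix U g) {y : Coord n}
    (hy : y ∈ U) : ContDiffAt ℝ ∞ (scalarCoord g) y := by
  unfold scalarCoord
  exact ContDiffAt.sum fun j _ => ContDiffAt.sum fun k _ =>
    (hg.contDiffAt_inv hy j k).mul (hg.contDiffAt_ricciCoord hy j k)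

end CurvatureCoord

/-! ### Continuity of the integrands and the divergence form -/

section Continuity

variable {m : ℕ} {M : Type*} [TopologicalSpace M] [ChartedSpace (Coord m) M]
  [IsManifold (𝓡 m) ∞ M] [RiemannianBundle (fun x : M => TangentSpace (𝓡 m) x)]
  [IsContMDiffRiemannianBundle (𝓡 m) ∞ (EuclideanSpace ℝ (Fin m))
    (fun x : M => TangentSpace (𝓡 m) x)]
  {x₀ x : M} {f φ : M → ℝ} {Ω : Set M}

/-- In either chart the scalar curvature is the trace of the Ricci form over one orthonormal basis,
and the Ricci form does not depend on the chart. -/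
theorem scalarCurvature_eq_scalarCoord (hx : x ∈ (chartAt (Coord m) x₀).source) :
    scalarCurvature m x = scalarCoord (chartMetric m x₀) (chartAt (Coord m) x₀ x) := by
  let b := stdOrthonormalBasis ℝ (TangentSpace (𝓡 m) x)
  have hb : ∀ i j, inner ℝ (b i) (b j) = if i = j then (1 : ℝ) else 0 :=
    orthonormal_iff_ite.1 b.orthonormal
  have hcard : Fintype.card (Fin (Module.finrank ℝ (TangentSpace (𝓡 m) x))) = m := by
    rw [Fintype.card_fin]
    exact finrank_euclideanSpace_fin (𝕜 := ℝ) (n := m)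
  rw [scalarCurvature_eq_sum b hb hcard,
    scalarCoord_eq_sum_of_orthonormal (isMetricMatrix_chartMetric x₀)
    ((chartAt (Coord m) x₀).map_source hx)
    (fun a => mvfderiv (𝓡 m) (chartAt (Coord m) x₀) x (b a))
    (fun i j => by rw [metricForm_chartMetric hx, hb]) hcard]
  exact Finset.sum_congr rfl fun a _ => ricci_eq_ricciForm hx _ _

omit [IsManifold (𝓡 m) ∞ M] [RiemannianBundle (fun x : M => TangentSpace (𝓡 m) x)]
  [IsContMDiffRiemannianBundle (𝓡 m) ∞ (EuclideanSpace ℝ (Fin m))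
    (fun x : M => TangentSpace (𝓡 m) x)] in
-- A quantity defined through a chart that varies with the point becomes continuous once it is
-- expressed in a single chart near `x`.
theorem continuousAt_of_chart {F : M → ℝ} {Φ : Coord m → ℝ} (hΩ : IsOpen Ω) (hΩx : x ∈ Ω)
    (hF : ∀ z ∈ (chartAt (Coord m) x).source, z ∈ Ω → F z = Φ (chartAt (Coord m) x z))
    (hΦ : ContinuousAt Φ (chartAt (Coord m) x x)) : ContinuousAt F x := by
  have hx := mem_chart_source (Coord m) x
  refine (hΦ.comp ((chartAt (Coord m) x).continuousAt hx)).congr ?_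
  filter_upwards [hΩ.mem_nhds hΩx, (chartAt (Coord m) x).open_source.mem_nhds hx] with z hz hz2
  exact (hF z hz2 hz).symm

theorem continuous_scalarCurvature : Continuous (scalarCurvature m (M := M)) :=
  continuous_iff_continuousAt.2 fun x => continuousAt_of_chart isOpen_univ (mem_univ x)
    (fun _ hz _ => scalarCurvature_eq_scalarCoord hz)
    ((isMetricMatrix_chartMetric x).contDiffAt_scalarCoord
      ((chartAt (Coord m) x).map_source (mem_chart_source _ x))).continuousAt

omit [IsManifold (𝓡 m) ∞ M] [RiemannianBundle (fun x : M => TangentSpace (𝓡 m) x)]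
  [IsContMDiffRiemannianBundle (𝓡 m) ∞ (EuclideanSpace ℝ (Fin m))
    (fun x : M => TangentSpace (𝓡 m) x)] in
theorem fieldInChart_chartAt (X : ∀ z : M, TangentSpace (𝓡 m) z)
    (hx : x ∈ (chartAt (Coord m) x₀).source) :
    fieldInChart m X x₀ (chartAt (Coord m) x₀ x) =
      mvfderiv (𝓡 m) (chartAt (Coord m) x₀) x (X x) := by
  rw [fieldInChart, (chartAt (Coord m) x₀).left_inv hx]

omit [IsContMDiffRiemannianBundle (𝓡 m) ∞ (EuclideanSpace ℝ (Fin m))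
    (fun x : M => TangentSpace (𝓡 m) x)] in
theorem inner_grad_eq_chart (hx : x ∈ (chartAt (Coord m) x₀).source)
    (hφ : MDifferentiableAt (𝓡 m) 𝓘(ℝ, ℝ) φ x) (v : TangentSpace (𝓡 m) x) :
    inner ℝ (grad m φ x) v =
      fderiv ℝ (fun s => φ ((chartAt (Coord m) x₀).symm s)) (chartAt (Coord m) x₀ x)
        (mvfderiv (𝓡 m) (chartAt (Coord m) x₀) x v) := by
  rw [inner_grad, fderiv_chart_apply hx hφ]

omit [IsManifold (𝓡 m) ∞ M] [IsContMDiffRiemannianBundle (𝓡 m) ∞ (EuclideanSpace ℝ (Fin m))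
    (fun x : M => TangentSpace (𝓡 m) x)] in
theorem grad_eq_zero_of_notMem_tsupport (hx : x ∉ tsupport φ) : grad m φ x = 0 := by
  have h : φ =ᶠ[𝓝 x] fun _ => 0 := notMem_tsupport_iff_eventuallyEq.1 hx
  have h2 : mvfderiv (𝓡 m) φ x = 0 := by
    ext v
    rw [mvfderiv, h.mfderiv_eq, mfderiv_const]
    rfl
  rw [grad, h2, map_zero]

namespace IsRegularOn

theorem contDiffAt_shapeCoord (h : IsRegularOn m Ω f) {y : Coord m}
    (hy : y ∈ chartRegion m Ω x₀) : ContDiffAt ℝ ∞ (shapeCoord m f x₀) y :=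
  contDiffAt_nablaEnd ((isMetricMatrix_chartMetric x₀).contDiffAt_christoffelForm hy.1)
    (h.contDiffAt_unitNormal hy)

theorem continuousAt_meanCurvature (h : IsRegularOn m Ω f) (hΩx : x ∈ Ω) :
    ContinuousAt (meanCurvature m f) x :=
  continuousAt_of_chart h.isOpen hΩx
    (Φ := fun s => traceCLM (shapeCoord m f x s)) (fun _ hz hzΩ => h.meanCurvature_eq_chart hz hzΩ)
    (traceCLM.continuous.continuousAt.comp
      (h.contDiffAt_shapeCoord (mem_chartRegion (mem_chart_source _ x) hΩx)).continuousAt)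

theorem continuousAt_extrinsicGauss (h : IsRegularOn m Ω f) (hΩx : x ∈ Ω) :
    ContinuousAt (extrinsicGauss m f) x := by
  have hA := (h.contDiffAt_shapeCoord (mem_chartRegion (mem_chart_source _ x) hΩx)).continuousAt
  refine continuousAt_of_chart h.isOpen hΩx
    (Φ := fun s => traceCLM (shapeCoord m f x s) ^ 2 -
      traceCLM ((shapeCoord m f x s).comp (shapeCoord m f x s)))
    (fun _ hz hzΩ => h.extrinsicGauss_eq_chart hz hzΩ) ?_
  exact ((traceCLM.continuous.continuousAt.comp hA).pow 2).sub
    (traceCLM.continuous.continuousAt.comp (hA.clm_comp hA))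

theorem continuousAt_ricci_unitNormal (h : IsRegularOn m Ω f) (hΩx : x ∈ Ω) :
    ContinuousAt (fun z => ricci m z (unitNormal m f z) (unitNormal m f z)) x := by
  have hg := isMetricMatrix_chartMetric (m := m) x
  have hy := mem_chartRegion (m := m) (mem_chart_source _ x) hΩx
  have hu := (h.contDiffAt_unitNormal hy).continuousAt
  have hui : ∀ i, ContinuousAt (fun s => fieldInChart m (unitNormal m f) x s i)
      (chartAt (Coord m) x x) := fun i =>
    (EuclideanSpace.proj i : Coord m →L[ℝ] ℝ).continuous.continuousAt.comp hu
  refine continuousAt_of_chart h.isOpen hΩx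
    (Φ := fun s => ∑ j, ∑ k, ricciCoord (chartMetric m x) j k s *
      fieldInChart m (unitNormal m f) x s j * fieldInChart m (unitNormal m f) x s k)
    (fun z hz hzΩ => ?_) ?_
  · rw [ricci_eq_ricciForm hz, hg.sum_ricciCoord_mul ((chartAt (Coord m) x).map_source hz),
      fieldInChart_chartAt _ hz]
  · exact tendsto_finsetSum _ fun j _ => tendsto_finsetSum _ fun k _ =>
      (((hg.contDiffAt_ricciCoord hy.1 j k).continuousAt.mul (hui j)).mul (hui k))

/-- The definition picks a parametrization separately at each point, so continuity can only be seen
through the Gauss formula. -/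
theorem continuousAt_levelScalarCurvature (h : IsRegularOn m Ω f) (hΩx : x ∈ Ω) :
    ContinuousAt (levelScalarCurvature m f) x := by
  refine (((continuous_scalarCurvature (m := m) (M := M)).continuousAt.sub
    ((h.continuousAt_ricci_unitNormal hΩx).const_mul 2)).add
      (h.continuousAt_extrinsicGauss hΩx)).congr ?_
  filter_upwards [h.isOpen.mem_nhds hΩx] with z hz
  exact (h.levelScalarCurvature_eq hz).symm

theorem continuousAt_inner_unitNormal_grad (h : IsRegularOn m Ω f)
    (hφ : ContMDiff (𝓡 m) 𝓘(ℝ, ℝ) ∞ φ) (hΩx : x ∈ Ω) :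
    ContinuousAt (fun z => inner ℝ (unitNormal m f z) (grad m φ z)) x := by
  have hy := mem_chartRegion (m := m) (mem_chart_source _ x) hΩx
  refine continuousAt_of_chart h.isOpen hΩx
    (Φ := fun s => fderiv ℝ (fun s => φ ((chartAt (Coord m) x).symm s)) s
      (fieldInChart m (unitNormal m f) x s)) (fun z hz hzΩ => ?_) ?_
  · rw [real_inner_comm, inner_grad_eq_chart hz (hφ.mdifferentiable (by simp) z),
      fieldInChart_chartAt _ hz]
  · exact ((contDiffAt_chart h.isOpen hφ.contMDiffOn hy).fderiv_right (m := ∞)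
      (by norm_cast)).continuousAt.clm_apply (h.contDiffAt_unitNormal hy).continuousAt

theorem continuousAt_inner_grad_covDeriv (h : IsRegularOn m Ω f)
    (hφ : ContMDiff (𝓡 m) 𝓘(ℝ, ℝ) ∞ φ) (hΩx : x ∈ Ω) :
    ContinuousAt (fun z => inner ℝ (grad m φ z)
      (covDeriv m (unitNormal m f) z (unitNormal m f z))) x := by
  have hy := mem_chartRegion (m := m) (mem_chart_source _ x) hΩx
  refine continuousAt_of_chart h.isOpen hΩx
    (Φ := fun s => fderiv ℝ (fun s => φ ((chartAt (Coord m) x).symm s)) s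
      (shapeCoord m f x s (fieldInChart m (unitNormal m f) x s))) (fun z hz hzΩ => ?_) ?_
  · rw [inner_grad_eq_chart hz (hφ.mdifferentiable (by simp) z),
      h.mvfderiv_covDeriv_unitNormal hz hzΩ, fieldInChart_chartAt _ hz, shapeCoord]
  · exact ((contDiffAt_chart h.isOpen hφ.contMDiffOn hy).fderiv_right (m := ∞)
      (by norm_cast)).continuousAt.clm_apply
      ((h.contDiffAt_shapeCoord hy).continuousAt.clm_apply
        (h.contDiffAt_unitNormal hy).continuousAt)

end IsRegularOn

/-- The integrand of the Bochner formula for `u = ∇f / |∇f|`, tested against `φ`. -/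
def bochnerIntegrand (m : ℕ) [ChartedSpace (Coord m) M]
    [RiemannianBundle (fun x : M => TangentSpace (𝓡 m) x)] (f φ : M → ℝ) (x : M) : ℝ :=
  φ x * ricci m x (unitNormal m f x) (unitNormal m f x) -
    (φ x * extrinsicGauss m f x
      + meanCurvature m f x * inner ℝ (unitNormal m f x) (grad m φ x)
      - inner ℝ (grad m φ x) (covDeriv m (unitNormal m f) x (unitNormal m f x)))

omit [IsManifold (𝓡 m) ∞ M] [IsContMDiffRiemannianBundle (𝓡 m) ∞ (EuclideanSpace ℝ (Fin m))
    (fun x : M => TangentSpace (𝓡 m) x)] in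
-- Every term contains φ or ∇φ. Hence the values of u, H and G outside `Ω`, where `f` is arbitrary,
-- play no role.
theorem bochnerIntegrand_eq_zero (hx : x ∉ tsupport φ) : bochnerIntegrand m f φ x = 0 := by
  simp [bochnerIntegrand, grad_eq_zero_of_notMem_tsupport (m := m) hx,
    image_eq_zero_of_notMem_tsupport hx]

/-- The vector field `∇_u u - H u` in a chart. -/
def bochnerField (m : ℕ) [ChartedSpace (Coord m) M]
    [RiemannianBundle (fun x : M => TangentSpace (𝓡 m) x)] (f : M → ℝ) (x₀ : M)
    (y : Coord m) : Coord m :=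
  shapeCoord m f x₀ y (fieldInChart m (unitNormal m f) x₀ y) -
    traceCLM (shapeCoord m f x₀ y) • fieldInChart m (unitNormal m f) x₀ y

namespace IsRegularOn

theorem contDiffAt_bochnerField (h : IsRegularOn m Ω f) {y : Coord m}
    (hy : y ∈ chartRegion m Ω x₀) : ContDiffAt ℝ ∞ (bochnerField m f x₀) y :=
  ((h.contDiffAt_shapeCoord hy).clm_apply (h.contDiffAt_unitNormal hy)).sub
    ((traceCLM.contDiff.contDiffAt.comp y (h.contDiffAt_shapeCoord hy)).smul
      (h.contDiffAt_unitNormal hy))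

theorem continuousAt_bochnerIntegrand (h : IsRegularOn m Ω f)
    (hφ : ContMDiff (𝓡 m) 𝓘(ℝ, ℝ) ∞ φ) (hΩx : x ∈ Ω) :
    ContinuousAt (bochnerIntegrand m f φ) x :=
  (hφ.continuous.continuousAt.mul (h.continuousAt_ricci_unitNormal hΩx)).sub
    (((hφ.continuous.continuousAt.mul (h.continuousAt_extrinsicGauss hΩx)).add
      ((h.continuousAt_meanCurvature hΩx).mul
        (h.continuousAt_inner_unitNormal_grad hφ hΩx))).sub
        (h.continuousAt_inner_grad_covDeriv hφ hΩx))

/-- The Bochner integrand is a divergence. -/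
theorem bochnerIntegrand_eq_divergence (h : IsRegularOn m Ω f)
    (hφ : ContMDiff (𝓡 m) 𝓘(ℝ, ℝ) ∞ φ) (hx : x ∈ (chartAt (Coord m) x₀).source) (hΩx : x ∈ Ω) :
    bochnerIntegrand m f φ x = divergence (christoffelForm (chartMetric m x₀))
      (fun s => φ ((chartAt (Coord m) x₀).symm s) • bochnerField m f x₀ s)
      (chartAt (Coord m) x₀ x) := by
  have hy := mem_chartRegion (m := m) hx hΩx
  have hg := isMetricMatrix_chartMetric (m := m) x₀
  have hLC := isLeviCivita_chart (m := m) x₀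
  have hd := divergence_bochner (hg.contDiffAt_christoffelForm hy.1) (h.contDiffAt_unitNormal hy)
    (by filter_upwards [hg.isOpen.mem_nhds hy.1] with s hs using hLC.connection_symm s hs)
  rw [divergence_smul
    ((contDiffAt_chart h.isOpen hφ.contMDiffOn hy).differentiableAt (by simp))
    ((h.contDiffAt_bochnerField hy).differentiableAt (by simp))]
  have hd2 : divergence (christoffelForm (chartMetric m x₀)) (bochnerField m f x₀)
      (chartAt (Coord m) x₀ x) = _ := hd
  have e1 := inner_grad_eq_chart hx (hφ.mdifferentiable (by simp) x)
    (covDeriv m (unitNormal m f) x (unitNormal m f x))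
  have e2 := inner_grad_eq_chart hx (hφ.mdifferentiable (by simp) x) (unitNormal m f x)
  rw [h.mvfderiv_covDeriv_unitNormal hx hΩx] at e1
  rw [hd2, bochnerIntegrand, real_inner_comm (grad m φ x) (unitNormal m f x), e1, e2,
    h.meanCurvature_eq_chart hx hΩx, h.extrinsicGauss_eq_chart hx hΩx, ricci_eq_ricciForm hx,
    bochnerField, ← fieldInChart_chartAt _ hx, (chartAt (Coord m) x₀).left_inv hx, map_sub,
    map_smul, smul_eq_mul]
  simp only [shapeCoord, divergence]
  ring

end IsRegularOn

end Continuity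

/-! ### Integration of the Bochner identity -/

section IntegralFormula

variable {m : ℕ} {M : Type*} [TopologicalSpace M] [ChartedSpace (Coord m) M]
  [RiemannianBundle (fun x : M => TangentSpace (𝓡 m) x)]
  {f φ : M → ℝ} {Ω : Set M}

theorem grad_sum {ι : Type*} (S : Finset ι) {ψ : ι → M → ℝ} {x : M}
    (hψ : ∀ i, MDifferentiableAt (𝓡 m) 𝓘(ℝ, ℝ) (ψ i) x) :
    MDifferentiableAt (𝓡 m) 𝓘(ℝ, ℝ) (fun z => ∑ i ∈ S, ψ i z) x ∧
      grad m (fun z => ∑ i ∈ S, ψ i z) x = ∑ i ∈ S, grad m (ψ i) x := by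
  classical
  induction S using Finset.induction_on with
  | empty =>
    simp only [Finset.sum_empty]
    refine ⟨mdifferentiableAt_const, ?_⟩
    rw [grad, mvfderiv_const, map_zero]
  | insert a S ha ih =>
    simp only [Finset.sum_insert ha]
    refine ⟨(hψ a).add ih.1, ?_⟩
    rw [← ih.2, grad, mvfderiv_fun_add (hψ a) ih.1, map_add]
    rfl

/-- The integrand is linear in φ, which is what permits a partition of unity. -/
theorem bochnerIntegrand_sum {ι : Type*} (S : Finset ι) {ψ : ι → M → ℝ} {x : M}
    (hψ : ∀ i, MDifferentiableAt (𝓡 m) 𝓘(ℝ, ℝ) (ψ i) x) :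
    bochnerIntegrand m f (fun z => ∑ i ∈ S, ψ i z) x = ∑ i ∈ S, bochnerIntegrand m f (ψ i) x := by
  simp only [bochnerIntegrand, (grad_sum S hψ).2, Finset.sum_sub_distrib, Finset.sum_add_distrib,
    Finset.sum_mul, sum_inner, inner_sum, Finset.mul_sum]

/-- Continuity is only needed on the closed support of `F`, which lies in that of φ and so in `Ω`.
-/
theorem continuous_of_eq_zero_of_notMem {F : M → ℝ} (hF : ∀ x ∈ Ω, ContinuousAt F x)
    (hφΩ : tsupport φ ⊆ Ω) (h0 : ∀ x ∉ tsupport φ, F x = 0) : Continuous F :=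
  continuous_of_tsupport fun x hx => hF x (hφΩ (closure_minimal (s := Function.support F)
    (fun z hz => by_contra fun h => hz (h0 z h)) (isClosed_tsupport φ) hx))

variable [IsManifold (𝓡 m) ∞ M]
  [IsContMDiffRiemannianBundle (𝓡 m) ∞ (EuclideanSpace ℝ (Fin m))
    (fun x : M => TangentSpace (𝓡 m) x)]
  [MeasurableSpace M] [BorelSpace M] [SecondCountableTopology M]

theorem integrable_of_eq_zero_of_notMem [T2Space M] {F : M → ℝ} (hF : ∀ x ∈ Ω, ContinuousAt F x)
    (hφΩ : tsupport φ ⊆ Ω) (hφc : HasCompactSupport φ) (h0 : ∀ x ∉ tsupport φ, F x = 0) :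
    Integrable F (riemannianVolume m M) :=
  have := isLocallyFiniteMeasure_riemannianVolume (m := m) (M := M)
  (continuous_of_eq_zero_of_notMem hF hφΩ h0).integrable_of_hasCompactSupport
    (HasCompactSupport.intro hφc h0)

namespace IsRegularOn

/-- With the support of φ inside one chart, the integral is that of the flat divergence of √det g ·
φ(∇_u u - H u). -/
theorem integral_bochnerIntegrand_of_subset (h : IsRegularOn m Ω f)
    (hφ : ContMDiff (𝓡 m) 𝓘(ℝ, ℝ) ∞ φ) (hφc : HasCompactSupport φ) (hφΩ : tsupport φ ⊆ Ω) {x₀ : M}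
    (hφs : tsupport φ ⊆ (chartAt (Coord m) x₀).source) :
    ∫ x, bochnerIntegrand m f φ x ∂(riemannianVolume m M) = 0 := by
  set e := chartAt (Coord m) x₀ with he
  have hg := isMetricMatrix_chartMetric (m := m) x₀
  set K : Set (Coord m) := e '' tsupport φ with hK
  have hKc : IsCompact K := IsCompact.image_of_continuousOn hφc (e.continuousOn.mono hφs)
  have hKr : K ⊆ chartRegion m Ω x₀ := by
    rintro _ ⟨x, hx, rfl⟩
    exact mem_chartRegion (hφs hx) (hφΩ hx)
  have hnot : ∀ y ∈ e.target, y ∉ K → e.symm y ∉ tsupport φ := fun y hy hyK hx =>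
    hyK ⟨_, hx, e.right_inv hy⟩
  set Z : Coord m → Coord m := fun s => chartDensity m x₀ s •
    (φ (e.symm s) • bochnerField m f x₀ s) with hZ
  -- Extension by zero is smooth: `Z` vanishes off the compact set `K`, which lies inside the open
  -- target.
  set Y : Coord m → Coord m := e.target.indicator Z with hY
  have hY0 : ∀ y ∉ K, Y y = 0 := fun y hy => by
    by_cases hyt : y ∈ e.target
    · rw [hY, indicator_of_mem hyt, hZ]
      simp only [image_eq_zero_of_notMem_tsupport (hnot y hyt hy), zero_smul, smul_zero]
    · exact indicator_of_notMem hyt _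
  have hYe : ∀ y ∉ K, Y =ᶠ[𝓝 y] fun _ => 0 := fun y hy => by
    filter_upwards [hKc.isClosed.isOpen_compl.mem_nhds hy] with s hs using hY0 s hs
  have hYZ : ∀ y ∈ e.target, Y =ᶠ[𝓝 y] Z := fun y hy => by
    filter_upwards [e.open_target.mem_nhds hy] with s hs using indicator_of_mem hs _
  have hW : ∀ y ∈ K, ContDiffAt ℝ ∞ (fun s => φ (e.symm s) • bochnerField m f x₀ s) y :=
    fun y hy => (contDiffAt_chart h.isOpen hφ.contMDiffOn (hKr hy)).smul
      (h.contDiffAt_bochnerField (hKr hy))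
  have hYd : ContDiff ℝ 1 Y := contDiff_iff_contDiffAt.2 fun y => by
    by_cases hy : y ∈ K
    · exact (((contDiffAt_chartDensity (hKr hy).1).smul (hW y hy)).congr_of_eventuallyEq
        (hYZ y (hKr hy).1)).of_le (by norm_cast)
    · exact contDiffAt_const.congr_of_eventuallyEq (hYe y hy)
  have hYd0 : ∀ y ∉ K, fderiv ℝ Y y = 0 := fun y hy => by
    rw [(hYe y hy).fderiv_eq, fderiv_fun_const]
    rfl
  have hYi : ∫ y in e.target, traceCLM (fderiv ℝ Y y) = ∫ y, traceCLM (fderiv ℝ Y y) :=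
    setIntegral_eq_integral_of_forall_compl_eq_zero fun y hy => by
      rw [hYd0 y fun hyK => hy (hKr hyK).1, map_zero]
  have hF : Continuous (bochnerIntegrand m f φ) :=
    continuous_of_eq_zero_of_notMem (fun x hx => h.continuousAt_bochnerIntegrand hφ hx) hφΩ
      fun x hx => bochnerIntegrand_eq_zero hx
  rw [integral_riemannianVolume_of_support (x₀ := x₀) hF fun x hx => hφs
    (by_contra fun hx2 => hx (bochnerIntegrand_eq_zero hx2)),
    ← integral_traceCLM_fderiv_eq_zero hYd (HasCompactSupport.intro hKc hY0), ← hYi]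
  refine setIntegral_congr_fun e.open_target.measurableSet fun y hy => ?_
  by_cases hyK : y ∈ K
  · have h1 := hg.sqrt_det_mul_divergence hy ((hW y hyK).differentiableAt (by simp))
    have h2 := h.bochnerIntegrand_eq_divergence hφ (e.map_target hy) (hKr hyK).2
    rw [e.right_inv hy] at h2
    rw [(hYZ y hy).fderiv_eq, h2]
    exact h1
  · rw [hYd0 y hyK, map_zero, bochnerIntegrand_eq_zero (hnot y hy hyK), mul_zero]

variable [T2Space M]

/-- Cut φ into pieces ρᵢφ, each supported in a chart. Compactness of the support leaves finitely
many of them, and the integral of each vanishes. -/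
theorem integral_bochnerIntegrand (h : IsRegularOn m Ω f)
    (hφ : ContMDiff (𝓡 m) 𝓘(ℝ, ℝ) ∞ φ) (hφc : HasCompactSupport φ) (hφΩ : tsupport φ ⊆ Ω) :
    ∫ x, bochnerIntegrand m f φ x ∂(riemannianVolume m M) = 0 := by
  have : LocallyCompactSpace M := ChartedSpace.locallyCompactSpace (Coord m) M
  obtain ⟨ρ, hρ⟩ := SmoothPartitionOfUnity.exists_isSubordinate_chartAt_source_of_isClosed
    (I := 𝓡 m) (isClosed_tsupport φ)
  have hfin := ρ.locallyFinite.finite_nonempty_inter_compact hφc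
  set S := hfin.toFinset with hS
  set ψ : tsupport φ → M → ℝ := fun i x => ρ i x * φ x with hψ
  have hψs : ∀ i, ContMDiff (𝓡 m) 𝓘(ℝ, ℝ) ∞ (ψ i) := fun i => (ρ i).contMDiff.mul hφ
  have hψφ : ∀ i, tsupport (ψ i) ⊆ tsupport φ := fun i => tsupport_mul_subset_right
  have hψρ : ∀ i, tsupport (ψ i) ⊆ tsupport (ρ i) := fun i => tsupport_mul_subset_left
  have hψc : ∀ i, HasCompactSupport (ψ i) := fun i => hφc.mul_left
  have hsum : φ = fun x => ∑ i ∈ S, ψ i x := by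
    funext x
    by_cases hx : x ∈ tsupport φ
    · have h1 := ρ.sum_eq_one hx
      rw [finsum_eq_sum_of_support_subset (s := S) _ fun i hi => by
        rw [hS, hfin.coe_toFinset]
        exact ⟨x, hi, hx⟩] at h1
      simp only [hψ]
      rw [← Finset.sum_mul, h1, one_mul]
    · simp [hψ, image_eq_zero_of_notMem_tsupport hx]
  have hD : ∀ x, bochnerIntegrand m f φ x = ∑ i ∈ S, bochnerIntegrand m f (ψ i) x := fun x => by
    conv_lhs => rw [hsum]
    exact bochnerIntegrand_sum S fun i => (hψs i).mdifferentiable (by simp) x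
  simp only [hD]
  rw [integral_finsetSum _ fun i _ => integrable_of_eq_zero_of_notMem
    (fun x hx => h.continuousAt_bochnerIntegrand (hψs i) hx) ((hψφ i).trans hφΩ) (hψc i)
    fun x hx => bochnerIntegrand_eq_zero hx]
  exact Finset.sum_eq_zero fun i _ => h.integral_bochnerIntegrand_of_subset (hψs i) (hψc i)
    ((hψφ i).trans hφΩ) ((hψρ i).trans (hρ i))

end IsRegularOn

end IntegralFormula

end RiemannianGeometry

end

/-! ### The two integral formulas -/

open RiemannianGeometry in
theorem mainTheorem11 {m : ℕ} {M : Type*} [TopologicalSpace M] [T2Space M]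
    [SecondCountableTopology M] [ChartedSpace (EuclideanSpace ℝ (Fin m)) M]
    [IsManifold (𝓡 m) ∞ M]
    [RiemannianBundle (fun x : M => TangentSpace (𝓡 m) x)]
    [IsContMDiffRiemannianBundle (𝓡 m) ∞ (EuclideanSpace ℝ (Fin m))
      (fun x : M => TangentSpace (𝓡 m) x)]
    [MeasurableSpace M] [BorelSpace M]
    (Ω : Set M) (hΩ : IsOpen Ω)
    (f : M → ℝ) (hf : ContMDiffOn (𝓡 m) 𝓘(ℝ, ℝ) ∞ f Ω)
    (hcrit : ∀ x ∈ Ω, mfderiv (𝓡 m) 𝓘(ℝ, ℝ) f x ≠ 0)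
    (φ : M → ℝ) (hφ : ContMDiff (𝓡 m) 𝓘(ℝ, ℝ) ∞ φ)
    (hφc : HasCompactSupport φ) (hφΩ : tsupport φ ⊆ Ω) :
    (IntegrableOn (fun x => φ x * ricci m x (unitNormal m f x) (unitNormal m f x)) Ω
        (riemannianVolume m M) ∧
      IntegrableOn (fun x => φ x * extrinsicGauss m f x
        + meanCurvature m f x * inner ℝ (unitNormal m f x) (grad m φ x)
        - inner ℝ (grad m φ x) (covDeriv m (unitNormal m f) x (unitNormal m f x))) Ω
        (riemannianVolume m M) ∧
      ∫ x in Ω, φ x * ricci m x (unitNormal m f x) (unitNormal m f x) ∂(riemannianVolume m M) =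
        ∫ x in Ω, (φ x * extrinsicGauss m f x
          + meanCurvature m f x * inner ℝ (unitNormal m f x) (grad m φ x)
          - inner ℝ (grad m φ x) (covDeriv m (unitNormal m f) x (unitNormal m f x)))
          ∂(riemannianVolume m M)) ∧
    (IntegrableOn (fun x => φ x * strange m x (unitNormal m f x)) Ω (riemannianVolume m M) ∧
      IntegrableOn (fun x => meanCurvature m f x * inner ℝ (unitNormal m f x) (grad m φ x)
        - inner ℝ (grad m φ x) (covDeriv m (unitNormal m f) x (unitNormal m f x))) Ω
        (riemannianVolume m M) ∧
      IntegrableOn (fun x => φ x * levelScalarCurvature m f x) Ω (riemannianVolume m M) ∧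
      ∫ x in Ω, φ x * strange m x (unitNormal m f x) ∂(riemannianVolume m M) =
        (∫ x in Ω, (meanCurvature m f x * inner ℝ (unitNormal m f x) (grad m φ x)
          - inner ℝ (grad m φ x) (covDeriv m (unitNormal m f) x (unitNormal m f x)))
          ∂(riemannianVolume m M))
        + (∫ x in Ω, φ x * levelScalarCurvature m f x ∂(riemannianVolume m M))) := by
  have h : IsRegularOn m Ω f := ⟨hΩ, hf, hcrit⟩
  have hφ0 : ∀ x ∉ tsupport φ, φ x = 0 := fun x hx => image_eq_zero_of_notMem_tsupport hx
  have hg0 : ∀ x ∉ tsupport φ, grad m φ x = 0 := fun x hx => grad_eq_zero_of_notMem_tsupport hx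
  set vol := riemannianVolume m M with hvol
  set R : M → ℝ := fun x => φ x * ricci m x (unitNormal m f x) (unitNormal m f x) with hR
  set B : M → ℝ := fun x => meanCurvature m f x * inner ℝ (unitNormal m f x) (grad m φ x)
    - inner ℝ (grad m φ x) (covDeriv m (unitNormal m f) x (unitNormal m f x)) with hB
  set G : M → ℝ := fun x => φ x * extrinsicGauss m f x with hG
  set L : M → ℝ := fun x => φ x * levelScalarCurvature m f x with hL
  have iR : Integrable R vol := integrable_of_eq_zero_of_notMem
    (fun x hx => hφ.continuous.continuousAt.mul (h.continuousAt_ricci_unitNormal hx)) hφΩ hφc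
    fun x hx => by simp [hR, hφ0 x hx]
  have iG : Integrable G vol := integrable_of_eq_zero_of_notMem
    (fun x hx => hφ.continuous.continuousAt.mul (h.continuousAt_extrinsicGauss hx)) hφΩ hφc
    fun x hx => by simp [hG, hφ0 x hx]
  have iL : Integrable L vol := integrable_of_eq_zero_of_notMem
    (fun x hx => hφ.continuous.continuousAt.mul (h.continuousAt_levelScalarCurvature hx)) hφΩ hφc
    fun x hx => by simp [hL, hφ0 x hx]
  have iB : Integrable B vol := integrable_of_eq_zero_of_notMem
    (fun x hx => ((h.continuousAt_meanCurvature hx).mul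
      (h.continuousAt_inner_unitNormal_grad hφ hx)).sub
      (h.continuousAt_inner_grad_covDeriv hφ hx)) hφΩ hφc
    fun x hx => by simp [hB, hg0 x hx]
  have eG : (fun x => φ x * extrinsicGauss m f x
      + meanCurvature m f x * inner ℝ (unitNormal m f x) (grad m φ x)
      - inner ℝ (grad m φ x) (covDeriv m (unitNormal m f) x (unitNormal m f x))) =
      fun x => G x + B x := by
    funext x
    simp only [hG, hB]
    ring
  -- The integrands vanish off the support of φ, so integrating over `Ω` or over `M` is the same,
  -- and the divergence theorem on `M` applies.
  have hzero : ∀ F : M → ℝ, (∀ x ∉ tsupport φ, F x = 0) → ∫ x in Ω, F x ∂vol = ∫ x, F x ∂vol :=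
    fun F hF => setIntegral_eq_integral_of_forall_compl_eq_zero fun x hx =>
      hF x fun hxt => hx (hφΩ hxt)
  have hmain : ∫ x in Ω, R x ∂vol = ∫ x in Ω, G x ∂vol + ∫ x in Ω, B x ∂vol := by
    have h0 := h.integral_bochnerIntegrand hφ hφc hφΩ
    have e0 : bochnerIntegrand m f φ = fun x => R x - (G x + B x) := by
      funext x
      simp only [bochnerIntegrand, hR, hG, hB]
      ring
    have h1 : ∫ x, (R x - (G x + B x)) ∂vol = ∫ x, R x ∂vol - ∫ x, (G x + B x) ∂vol :=
      integral_sub iR (iG.add iB)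
    rw [integral_add iG iB] at h1
    rw [e0] at h0
    rw [hzero R fun x hx => by simp [hR, hφ0 x hx], hzero G fun x hx => by simp [hG, hφ0 x hx],
      hzero B fun x hx => by simp [hB, hg0 x hx]]
    linarith
  -- Gauss formula rearranged: Str(u) = Ric(u,u) + Int_f - G. Substituting the first formula then
  -- cancels the integral of φG.
  have eS : EqOn (fun x => φ x * strange m x (unitNormal m f x)) (fun x => R x + L x - G x) Ω := by
    intro x hx
    simp only [hR, hL, hG, strange, h.levelScalarCurvature_eq hx]
    ring
  have iRL : IntegrableOn (fun x => R x + L x) Ω vol := (iR.add iL).integrableOn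
  refine ⟨⟨iR.integrableOn, ?_, ?_⟩, ?_, iB.integrableOn, iL.integrableOn, ?_⟩
  · rw [eG]
    exact (iG.add iB).integrableOn
  · rw [eG, integral_add iG.integrableOn iB.integrableOn, hmain]
  · exact (integrableOn_congr_fun eS hΩ.measurableSet).2 (iRL.sub iG.integrableOn)
  · rw [setIntegral_congr_fun hΩ.measurableSet eS, integral_sub iRL iG.integrableOn,
      integral_add iR.integrableOn iL.integrableOn, hmain]
    ring
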